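/- Let $d\ge 2$, write $x^\perp=x\cdot e_1$ for $x\in\mathbb R^d$, and use the summation convention. Let $a:\mathbb R^d\to\mathbb R^{d\times d}$ be a measurable coefficient field of the form $a=a_-$ for $x^\perp<-1$, $a=a_\circ$ for $-1<x^\perp<1$, $a=a_+$ for $x^\perp>1$, and let $\bar a=\bar a_+$ for $x^\perp>0$, $\bar a=\bar a_-$ for $x^\perp<0$, with constant matrices $\bar a_\pm$. Both fields are assumed to satisfy, with a constant $\lambda>0$, for (almost) every $x$ and all $\xi\in\mathbb R^d$, $$\lambda|\xi|^2\le \xi\cdot a(x)\xi,\qquad \lambda|\xi|^2\le \xi\cdot a(x)^{-1}\xi .$$ For $1\le k\le d$ let $P_k(x)=x\cdot e_k$ if $x^\perp<0$ and $P_k(x)=x\cdot e_k+\frac{(\bar a_-)_{1k}-(\bar a_+)_{1k}}{(\bar a_+)_{11}}\,x\cdot e_1$ if $x^\perp>0$. A function $f\in L^2_{\rm loc}(\mathbb R^d)$ is strictly sublinear if $\lim_{r\to\infty}\frac1r\big\langle|f-\langle f\rangle_{0,r}|^2\big\rangle_{0,r}^{1/2}=0$, where $\langle g\rangle_{x_0,r}:=\frac1{|B(x_0,r)|}\int_{B(x_0,r)}g(x)\,dx$.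 A generalized ungauged corrector $(\phi,\sigma^{\rm u})$ consists of strictly sublinear functions $\phi_k\in H^1_{\rm loc}(\mathbb R^d)$ and $\sigma^{\rm u}_{ijk}\in L^2_{\rm loc}(\mathbb R^d)$, $1\le i,j,k\le d$, such that, weakly in $\mathbb R^d$, $$-\operatorname{div}\big(a\nabla(P_k+\phi_k)\big)=0,\qquad \partial_i\sigma^{\rm u}_{ijk}=\bar a_{jl}\partial_lP_k-a_{jl}(\partial_lP_k+\partial_l\phi_k),\qquad \sigma^{\rm u}_{ijk}=-\sigma^{\rm u}_{jik}.$$ For a function $u\in H^1(B(x_0,r))$ the excess is $$\mathcal E(x_0,r)[u]=\inf_{\xi\in\mathbb R^d}\Big\langle\big|\nabla u-\xi_k(\nabla P_k+\nabla\phi_k)\big|^2\Big\rangle_{x_0,r} .$$ Theorem. For every $d\ge2$, $\lambda>0$ and $\alpha\in(0,1)$ there is a constant $\delta=\delta(d,\lambda,\alpha)>0$ such that the following holds for all $a$, $\bar a$ and $(\phi,\sigma^{\rm u})$ as above. Let $x_0\in\mathbb R^d$ and $r_{\max}>r^\star>0$, and assume that $$\sup_{r\in[r^\star,r_{\max}]}\frac1r\Big\langle\big|(\phi,\sigma^{\rm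 u})-\langle(\phi,\sigma^{\rm u})\rangle_{x_0,r}\big|^2\Big\rangle_{x_0,r}^{1/2}\le\delta .$$ (i) For every $R\in[r^\star,r_{\max}]$, every $u\in H^1(B(x_0,R))$ that is $a$-harmonic in $B(x_0,R)$ (that is, $-\operatorname{div}(a\nabla u)=0$ weakly) and every $r\in[r^\star,R]$, $$\mathcal E(x_0,r)[u]\le\delta^{-1}\Big(\frac rR\Big)^{2\alpha}\mathcal E(x_0,R)[u].$$ (ii) For every $\xi\in\mathbb R^d$ and $r\in[r^\star,r_{\max}/2]$, $$\delta|\xi|^2\le\Big\langle\big|\xi_k(\nabla P_k+\nabla\phi_k)\big|^2\Big\rangle_{x_0,r}\le\delta^{-1}|\xi|^2 .$$ (iii) For all $r^\star\le r\le R\le r_{\max}$ and every $u\in H^1(B(x_0,R))$ that is $a$-harmonic in $B(x_0,R)$, $$\big\langle|\nabla u|^2\big\rangle_{x_0,r}\le\delta^{-1}\big\langle|\nabla u|^2\big\rangle_{x_0,R} .$$ -/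

import Mathlib

open MeasureTheory Set Filter Topology
open scoped ContDiff Matrix

noncomputable section

/-- Points (and vectors) of `ℝ^d` with the Euclidean norm. The coordinate `x 0` is the
coordinate `x^⊥ = x · e₁` orthogonal to the interface. -/
abbrev Space (d : ℕ) := EuclideanSpace ℝ (Fin d)

/-- Coefficient fields `ℝ^d → ℝ^{d×d}`. -/
abbrev CoeffField (d : ℕ) := Space d → Matrix (Fin d) (Fin d) ℝ

/-- The canonical basis vector `e_i`. -/
abbrev basisVec {d : ℕ} (i : Fin d) : Space d := EuclideanSpace.single i (1 : ℝ)

/-- Classical partial derivative `∂_i ψ (x)`; only used for smooth `ψ`. -/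
def partialDeriv {d : ℕ} (i : Fin d) (ψ : Space d → ℝ) (x : Space d) : ℝ :=
  fderiv ℝ ψ x (basisVec i)

/-- `ψ ∈ C_c^∞(U)`. -/
structure IsTestFunction {d : ℕ} (U : Set (Space d)) (ψ : Space d → ℝ) : Prop where
  smooth : ContDiff ℝ ∞ ψ
  compact : HasCompactSupport ψ
  support_subset : tsupport ψ ⊆ U

/-- `f ∈ L²_loc(ℝ^d)`. -/
def IsL2Loc {d : ℕ} (f : Space d → ℝ) : Prop :=
  ∀ r : ℝ, 0 < r → MemLp f 2 (volume.restrict (Metric.ball 0 r))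

/-- `f ∈ H¹(U)` with weak gradient `G`. -/
structure IsH1On {d : ℕ} (U : Set (Space d)) (f : Space d → ℝ) (G : Space d → Space d) :
    Prop where
  memLp_fun : MemLp f 2 (volume.restrict U)
  memLp_grad : MemLp G 2 (volume.restrict U)
  weak_grad : ∀ ψ : Space d → ℝ, IsTestFunction U ψ → ∀ i : Fin d,
    ∫ x in U, f x * partialDeriv i ψ x = -∫ x in U, G x i * ψ x

/-- `f ∈ H¹_loc(ℝ^d)` with weak gradient `G`. -/
def IsH1Loc {d : ℕ} (f : Space d → ℝ) (G : Space d → Space d) : Prop :=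
  ∀ r : ℝ, 0 < r → IsH1On (Metric.ball 0 r) f G

/-- The weak equation `div F = h` in `U`, tested against `C_c^∞(U)`. -/
def WeakDivEqOn {d : ℕ} (U : Set (Space d)) (F : Space d → Fin d → ℝ) (h : Space d → ℝ) :
    Prop :=
  ∀ ψ : Space d → ℝ, IsTestFunction U ψ →
    ∫ x in U, ∑ i, F x i * partialDeriv i ψ x = -∫ x in U, h x * ψ x

/-- The flux `a G`, that is, `x ↦ (a_{ij}(x) G_j(x))_i`. -/
def flux {d : ℕ} (a : CoeffField d) (G : Space d → Space d) (x : Space d) (i : Fin d) : ℝ :=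
  ∑ j, a x i j * G x j

/-- `u ∈ H¹(U)`, with weak gradient `Du`, is `a`-harmonic: `-div (a ∇u) = 0` weakly in `U`. -/
structure IsHarmonicOn {d : ℕ} (a : CoeffField d) (U : Set (Space d)) (u : Space d → ℝ)
    (Du : Space d → Space d) : Prop where
  h1 : IsH1On U u Du
  eqn : WeakDivEqOn U (flux a Du) (fun _ => 0)

/-- `λ |ξ|² ≤ ξ · A ξ` and `λ |ξ|² ≤ ξ · A⁻¹ ξ` for all `ξ ∈ ℝ^d`. -/
def IsEllipticMatrix {d : ℕ} (lam : ℝ) (A : Matrix (Fin d) (Fin d) ℝ) : Prop :=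
  ∀ ξ : Fin d → ℝ, lam * (ξ ⬝ᵥ ξ) ≤ ξ ⬝ᵥ (A *ᵥ ξ) ∧ lam * (ξ ⬝ᵥ ξ) ≤ ξ ⬝ᵥ (A⁻¹ *ᵥ ξ)

/-- A measurable coefficient field that is uniformly elliptic and bounded with constant `λ`. -/
structure IsEllipticField {d : ℕ} (lam : ℝ) (a : CoeffField d) : Prop where
  aemeasurable : ∀ i j, AEMeasurable (fun x => a x i j) volume
  elliptic : ∀ᵐ x ∂(volume : Measure (Space d)), IsEllipticMatrix lam (a x)

/-- The field equal to `a₋` for `x^⊥ < -1`, to `a₊` for `x^⊥ > 1`, and to `a_∘` in the layer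
between. -/
def layeredField {d : ℕ} [NeZero d] (aMinus aCirc aPlus : CoeffField d) : CoeffField d :=
  fun x => if x 0 < -1 then aMinus x else if 1 < x 0 then aPlus x else aCirc x

/-- The piecewise constant field equal to `ā₊` for `x^⊥ > 0` and to `ā₋` for `x^⊥ < 0`. -/
def homogenizedField {d : ℕ} [NeZero d] (abarMinus abarPlus : Matrix (Fin d) (Fin d) ℝ) :
    CoeffField d :=
  fun x => if 0 < x 0 then abarPlus else abarMinus

/-- The `ā`-harmonic coordinate `P_k`. -/
def harmonicCoord {d : ℕ} [NeZero d] (abarMinus abarPlus : Matrix (Fin d) (Fin d) ℝ)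
    (k : Fin d) (x : Space d) : ℝ :=
  if 0 < x 0 then x k + (abarMinus 0 k - abarPlus 0 k) / abarPlus 0 0 * x 0 else x k

/-- The gradient `∇P_k` of the (continuous, piecewise linear) coordinate `P_k`; see
`hasGradientAt_harmonicCoord`. -/
def gradHarmonicCoord {d : ℕ} [NeZero d] (abarMinus abarPlus : Matrix (Fin d) (Fin d) ℝ)
    (k : Fin d) (x : Space d) : Space d :=
  if 0 < x 0 then
    basisVec k + ((abarMinus 0 k - abarPlus 0 k) / abarPlus 0 0) • basisVec 0
  else basisVec k

theorem hasGradientAt_harmonicCoord {d : ℕ} [NeZero d]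
    (abarMinus abarPlus : Matrix (Fin d) (Fin d) ℝ) (k : Fin d) (x : Space d) (hx : x 0 ≠ 0) :
    HasGradientAt (harmonicCoord abarMinus abarPlus k)
      (gradHarmonicCoord abarMinus abarPlus k x) x := by
  have hcont : Continuous (fun y : Space d => y 0) := by fun_prop
  have hlin : ∀ v : Space d, HasGradientAt (fun y : Space d => inner ℝ v y) v x := fun v => by
    rw [hasGradientAt_iff_hasFDerivAt]
    exact (InnerProductSpace.toDual ℝ (Space d) v).hasFDerivAt
  rcases lt_or_gt_of_ne hx with h | h
  · have h1 := hlin (basisVec k)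
    have hg : gradHarmonicCoord abarMinus abarPlus k x = basisVec k := by
      simp [gradHarmonicCoord, not_lt.mpr h.le]
    rw [hg]
    refine h1.congr_of_eventuallyEq ?_
    filter_upwards [hcont.continuousAt.eventually_lt continuousAt_const h] with y hy
    simp [harmonicCoord, not_lt.mpr hy.le, basisVec, EuclideanSpace.inner_single_left]
  · have h1 := hlin (basisVec k + ((abarMinus 0 k - abarPlus 0 k) / abarPlus 0 0) • basisVec 0)
    have hg : gradHarmonicCoord abarMinus abarPlus k x =
        basisVec k + ((abarMinus 0 k - abarPlus 0 k) / abarPlus 0 0) • basisVec 0 := by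
      simp [gradHarmonicCoord, h]
    rw [hg]
    refine h1.congr_of_eventuallyEq ?_
    filter_upwards [continuousAt_const.eventually_lt hcont.continuousAt h] with y hy
    simp [harmonicCoord, hy, inner_add_left, inner_smul_left, basisVec,
      EuclideanSpace.inner_single_left]

/-- Strict sublinearity of `f`:
`(1/r) (⨍_{B(0,r)} |f - ⨍_{B(0,r)} f|²)^{1/2} → 0` as `r → ∞`. -/
def IsStrictlySublinear {d : ℕ} (f : Space d → ℝ) : Prop :=
  Tendsto (fun r : ℝ =>
    1 / r * √(⨍ y in Metric.ball (0 : Space d) r,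
      (f y - ⨍ z in Metric.ball (0 : Space d) r, f z) ^ 2)) atTop (𝓝 0)

/-- `(φ, σ)` is a generalized ungauged corrector for the coefficient field `a` and the
homogenized matrices `ā₋`, `ā₊`, with `∇φ_k = Dφ_k`. In `σ i j k` the skew indices are `i, j`,
and `div (σ_{· j k}) = (ā ∇P_k - a (∇P_k + ∇φ_k))_j`. -/
structure IsUngaugedCorrector {d : ℕ} [NeZero d] (a : CoeffField d)
    (abarMinus abarPlus : Matrix (Fin d) (Fin d) ℝ)
    (φ : Fin d → Space d → ℝ) (Dφ : Fin d → Space d → Space d)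
    (σ : Fin d → Fin d → Fin d → Space d → ℝ) : Prop where
  phi_h1 : ∀ k, IsH1Loc (φ k) (Dφ k)
  phi_sublinear : ∀ k, IsStrictlySublinear (φ k)
  phi_eqn : ∀ k, WeakDivEqOn univ
    (flux a fun x => gradHarmonicCoord abarMinus abarPlus k x + Dφ k x) (fun _ => 0)
  sigma_l2 : ∀ i j k, IsL2Loc (σ i j k)
  sigma_sublinear : ∀ i j k, IsStrictlySublinear (σ i j k)
  sigma_skew : ∀ i j k, ∀ᵐ x ∂(volume : Measure (Space d)), σ i j k x = -σ j i k x
  sigma_eqn : ∀ j k, WeakDivEqOn univ (fun x i => σ i j k x) (fun x =>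
    flux (homogenizedField abarMinus abarPlus) (gradHarmonicCoord abarMinus abarPlus k) x j
      - flux a (fun y => gradHarmonicCoord abarMinus abarPlus k y + Dφ k y) x j)

/-- `(1/r) (⨍_{B(x₀,r)} |(φ,σ) - ⨍_{B(x₀,r)} (φ,σ)|²)^{1/2}`. -/
def correctorOsc {d : ℕ} (φ : Fin d → Space d → ℝ) (σ : Fin d → Fin d → Fin d → Space d → ℝ)
    (x₀ : Space d) (r : ℝ) : ℝ :=
  1 / r * √(⨍ y in Metric.ball x₀ r,
    ((∑ k, (φ k y - ⨍ z in Metric.ball x₀ r, φ k z) ^ 2)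
      + ∑ i, ∑ j, ∑ k, (σ i j k y - ⨍ z in Metric.ball x₀ r, σ i j k z) ^ 2))

/-- `(∇P + ∇φ) · ξ = ξ_k (∇P_k + ∇φ_k)`. -/
def correctedGrad {d : ℕ} [NeZero d] (abarMinus abarPlus : Matrix (Fin d) (Fin d) ℝ)
    (Dφ : Fin d → Space d → Space d) (ξ : Space d) (x : Space d) : Space d :=
  ∑ k, ξ k • (gradHarmonicCoord abarMinus abarPlus k x + Dφ k x)

/-- The excess `𝓔(x₀,r)[u] = inf_ξ ⨍_{B(x₀,r)} |∇u - (∇P + ∇φ) · ξ|²`, with `∇u = Du`. -/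
def excess {d : ℕ} [NeZero d] (abarMinus abarPlus : Matrix (Fin d) (Fin d) ℝ)
    (Dφ : Fin d → Space d → Space d) (Du : Space d → Space d) (x₀ : Space d) (r : ℝ) : ℝ :=
  ⨅ ξ : Space d, ⨍ x in Metric.ball x₀ r,
    ‖Du x - correctedGrad abarMinus abarPlus Dφ ξ x‖ ^ 2

end

/-! The proof is by compactness. All three estimates are invariant under zooming at `x₀`, so they
reduce to statements on the unit ball about correctors whose oscillation is small. The homogenized
problem remembers the zoom only through the height of the interface, a parameter ranging over the
compact space `[-∞, ∞]`; at an infinite height a single phase is left.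

Consider correctors whose oscillation tends to zero on every ball. Because `φ` vanishes in the limit
up to constants, `∇P_k + ∇φ_k` converges weakly to the limiting `∇P_k`. Because `σ` does, and `div
σ` is the difference of the fluxes, the fluxes `a(∇P_k + ∇φ_k)` converge weakly to `ā∇P_k`. The
corrected coordinates therefore act as Tartar's oscillating test functions: if `w` is `a`-harmonic
with bounded energy, the div-curl lemma applied to `w` minus a corrected coordinate gives a
monotonicity inequality in the limit, and Minty's trick turns it into the relation "limit flux = `ā`
times limit gradient" (`eq_flux_of_monotone`). The limit is thus an entire solution for a piecewise
constant field. If its Dirichlet integral grows slower than `r^(d+2)`, a Liouville theorem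
identifies its gradient with some `ξ_k ∇P_k`. The difference of `w` and the corrected coordinate
then has a weakly null gradient, which Rellich and Caccioppoli make strongly null on a smaller ball.
The outcome is `exists_close_correctedComb`.

The Liouville theorem rests on invariance under translations parallel to the interface. A tangential
difference of a solution is again a solution, and Caccioppoli lowers its growth exponent by two;
iterating, tangential differences vanish. Then the tangential components of the gradient and the
normal flux are constant, and these data characterize `ξ_k ∇P_k`.

For the excess decay, take a radius `ρ` that almost maximizes `(R/r)^(2α) 𝓔(r)`. Non-degeneracy of
the corrected gradients (averaging them and their fluxes against a cutoff recovers `ξ`) prevents the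
optimal `ξ` from drifting between dyadic scales. Hence `u` minus the corrected coordinate chosen at
`ρ` has energy growth exponent `d + 2α < d + 2` above `ρ`. If `ρ` were much smaller than `R`,
closeness to a corrected coordinate would bound `𝓔(ρ)` by a quarter of itself. So `ρ` is comparable
to `R`, and comparing volumes finishes. The Lipschitz estimate follows from the decay by summing the
drift of `ξ` over dyadic scales. -/

noncomputable section


/-! ### Real-valued square-integrable functions -/

section SquareIntegrable

variable {X : Type*} [MeasurableSpace X] {μ : Measure X} {f g : X → ℝ}

theorem MeasureTheory.MemLp.integrable_mul_two (hf : MemLp f 2 μ) (hg : MemLp g 2 μ) :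
    Integrable (fun x => f x * g x) μ :=
  hf.integrable_mul hg

theorem MeasureTheory.MemLp.add_two (hf : MemLp f 2 μ) (hg : MemLp g 2 μ) :
    MemLp (fun x => f x + g x) 2 μ :=
  hf.add hg

theorem MeasureTheory.MemLp.sub_two (hf : MemLp f 2 μ) (hg : MemLp g 2 μ) :
    MemLp (fun x => f x - g x) 2 μ :=
  hf.sub hg

/-- The Cauchy–Schwarz inequality. -/
theorem sq_integral_mul_le (hf : MemLp f 2 μ) (hg : MemLp g 2 μ) :
    (∫ x, f x * g x ∂μ) ^ 2 ≤ (∫ x, f x ^ 2 ∂μ) * ∫ x, g x ^ 2 ∂μ := by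
  have key : ∀ t : ℝ, 0 ≤ (∫ x, f x ^ 2 ∂μ) * (t * t) + (2 * ∫ x, f x * g x ∂μ) * t
      + ∫ x, g x ^ 2 ∂μ := by
    intro t
    have h0 : 0 ≤ ∫ x, (t * f x + g x) ^ 2 ∂μ := integral_nonneg fun x => sq_nonneg _
    have h1 : ∫ x, (t * f x + g x) ^ 2 ∂μ = ∫ x, (t ^ 2 * f x ^ 2 + 2 * t * (f x * g x))
        + g x ^ 2 ∂μ := by
      congr 1; ext x; ring
    rw [h1, integral_add ((hf.integrable_sq.const_mul _).fun_add
      ((hf.integrable_mul_two hg).const_mul _)) hg.integrable_sq,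
      integral_add (hf.integrable_sq.const_mul _) ((hf.integrable_mul_two hg).const_mul _),
      integral_const_mul, integral_const_mul] at h0
    linarith
  have := discrim_le_zero key
  unfold discrim at this
  nlinarith

theorem abs_integral_mul_le (hf : MemLp f 2 μ) (hg : MemLp g 2 μ) :
    |∫ x, f x * g x ∂μ| ≤ √(∫ x, f x ^ 2 ∂μ) * √(∫ x, g x ^ 2 ∂μ) := by
  rw [← Real.sqrt_mul (integral_nonneg fun x => sq_nonneg _)]
  exact Real.abs_le_sqrt (sq_integral_mul_le hf hg)

theorem integral_sq_add_le (hf : MemLp f 2 μ) (hg : MemLp g 2 μ) :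
    ∫ x, (f x + g x) ^ 2 ∂μ ≤ 2 * (∫ x, f x ^ 2 ∂μ) + 2 * ∫ x, g x ^ 2 ∂μ := by
  rw [← integral_const_mul, ← integral_const_mul,
    ← integral_add (hf.integrable_sq.const_mul _) (hg.integrable_sq.const_mul _)]
  refine integral_mono (hf.add_two hg).integrable_sq
    ((hf.integrable_sq.const_mul _).add (hg.integrable_sq.const_mul _)) fun x => ?_
  nlinarith [sq_nonneg (f x - g x)]

theorem integral_sq_sub_le (hf : MemLp f 2 μ) (hg : MemLp g 2 μ) :
    ∫ x, (f x - g x) ^ 2 ∂μ ≤ 2 * (∫ x, f x ^ 2 ∂μ) + 2 * ∫ x, g x ^ 2 ∂μ := by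
  have := integral_sq_add_le hf hg.neg
  simpa [sub_eq_add_neg] using this

/-- Strong convergence times a bounded sequence which converges weakly against the limit. -/
theorem tendsto_integral_mul_of_strong_weak {ι : Type*} {l : Filter ι} {F G : ι → X → ℝ}
    {C : ℝ} (hF : ∀ᶠ n in l, MemLp (F n) 2 μ) (hf : MemLp f 2 μ)
    (hG : ∀ᶠ n in l, MemLp (G n) 2 μ)
    (hs : Tendsto (fun n => ∫ x, (F n x - f x) ^ 2 ∂μ) l (𝓝 0))
    (hC : ∀ᶠ n in l, ∫ x, G n x ^ 2 ∂μ ≤ C)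
    (hw : Tendsto (fun n => ∫ x, G n x * f x ∂μ) l (𝓝 (∫ x, g x * f x ∂μ))) :
    Tendsto (fun n => ∫ x, F n x * G n x ∂μ) l (𝓝 (∫ x, f x * g x ∂μ)) := by
  have h1 : Tendsto (fun n => ∫ x, (F n x - f x) * G n x ∂μ) l (𝓝 0) := by
    have h2 : Tendsto (fun n => √(∫ x, (F n x - f x) ^ 2 ∂μ) * √C) l (𝓝 0) := by
      have := (hs.sqrt).mul_const (√C)
      simpa using this
    refine squeeze_zero_norm' ?_ h2
    filter_upwards [hF, hG, hC] with n h3 h4 h5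
    rw [Real.norm_eq_abs]
    refine (abs_integral_mul_le (h3.sub_two hf) h4).trans ?_
    exact mul_le_mul_of_nonneg_left (Real.sqrt_le_sqrt h5) (Real.sqrt_nonneg _)
  have h2 := h1.add hw
  have e : ∫ x, f x * g x ∂μ = 0 + ∫ x, g x * f x ∂μ := by simp only [mul_comm, zero_add]
  rw [e]
  refine h2.congr' ?_
  filter_upwards [hF, hG] with n h3 h4
  rw [← integral_add ((h3.sub_two hf).integrable_mul_two h4) (h4.integrable_mul_two hf)]
  congr 1; ext x; ring

theorem tendsto_integral_mul_of_strong {ι : Type*} {l : Filter ι} {F : ι → X → ℝ}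
    (hF : ∀ᶠ n in l, MemLp (F n) 2 μ) (hf : MemLp f 2 μ) (hg : MemLp g 2 μ)
    (hs : Tendsto (fun n => ∫ x, (F n x - f x) ^ 2 ∂μ) l (𝓝 0)) :
    Tendsto (fun n => ∫ x, F n x * g x ∂μ) l (𝓝 (∫ x, f x * g x ∂μ)) :=
  tendsto_integral_mul_of_strong_weak (G := fun _ => g) (C := ∫ x, g x ^ 2 ∂μ) hF hf
    (Eventually.of_forall fun _ => hg) hs (Eventually.of_forall fun _ => le_rfl)
    tendsto_const_nhds

theorem tendsto_integral_sq_of_strong {ι : Type*} {l : Filter ι} {F : ι → X → ℝ}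
    (hF : ∀ᶠ n in l, MemLp (F n) 2 μ) (hf : MemLp f 2 μ)
    (hs : Tendsto (fun n => ∫ x, (F n x - f x) ^ 2 ∂μ) l (𝓝 0)) :
    Tendsto (fun n => ∫ x, F n x ^ 2 ∂μ) l (𝓝 (∫ x, f x ^ 2 ∂μ)) := by
  have h1 := (tendsto_integral_mul_of_strong hF hf hf hs).const_mul 2
  have h2 := (hs.add h1).sub_const (∫ x, f x ^ 2 ∂μ)
  have e : ∫ x, f x ^ 2 ∂μ = 0 + 2 * (∫ x, f x * f x ∂μ) - ∫ x, f x ^ 2 ∂μ := by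
    simp only [← pow_two]; ring
  rw [e]
  refine h2.congr' ?_
  filter_upwards [hF] with n h3
  rw [← integral_const_mul, ← integral_add (h3.sub_two hf).integrable_sq
    ((h3.integrable_mul_two hf).const_mul _), ← integral_sub _ hf.integrable_sq]
  · congr 1; ext x; ring
  · exact (h3.sub_two hf).integrable_sq.fun_add ((h3.integrable_mul_two hf).const_mul _)

theorem ae_eq_zero_of_integral_sq_eq_zero (hf : MemLp f 2 μ) (h : ∫ x, f x ^ 2 ∂μ = 0) :
    f =ᵐ[μ] 0 := by
  have := (integral_eq_zero_iff_of_nonneg (fun x => sq_nonneg (f x)) hf.integrable_sq).1 h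
  filter_upwards [this] with x hx
  simpa using hx

end SquareIntegrable

/-! ### Balls and test functions -/

section Tests

variable {d : ℕ}

theorem memLp_apply {μ : Measure (Space d)} {G : Space d → Space d} (h : MemLp G 2 μ)
    (i : Fin d) : MemLp (fun x => G x i) 2 μ :=
  (EuclideanSpace.proj (𝕜 := ℝ) i).comp_memLp' h

theorem memLp_of_apply {μ : Measure (Space d)} {G : Space d → Space d}
    (h : ∀ i, MemLp (fun x => G x i) 2 μ) : MemLp G 2 μ := by
  have : G = fun x => ∑ i, (G x i) • (basisVec i : Space d) := by
    ext x j
    simp [Finset.sum_apply, Pi.single_apply]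
  rw [this]
  refine memLp_finsetSum _ fun i _ => ?_
  have := (ContinuousLinearMap.toSpanSingleton ℝ (basisVec i : Space d)).comp_memLp' (h i)
  simpa [Function.comp_def] using this

theorem norm_sq_eq_sum (v : Space d) : ‖v‖ ^ 2 = ∑ i, v i ^ 2 := by
  rw [EuclideanSpace.norm_sq_eq]; simp

theorem integral_norm_sq_eq {μ : Measure (Space d)} {G : Space d → Space d} (h : MemLp G 2 μ) :
    ∫ x, ‖G x‖ ^ 2 ∂μ = ∑ i, ∫ x, G x i ^ 2 ∂μ := by
  simp_rw [norm_sq_eq_sum]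
  exact integral_finsetSum _ fun i _ => (memLp_apply h i).integrable_sq

theorem integrable_norm_sq {μ : Measure (Space d)} {G : Space d → Space d} (h : MemLp G 2 μ) :
    Integrable (fun x => ‖G x‖ ^ 2) μ := by
  simpa using h.norm.integrable_sq

theorem abs_apply_le_norm (v : Space d) (i : Fin d) : |v i| ≤ ‖v‖ := by
  simpa using PiLp.norm_apply_le v i

variable {U V : Set (Space d)} {ψ η : Space d → ℝ}

theorem IsTestFunction.mono (h : IsTestFunction U ψ) (hUV : U ⊆ V) : IsTestFunction V ψ :=
  ⟨h.smooth, h.compact, h.support_subset.trans hUV⟩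

theorem IsTestFunction.mul_smooth (h : IsTestFunction U η) (hψ : ContDiff ℝ ∞ ψ) :
    IsTestFunction U (fun x => η x * ψ x) :=
  ⟨h.smooth.mul hψ, h.compact.mul_right,
    (tsupport_mul_subset_left (f := η) (g := ψ)).trans h.support_subset⟩

theorem contDiff_partialDeriv (h : ContDiff ℝ ∞ ψ) (i : Fin d) :
    ContDiff ℝ ∞ (partialDeriv i ψ) := by
  unfold partialDeriv
  exact (h.fderiv_right (m := ∞) (by simp)).clm_apply contDiff_const

theorem tsupport_partialDeriv_subset (ψ : Space d → ℝ) (i : Fin d) :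
    tsupport (partialDeriv i ψ) ⊆ tsupport ψ := by
  refine (closure_mono ?_).trans (tsupport_fderiv_subset ℝ (f := ψ))
  intro x hx h0
  exact hx (by simp [partialDeriv, h0])

theorem IsTestFunction.partialDeriv (h : IsTestFunction U ψ) (i : Fin d) :
    IsTestFunction U (partialDeriv i ψ) :=
  ⟨contDiff_partialDeriv h.smooth i,
    h.compact.of_isClosed_subset (isClosed_tsupport _) (tsupport_partialDeriv_subset ψ i),
    (tsupport_partialDeriv_subset ψ i).trans h.support_subset⟩

theorem partialDeriv_mul (hη : ContDiff ℝ ∞ η) (hψ : ContDiff ℝ ∞ ψ) (i : Fin d)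
    (x : Space d) :
    partialDeriv i (fun y => η y * ψ y) x
      = η x * partialDeriv i ψ x + ψ x * partialDeriv i η x := by
  unfold partialDeriv
  rw [fderiv_fun_mul (hη.differentiable (by simp) x) (hψ.differentiable (by simp) x)]
  simp

theorem IsTestFunction.memLp (h : IsTestFunction U ψ) (μ : Measure (Space d))
    [IsFiniteMeasureOnCompacts μ] (p : ENNReal) : MemLp ψ p μ :=
  h.smooth.continuous.memLp_of_hasCompactSupport h.compact

theorem IsTestFunction.exists_bound (h : IsTestFunction U ψ) : ∃ C, 0 ≤ C ∧ ∀ x, |ψ x| ≤ C := by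
  obtain ⟨C, hC⟩ := h.smooth.continuous.bounded_above_of_compact_support h.compact
  exact ⟨C, (norm_nonneg _).trans (hC 0), hC⟩

theorem IsTestFunction.eq_zero (h : IsTestFunction U ψ) {x : Space d} (hx : x ∉ U) : ψ x = 0 :=
  image_eq_zero_of_notMem_tsupport fun h' => hx (h.support_subset h')

theorem MeasureTheory.MemLp.mul_test {f : Space d → ℝ} {μ : Measure (Space d)}
    (hf : MemLp f 2 μ) (h : IsTestFunction U ψ) : MemLp (fun x => ψ x * f x) 2 μ := by
  obtain ⟨C, -, hC⟩ := h.exists_bound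
  exact hf.of_le_mul (c := C) (h.smooth.continuous.aestronglyMeasurable.mul hf.1)
    (Eventually.of_forall fun x => by
      rw [norm_mul]; exact mul_le_mul_of_nonneg_right (hC x) (norm_nonneg _))

/-- A test function on a ball is supported in a smaller concentric ball. -/
theorem IsTestFunction.exists_radius {R : ℝ} (hR : 0 < R)
    (h : IsTestFunction (Metric.ball (0 : Space d) R) ψ) :
    ∃ R', 0 < R' ∧ R' < R ∧ IsTestFunction (Metric.ball (0 : Space d) R') ψ := by
  obtain ⟨R', h1, h2⟩ := exists_pos_lt_subset_ball hR h.compact.isClosed h.support_subset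
  exact ⟨R', h1.1, h1.2, h.smooth, h.compact, h2⟩

/-- Passing through the integral over the whole space makes integrals over different domains
comparable, which is how weak equations are restricted and localized below. -/
theorem setIntegral_eq_of_test {S : Set (Space d)} (hUS : U ⊆ S)
    {f : Space d → ℝ} (hf : ∀ x, x ∉ U → f x = 0) :
    ∫ x in S, f x = ∫ x, f x := by
  rw [setIntegral_eq_integral_of_forall_compl_eq_zero]
  intro x hx
  exact hf x fun h => hx (hUS h)

theorem WeakDivEqOn.mono {F : Space d → Fin d → ℝ} {h : Space d → ℝ} (hF : WeakDivEqOn U F h)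
    (hVU : V ⊆ U) : WeakDivEqOn V F h := by
  intro ψ hψ
  have h1 := hF ψ (hψ.mono hVU)
  have e1 : ∀ x, x ∉ V → ∑ i, F x i * partialDeriv i ψ x = 0 := fun x hx =>
    Finset.sum_eq_zero fun i _ => by rw [(hψ.partialDeriv i).eq_zero hx, mul_zero]
  have e2 : ∀ x, x ∉ V → h x * ψ x = 0 := fun x hx => by rw [hψ.eq_zero hx, mul_zero]
  rw [setIntegral_eq_of_test hVU e1, setIntegral_eq_of_test hVU e2] at h1
  rw [setIntegral_eq_of_test Subset.rfl e1, setIntegral_eq_of_test Subset.rfl e2, h1]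

theorem IsH1On.mono {f : Space d → ℝ} {G : Space d → Space d}
    (hf : IsH1On U f G) (hVU : V ⊆ U) : IsH1On V f G := by
  refine ⟨hf.memLp_fun.mono_measure (Measure.restrict_mono hVU le_rfl),
    hf.memLp_grad.mono_measure (Measure.restrict_mono hVU le_rfl), fun ψ hψ i => ?_⟩
  have h1 := hf.weak_grad ψ (hψ.mono hVU) i
  have e1 : ∀ x, x ∉ V → f x * partialDeriv i ψ x = 0 := fun x hx => by
    rw [(hψ.partialDeriv i).eq_zero hx, mul_zero]
  have e2 : ∀ x, x ∉ V → G x i * ψ x = 0 := fun x hx => by rw [hψ.eq_zero hx, mul_zero]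
  rw [setIntegral_eq_of_test hVU e1, setIntegral_eq_of_test hVU e2] at h1
  rw [setIntegral_eq_of_test Subset.rfl e1, setIntegral_eq_of_test Subset.rfl e2, h1]

theorem IsHarmonicOn.mono {a : CoeffField d} {u : Space d → ℝ} {Du : Space d → Space d}
    (h : IsHarmonicOn a U u Du) (hVU : V ⊆ U) :
    IsHarmonicOn a V u Du :=
  ⟨h.h1.mono hVU, h.eqn.mono hVU⟩

instance isFiniteMeasure_restrict_ball (x : Space d) (r : ℝ) :
    IsFiniteMeasure (volume.restrict (Metric.ball x r)) :=
  ⟨by rw [Measure.restrict_apply_univ]; exact measure_ball_lt_top⟩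

/-- Integration by parts against the constant `1`. Consequently a function tested with a derivative
matters only modulo constants, which is why bounds on mean oscillations of `φ` and `σ` suffice. -/
theorem integral_partialDeriv_eq_zero (hψ : IsTestFunction U ψ)
    (i : Fin d) : ∫ x in U, _root_.partialDeriv i ψ x = 0 := by
  rw [setIntegral_eq_of_test Subset.rfl fun x hx => (hψ.partialDeriv i).eq_zero hx]
  have h1 : Integrable (fun x => fderiv ℝ ψ x (basisVec i)) volume :=
    memLp_one_iff_integrable.1 ((hψ.partialDeriv i).memLp volume 1)
  have h := integral_mul_fderiv_eq_neg_fderiv_mul_of_integrable (μ := (volume : Measure (Space d)))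
    (f := fun _ => (1 : ℝ)) (g := ψ) (v := basisVec i) (by simp)
    (by simpa using h1)
    (by simpa [memLp_one_iff_integrable] using hψ.memLp volume 1)
    (fun x _ => differentiableAt_const _) (fun x _ => hψ.smooth.differentiable (by simp) x)
  simpa [_root_.partialDeriv] using h

end Tests


/-! ### Mollification -/

section Mollification

open scoped Convolution ENNReal

variable {d : ℕ}

/-- Translation is continuous in `L²`. -/
theorem tendsto_eLpNorm_translate_sub {f : Space d → ℝ} (hf : MemLp f 2 volume) :
    Tendsto (fun h : Space d => eLpNorm (fun x => f (x - h) - f x) 2 volume) (𝓝 0) (𝓝 0) := by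
  have : Fact ((1 : ℝ≥0∞) ≤ 2) := ⟨by norm_num⟩
  -- Currying makes `h ↦ (x ↦ x - h)` continuous into the space of continuous maps, so that
  -- continuity of composition with measure preserving maps applies.
  let T : C(Space d × Space d, Space d) := ⟨fun p => p.2 - p.1, by fun_prop⟩
  have hT : Continuous (fun h : Space d => T.curry h) := T.curry.continuous
  have hmp : ∀ h : Space d, MeasurePreserving (T.curry h) volume volume := fun h => by
    change MeasurePreserving (fun x => x - h) volume volume
    exact measurePreserving_sub_right volume h
  have hc : Continuous fun h => Lp.compMeasurePreserving (T.curry h) (hmp h) hf.toLp :=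
    Continuous.compMeasurePreservingLp continuous_const hT hmp (by norm_num)
  have h1 := (hc.tendsto 0).sub_const (hf.toLp)
  have h2 : Lp.compMeasurePreserving (T.curry 0) (hmp 0) hf.toLp - hf.toLp = 0 := by
    rw [sub_eq_zero, Lp.toLp_compMeasurePreserving]
    congr 1
    ext x; simp [T]
  rw [h2] at h1
  have h3 := (continuous_enorm.tendsto _).comp h1
  simp only [enorm_zero] at h3
  refine h3.congr fun h => ?_
  simp only [Function.comp]
  rw [Lp.toLp_compMeasurePreserving, ← MemLp.toLp_sub, Lp.enorm_def]
  exact eLpNorm_congr_ae (MemLp.coeFn_toLp _)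

/-- Jensen's inequality for a weight of mass at most one: Cauchy–Schwarz after splitting `w =
w^(1/2) * w^(1/2)`. -/
theorem sq_lintegral_mul_le {X : Type*} [MeasurableSpace X] {μ : Measure X} {w F : X → ℝ≥0∞}
    (hw : AEMeasurable w μ) (hF : AEMeasurable F μ) (h1 : ∫⁻ x, w x ∂μ ≤ 1) :
    (∫⁻ x, w x * F x ∂μ) ^ 2 ≤ ∫⁻ x, w x * F x ^ 2 ∂μ := by
  have h := ENNReal.lintegral_mul_le_Lp_mul_Lq μ (p := 2) (q := 2) Real.HolderConjugate.two_two
    (f := fun x => w x ^ (1 / 2 : ℝ)) (g := fun x => w x ^ (1 / 2 : ℝ) * F x) (hw.pow_const _)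
    ((hw.pow_const _).mul hF)
  have e1 : ∀ x, w x ^ (1 / 2 : ℝ) * w x ^ (1 / 2 : ℝ) = w x := fun x => by
    rw [← ENNReal.rpow_add_of_nonneg _ _ (by norm_num) (by norm_num)]; norm_num
  have e2 : ∀ x, (w x ^ (1 / 2 : ℝ)) ^ (2 : ℝ) = w x := fun x => by
    rw [← ENNReal.rpow_mul]; norm_num
  have e3 : ∀ x, (w x ^ (1 / 2 : ℝ) * F x) ^ (2 : ℝ) = w x * F x ^ 2 := fun x => by
    rw [ENNReal.mul_rpow_of_nonneg _ _ (by norm_num), e2]; norm_num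
  simp only [Pi.mul_apply, ← mul_assoc, e1, e2, e3] at h
  calc (∫⁻ x, w x * F x ∂μ) ^ 2
      ≤ ((∫⁻ x, w x ∂μ) ^ (1 / 2 : ℝ) * (∫⁻ x, w x * F x ^ 2 ∂μ) ^ (1 / 2 : ℝ)) ^ 2 := by gcongr
    _ = (∫⁻ x, w x ∂μ) * ∫⁻ x, w x * F x ^ 2 ∂μ := by
        rw [← ENNReal.rpow_natCast, ENNReal.mul_rpow_of_nonneg _ _ (by norm_num),
          ← ENNReal.rpow_mul, ← ENNReal.rpow_mul]; norm_num
    _ ≤ 1 * ∫⁻ x, w x * F x ^ 2 ∂μ := by gcongr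
    _ = _ := one_mul _

theorem lintegral_normed_eq_one (φ : ContDiffBump (0 : Space d)) :
    ∫⁻ h, ENNReal.ofReal (φ.normed volume h) = 1 := by
  rw [← ofReal_integral_eq_lintegral_ofReal φ.integrable_normed
    (Eventually.of_forall φ.nonneg_normed), φ.integral_normed, ENNReal.ofReal_one]

/-- Mollification converges in `L²`. -/
theorem tendsto_integral_sq_mollify_sub {f : Space d → ℝ} (hf : MemLp f 2 volume)
    {φ : ℕ → ContDiffBump (0 : Space d)} (hφ : Tendsto (fun n => (φ n).rOut) atTop (𝓝 0)) :
    Tendsto (fun n => ∫⁻ x, ‖((φ n).normed volume ⋆[ContinuousLinearMap.lsmul ℝ ℝ, volume] f) x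
      - f x‖ₑ ^ 2) atTop (𝓝 0) := by
  have hloc : LocallyIntegrable f volume := hf.locallyIntegrable (by norm_num)
  -- Jensen and Tonelli bound the mollification error by the average of the translation modulus `τ`
  -- against the mollifier, and `τ` is small near the origin.
  set τ : Space d → ℝ≥0∞ := fun h => ∫⁻ x, ‖f (x - h) - f x‖ₑ ^ 2 with hτ
  have hτ0 : Tendsto τ (𝓝 0) (𝓝 0) := by
    have h := (ENNReal.continuous_pow 2).tendsto 0 |>.comp (tendsto_eLpNorm_translate_sub hf)
    simp only [ne_eq, OfNat.ofNat_ne_zero, not_false_eq_true, zero_pow] at h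
    refine h.congr fun y => ?_
    simp only [Function.comp, hτ]
    rw [eLpNorm_eq_lintegral_rpow_enorm_toReal (by norm_num) (by norm_num),
      ← ENNReal.rpow_natCast, ← ENNReal.rpow_mul]
    norm_num
  have hbound : ∀ n, ∫⁻ x, ‖((φ n).normed volume ⋆[ContinuousLinearMap.lsmul ℝ ℝ, volume] f) x
      - f x‖ₑ ^ 2 ≤ ∫⁻ h, ENNReal.ofReal ((φ n).normed volume h) * τ h := by
    intro n
    set ρ := (φ n).normed volume with hρ
    have hρc : Continuous ρ := (φ n).continuous_normed
    have hmeas : AEMeasurable (fun p : Space d × Space d => f (p.1 - p.2) - f p.1)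
        (volume.prod volume) := by
      refine AEMeasurable.sub ?_ ?_
      · exact (hf.1.aemeasurable).comp_quasiMeasurePreserving
          (quasiMeasurePreserving_sub_of_right_invariant volume volume)
      · exact (hf.1.aemeasurable).comp_quasiMeasurePreserving Measure.quasiMeasurePreserving_fst
    have hpt : ∀ x, ‖(ρ ⋆[ContinuousLinearMap.lsmul ℝ ℝ, volume] f) x - f x‖ₑ ^ 2
        ≤ ∫⁻ h, ENNReal.ofReal (ρ h) * ‖f (x - h) - f x‖ₑ ^ 2 := by
      intro x
      have hce : Integrable (fun h => ρ h * f (x - h)) volume := by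
        have := (φ n).hasCompactSupport_normed (μ := volume) |>.convolutionExists_left
          (ContinuousLinearMap.lsmul ℝ ℝ) hρc hloc x
        simpa [ConvolutionExistsAt] using this
      have e : (ρ ⋆[ContinuousLinearMap.lsmul ℝ ℝ, volume] f) x - f x
          = ∫ h, ρ h * (f (x - h) - f x) := by
        have : f x = ∫ h, ρ h * f x := by
          rw [integral_mul_const, (φ n).integral_normed, one_mul]
        rw [convolution_def]
        conv_lhs => rw [this]
        rw [← integral_sub]
        · congr 1; ext h; simp; ring
        · simpa using hce
        · exact (φ n).integrable_normed.mul_const _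
      have hm1 : AEMeasurable (fun h => f (x - h) - f x) volume := by
        refine AEMeasurable.sub ?_ aemeasurable_const
        exact (hf.1.aemeasurable).comp_quasiMeasurePreserving
          (quasiMeasurePreserving_sub_left volume x)
      rw [e]
      refine le_trans ?_ (sq_lintegral_mul_le (w := fun h => ENNReal.ofReal (ρ h))
        (hρc.measurable.ennreal_ofReal.aemeasurable) hm1.enorm (lintegral_normed_eq_one _).le)
      gcongr
      refine (enorm_integral_le_lintegral_enorm _).trans (lintegral_mono fun h => ?_)
      rw [enorm_mul, Real.enorm_eq_ofReal ((φ n).nonneg_normed h)]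
    refine (lintegral_mono hpt).trans ?_
    rw [lintegral_lintegral_swap]
    · refine lintegral_mono fun h => ?_
      rw [lintegral_const_mul' _ _ ENNReal.ofReal_ne_top]
    · refine AEMeasurable.mul ?_ (hmeas.enorm.pow_const 2)
      exact (hρc.measurable.ennreal_ofReal.comp measurable_snd).aemeasurable
  rw [ENNReal.tendsto_nhds_zero]
  intro ε hε
  obtain ⟨r, hr, hball⟩ := Metric.eventually_nhds_iff_ball.1 (ENNReal.tendsto_nhds_zero.1 hτ0 ε hε)
  filter_upwards [(hφ.eventually (gt_mem_nhds hr))] with n hn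
  refine (hbound n).trans ?_
  calc ∫⁻ h, ENNReal.ofReal ((φ n).normed volume h) * τ h
      ≤ ∫⁻ h, ENNReal.ofReal ((φ n).normed volume h) * ε := by
        refine lintegral_mono fun h => ?_
        by_cases hh : h ∈ Metric.ball (0 : Space d) (φ n).rOut
        · have := hball h (Metric.ball_subset_ball hn.le hh)
          gcongr
        · have : (φ n).normed volume h = 0 := by
            have := (φ n).support_normed_eq (μ := volume)
            by_contra h0
            exact hh (this ▸ h0)
          simp [this]
    _ = ε := by
        rw [lintegral_mul_const _ ((φ n).continuous_normed.measurable.ennreal_ofReal),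
          lintegral_normed_eq_one, one_mul]

theorem tendsto_setIntegral_sq_mollify_sub {f : Space d → ℝ} (hf : MemLp f 2 volume)
    {φ : ℕ → ContDiffBump (0 : Space d)} (hφ : Tendsto (fun n => (φ n).rOut) atTop (𝓝 0))
    (S : Set (Space d)) :
    Tendsto (fun n => ∫ x in S, (((φ n).normed volume ⋆[ContinuousLinearMap.lsmul ℝ ℝ, volume] f) x
      - f x) ^ 2) atTop (𝓝 0) := by
  have h := tendsto_integral_sq_mollify_sub hf hφ
  have h1 := (ENNReal.tendsto_toReal ENNReal.zero_ne_top).comp h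
  have hne := (ENNReal.tendsto_nhds_zero.1 h 1 one_pos)
  refine squeeze_zero' (Eventually.of_forall fun n => integral_nonneg fun x => sq_nonneg _) ?_ h1
  filter_upwards [hne] with n hn
  have hc : Continuous ((φ n).normed volume ⋆[ContinuousLinearMap.lsmul ℝ ℝ, volume] f) :=
    ((φ n).hasCompactSupport_normed.continuous_convolution_left _ (φ n).continuous_normed
      (hf.locallyIntegrable (by norm_num)))
  have hm : AEStronglyMeasurable (fun x =>
      (((φ n).normed volume ⋆[ContinuousLinearMap.lsmul ℝ ℝ, volume] f) x - f x) ^ 2)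
      (volume.restrict S) := (hc.aestronglyMeasurable.sub hf.1.restrict).pow 2
  rw [integral_eq_lintegral_of_nonneg_ae (Eventually.of_forall fun x => sq_nonneg _) hm]
  refine ENNReal.toReal_mono (ne_top_of_le_ne_top ENNReal.one_ne_top hn) ?_
  refine (lintegral_mono fun x => ?_).trans (setLIntegral_le_lintegral S _)
  rw [← enorm_pow, Real.enorm_eq_ofReal (sq_nonneg _)]

/-- On smaller balls `H¹` functions are limits of smooth functions, together with their
gradients. -/
theorem IsH1On.exists_smooth_approx {R R' : ℝ} {u : Space d → ℝ} {G : Space d → Space d}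
    (h : IsH1On (Metric.ball 0 R) u G) (hR : R' < R) :
    ∃ v : ℕ → Space d → ℝ, (∀ n, ContDiff ℝ ∞ (v n)) ∧
      Tendsto (fun n => ∫ x in Metric.ball 0 R', (v n x - u x) ^ 2) atTop (𝓝 0) ∧
      ∀ i, Tendsto (fun n => ∫ x in Metric.ball 0 R', (partialDeriv i (v n) x - G x i) ^ 2)
        atTop (𝓝 0) := by
  set B := Metric.ball (0 : Space d) R with hB
  have hBm : MeasurableSet B := Metric.isOpen_ball.measurableSet
  have hsub : Metric.ball (0 : Space d) R' ⊆ B := Metric.ball_subset_ball hR.le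
  have hδ : 0 < R - R' := sub_pos.2 hR
  -- The outer radii tend to zero but stay strictly below the gap `R - R'`, so mollification at
  -- points of the smaller ball sees only values in the larger one.
  let φ : ℕ → ContDiffBump (0 : Space d) := fun n =>
    ⟨(R - R') / (2 * (n + 2)), (R - R') / (n + 2), by positivity, by
      apply div_lt_div_of_pos_left hδ (by positivity); linarith [(Nat.cast_nonneg n : (0:ℝ) ≤ n)]⟩
  have hφ : Tendsto (fun n => (φ n).rOut) atTop (𝓝 0) := by
    change Tendsto (fun n : ℕ => (R - R') / ((n : ℝ) + 2)) atTop (𝓝 0)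
    exact tendsto_const_nhds.div_atTop
      (tendsto_atTop_add_const_right _ _ tendsto_natCast_atTop_atTop)
  have hφlt : ∀ n, (φ n).rOut < R - R' := fun n => by
    change (R - R') / ((n : ℝ) + 2) < R - R'
    apply div_lt_self hδ
    linarith [(Nat.cast_nonneg n : (0:ℝ) ≤ n)]
  have hu : MemLp (B.indicator u) 2 volume := (memLp_indicator_iff_restrict hBm).2 h.memLp_fun
  have hG : ∀ i, MemLp (B.indicator fun x => G x i) 2 volume := fun i =>
    (memLp_indicator_iff_restrict hBm).2 (memLp_apply h.memLp_grad i)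
  have hul : LocallyIntegrable (B.indicator u) volume := hu.locallyIntegrable (by norm_num)
  refine ⟨fun n => (φ n).normed volume ⋆[ContinuousLinearMap.lsmul ℝ ℝ, volume] (B.indicator u),
    fun n => ?_, ?_, fun i => ?_⟩
  · exact (φ n).hasCompactSupport_normed.contDiff_convolution_left _ (φ n).contDiff_normed hul
  · refine (tendsto_setIntegral_sq_mollify_sub hu hφ (Metric.ball 0 R')).congr fun n => ?_
    refine setIntegral_congr_fun Metric.isOpen_ball.measurableSet fun x hx => ?_
    simp only [indicator_of_mem (hsub hx)]
  · refine (tendsto_setIntegral_sq_mollify_sub (hG i) hφ (Metric.ball 0 R')).congr fun n => ?_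
    refine setIntegral_congr_fun Metric.isOpen_ball.measurableSet fun x hx => ?_
    simp only [indicator_of_mem (hsub hx)]
    congr 2
    set ρ := (φ n).normed volume with hρ
    have hρs : ContDiff ℝ ∞ ρ := (φ n).contDiff_normed
    have hρc : HasCompactSupport ρ := (φ n).hasCompactSupport_normed
    -- For `x` in the smaller ball the reflected mollifier is admissible in the weak gradient
    -- identity; this shows that differentiation commutes with mollification there.
    have hψ : IsTestFunction B fun y => ρ (x - y) := by
      refine ⟨hρs.comp (contDiff_const.sub contDiff_id),
        hρc.comp_homeomorph (Homeomorph.subLeft x), ?_⟩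
      have hsupp : Function.support (fun y => ρ (x - y)) ⊆ Metric.closedBall x (φ n).rOut := by
        intro y hy
        have h1 : x - y ∈ Function.support ρ := hy
        rw [hρ, (φ n).support_normed_eq] at h1
        rw [mem_ball_zero_iff] at h1
        rw [Metric.mem_closedBall, dist_comm, dist_eq_norm]
        exact h1.le
      refine (closure_minimal hsupp Metric.isClosed_closedBall).trans ?_
      intro y hy
      rw [Metric.mem_closedBall] at hy
      rw [Metric.mem_ball] at hx
      rw [hB, Metric.mem_ball]
      linarith [dist_triangle y x 0, hφlt n]
    have hd : ∀ y, partialDeriv i (fun y => ρ (x - y)) y = - partialDeriv i ρ (x - y) := by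
      intro y
      have h1 : HasFDerivAt (fun y => ρ (x - y)) ((fderiv ℝ ρ (x - y)).comp
          (-ContinuousLinearMap.id ℝ (Space d))) y :=
        HasFDerivAt.comp y (hρs.differentiable (by simp) _).hasFDerivAt
          ((hasFDerivAt_id y).const_sub x)
      simp [partialDeriv, h1.fderiv]
    have hw := h.weak_grad _ hψ i
    have e1 : ∀ f : Space d → ℝ, (ρ ⋆[ContinuousLinearMap.lsmul ℝ ℝ, volume] (B.indicator f)) x
        = ∫ y in B, f y * ρ (x - y) := by
      intro f
      rw [convolution_eq_swap, ← integral_indicator hBm]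
      congr 1; ext y
      by_cases hy : y ∈ B <;> simp [hy, mul_comm]
    rw [e1]
    simp only [hd, mul_neg] at hw
    rw [integral_neg, neg_inj] at hw
    rw [← hw]
    have h2 := hρc.hasFDerivAt_convolution_left (ContinuousLinearMap.lsmul ℝ ℝ)
      (hρs.of_le (by simp)) hul x
    rw [partialDeriv, h2.fderiv, convolution_eq_swap, ContinuousLinearMap.integral_apply,
      ← integral_indicator hBm]
    · congr 1; ext y
      by_cases hy : y ∈ B <;> simp [hy, mul_comm, partialDeriv]
    · have := (hρc.fderiv ℝ).convolutionExists_left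
        (ContinuousLinearMap.precompL (Space d) (ContinuousLinearMap.lsmul ℝ ℝ))
        (hρs.continuous_fderiv (by simp)) hul x
      exact this.integrable_swap

theorem memLp_ball_of_continuous {f : Space d → ℝ} (hf : Continuous f) (R : ℝ) :
    MemLp f 2 (volume.restrict (Metric.ball 0 R)) := by
  obtain ⟨C, hC⟩ := (isCompact_closedBall (0 : Space d) R).exists_bound_of_continuousOn
    hf.continuousOn
  refine MemLp.of_bound hf.aestronglyMeasurable C ?_
  filter_upwards [ae_restrict_mem Metric.isOpen_ball.measurableSet] with x hx
  exact hC x (Metric.ball_subset_closedBall hx)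

/-- The weak divergence equation may be tested with `η z`, where `z ∈ H¹`. -/
theorem WeakDivEqOn.integral_test_mul {R : ℝ} (hR : 0 < R) {F : Space d → Fin d → ℝ}
    (hF : ∀ i, MemLp (fun x => F x i) 2 (volume.restrict (Metric.ball 0 R)))
    (h : WeakDivEqOn (Metric.ball 0 R) F fun _ => 0) {z : Space d → ℝ} {Z : Space d → Space d}
    (hz : IsH1On (Metric.ball 0 R) z Z) {η : Space d → ℝ}
    (hη : IsTestFunction (Metric.ball 0 R) η) :
    ∫ x in Metric.ball 0 R, η x * ∑ i, F x i * Z x i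
      = -∫ x in Metric.ball 0 R, z x * ∑ i, F x i * partialDeriv i η x := by
  obtain ⟨R', hR'0, hR', hη'⟩ := hη.exists_radius hR
  obtain ⟨v, hvs, hv, hvg⟩ := hz.exists_smooth_approx hR'
  set B := Metric.ball (0 : Space d) R
  set B' := Metric.ball (0 : Space d) R'
  have hsub : B' ⊆ B := Metric.ball_subset_ball hR'.le
  have hz' := hz.mono hsub
  have hF' : ∀ i, MemLp (fun x => F x i) 2 (volume.restrict B') := fun i =>
    (hF i).mono_measure (Measure.restrict_mono hsub le_rfl)
  have eB : ∀ f : Space d → ℝ, (∀ x, x ∉ B' → f x = 0) → ∫ x in B, f x = ∫ x in B', f x :=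
    fun f hf => by rw [setIntegral_eq_of_test hsub hf, setIntegral_eq_of_test Subset.rfl hf]
  rw [eB _ fun x hx => by rw [hη'.eq_zero hx, zero_mul], eB _ fun x hx => by
    rw [Finset.sum_eq_zero fun i _ => by rw [(hη'.partialDeriv i).eq_zero hx, mul_zero], mul_zero]]
  have hsm : ∀ {f : Space d → ℝ}, ContDiff ℝ ∞ f → MemLp f 2 (volume.restrict B') :=
    fun hf => memLp_ball_of_continuous hf.continuous _
  have hvm := fun n => hsm (hvs n)
  have hvgm := fun n i => hsm (contDiff_partialDeriv (hvs n) i)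
  -- For a smooth approximation `v n` the product `η v n` is a genuine test function. All terms are
  -- supported in the smaller ball, where the approximations and their gradients converge in `L²`.
  have key : ∀ n, ∑ i, ((∫ x in B', partialDeriv i (v n) x * (η x * F x i))
      + ∫ x in B', v n x * (partialDeriv i η x * F x i)) = 0 := by
    intro n
    have h0 := h _ (hη.mul_smooth (hvs n))
    simp only [partialDeriv_mul hη.smooth (hvs n), zero_mul, integral_zero, neg_zero] at h0
    rw [eB _ fun x hx => Finset.sum_eq_zero fun i _ => by
      rw [hη'.eq_zero hx, (hη'.partialDeriv i).eq_zero hx]; ring] at h0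
    rw [← h0, integral_finsetSum]
    · refine Finset.sum_congr rfl fun i _ => ?_
      rw [← integral_add ((hvgm n i).integrable_mul_two ((hF' i).mul_test hη))
        ((hvm n).integrable_mul_two ((hF' i).mul_test (hη.partialDeriv i)))]
      congr 1; ext x; ring
    · intro i _
      have := ((hvgm n i).integrable_mul_two ((hF' i).mul_test hη)).fun_add
        ((hvm n).integrable_mul_two ((hF' i).mul_test (hη.partialDeriv i)))
      refine this.congr (Eventually.of_forall fun x => ?_)
      ring
  have hlim : Tendsto (fun n => ∑ i, ((∫ x in B', partialDeriv i (v n) x * (η x * F x i))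
      + ∫ x in B', v n x * (partialDeriv i η x * F x i))) atTop
      (𝓝 (∑ i, ((∫ x in B', Z x i * (η x * F x i))
      + ∫ x in B', z x * (partialDeriv i η x * F x i)))) := by
    refine tendsto_finsetSum _ fun i _ => Tendsto.add ?_ ?_
    · exact tendsto_integral_mul_of_strong (Eventually.of_forall fun n => hvgm n i)
        (memLp_apply hz'.memLp_grad i) ((hF' i).mul_test hη) (hvg i)
    · exact tendsto_integral_mul_of_strong (Eventually.of_forall hvm)
        hz'.memLp_fun ((hF' i).mul_test (hη.partialDeriv i)) hv
  simp only [key] at hlim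
  have h0 := tendsto_nhds_unique tendsto_const_nhds hlim
  rw [Finset.sum_add_distrib, ← integral_finsetSum _ fun i _ =>
    (memLp_apply hz'.memLp_grad i).integrable_mul_two ((hF' i).mul_test hη),
    ← integral_finsetSum _ fun i _ =>
      hz'.memLp_fun.integrable_mul_two ((hF' i).mul_test (hη.partialDeriv i))] at h0
  have e3 : ∀ x, η x * ∑ i, F x i * Z x i = ∑ i, Z x i * (η x * F x i) := fun x => by
    rw [Finset.mul_sum]; exact Finset.sum_congr rfl fun i _ => by ring
  have e4 : ∀ x, z x * ∑ i, F x i * partialDeriv i η x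
      = ∑ i, z x * (partialDeriv i η x * F x i) := fun x => by
    rw [Finset.mul_sum]; exact Finset.sum_congr rfl fun i _ => by ring
  simp only [e3, e4]
  linarith

end Mollification


/-! ### Poincaré inequality and difference quotients -/

section Poincare

open scoped ENNReal

variable {d : ℕ}

theorem fderiv_apply_eq_sum (v : Space d → ℝ) (x w : Space d) :
    fderiv ℝ v x w = ∑ i, w i * partialDeriv i v x := by
  have hw : w = ∑ i, w i • (basisVec i : Space d) := by
    ext j; simp [Finset.sum_apply, Pi.single_apply]
  conv_lhs => rw [hw]
  simp [partialDeriv]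

theorem sq_fderiv_apply_le (v : Space d → ℝ) (x w : Space d) :
    (fderiv ℝ v x w) ^ 2 ≤ ‖w‖ ^ 2 * ∑ i, partialDeriv i v x ^ 2 := by
  rw [fderiv_apply_eq_sum, norm_sq_eq_sum]
  exact Finset.sum_mul_sq_le_sq_mul_sq _ _ _

theorem continuous_sum_sq_partialDeriv {v : Space d → ℝ} (hv : ContDiff ℝ ∞ v) :
    Continuous fun x => ∑ i, partialDeriv i v x ^ 2 :=
  continuous_finsetSum _ fun i _ => (contDiff_partialDeriv hv i).continuous.pow 2

/-- The fundamental theorem of calculus along the segment, followed by Cauchy–Schwarz in the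
parameter. -/
theorem sq_sub_le_lintegral_segment {v : Space d → ℝ} (hv : ContDiff ℝ ∞ v) (x y : Space d) :
    ENNReal.ofReal ((v y - v x) ^ 2) ≤ ENNReal.ofReal (‖y - x‖ ^ 2) *
      ∫⁻ t in Icc (0 : ℝ) 1, ENNReal.ofReal (∑ i, partialDeriv i v (x + t • (y - x)) ^ 2) := by
  set w := y - x with hw
  set g : ℝ → ℝ := fun t => ∑ i, partialDeriv i v (x + t • w) ^ 2 with hg
  have hline : Continuous fun t : ℝ => x + t • w := by fun_prop
  have hgc : Continuous g := (continuous_sum_sq_partialDeriv hv).comp hline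
  have hD : ∀ t : ℝ, HasDerivAt (fun t : ℝ => v (x + t • w)) (fderiv ℝ v (x + t • w) w) t := by
    intro t
    have h1 : HasDerivAt (fun t : ℝ => x + t • w) w t := by
      simpa using ((hasDerivAt_id t).smul_const w).const_add x
    exact (hv.differentiable (by simp) _).hasFDerivAt.comp_hasDerivAt t h1
  have hDc : Continuous fun t : ℝ => fderiv ℝ v (x + t • w) w :=
    ((hv.continuous_fderiv (by simp)).comp hline).clm_apply continuous_const
  have hftc : v y - v x = ∫ t in Icc (0 : ℝ) 1, fderiv ℝ v (x + t • w) w := by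
    rw [integral_Icc_eq_integral_Ioc, ← intervalIntegral.integral_of_le zero_le_one,
      intervalIntegral.integral_eq_sub_of_hasDerivAt (fun t _ => hD t)
        (hDc.intervalIntegrable _ _)]
    simp [hw]
  have hm : MemLp (fun t : ℝ => fderiv ℝ v (x + t • w) w) 2 (volume.restrict (Icc (0 : ℝ) 1)) := by
    obtain ⟨C, hC⟩ := (isCompact_Icc (a := (0 : ℝ)) (b := 1)).exists_bound_of_continuousOn
      hDc.continuousOn
    refine MemLp.of_bound hDc.aestronglyMeasurable C ?_
    filter_upwards [ae_restrict_mem measurableSet_Icc] with t ht using hC t ht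
  have hgi : IntegrableOn g (Icc (0 : ℝ) 1) := hgc.continuousOn.integrableOn_compact isCompact_Icc
  have hcs := sq_integral_mul_le hm (memLp_const (1 : ℝ))
  simp only [mul_one, one_pow, integral_const, smul_eq_mul, Measure.real,
    Measure.restrict_apply_univ, Real.volume_Icc, sub_zero, ENNReal.ofReal_one,
    ENNReal.toReal_one] at hcs
  rw [← hftc] at hcs
  have hle : (v y - v x) ^ 2 ≤ ‖w‖ ^ 2 * ∫ t in Icc (0 : ℝ) 1, g t := by
    refine hcs.trans ?_
    rw [← integral_const_mul]
    exact integral_mono hm.integrable_sq (hgi.const_mul _) fun t => sq_fderiv_apply_le v _ w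
  refine (ENNReal.ofReal_le_ofReal hle).trans ?_
  rw [ENNReal.ofReal_mul (sq_nonneg _), ofReal_integral_eq_lintegral_ofReal hgi
    (Eventually.of_forall fun t => Finset.sum_nonneg fun i _ => sq_nonneg _)]

theorem setLIntegral_comp_affine_le {f : Space d → ℝ≥0∞} (hf : Measurable f) {s : ℝ} (hs : 0 < s)
    (b : Space d) {K K' : Set (Space d)} (hK : MeasurableSet K) (hK' : MeasurableSet K')
    (h : ∀ x ∈ K, s • x + b ∈ K') :
    ∫⁻ x in K, f (s • x + b) ≤ ENNReal.ofReal ((s ^ d)⁻¹) * ∫⁻ x in K', f x := by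
  have e : ∫⁻ x : Space d, K'.indicator f (s • x + b)
      = ENNReal.ofReal ((s ^ d)⁻¹) * ∫⁻ x in K', f x := by
    have h1 := lintegral_map (μ := (volume : Measure (Space d))) (g := fun x : Space d => s • x)
      (f := fun y => K'.indicator f (y + b)) ((hf.indicator hK').comp (measurable_add_const b))
      (measurable_const_smul s)
    rw [← h1, Measure.map_addHaar_smul _ hs.ne', lintegral_smul_measure,
      lintegral_add_right_eq_self (fun y => K'.indicator f y) b, lintegral_indicator hK',
      finrank_euclideanSpace_fin, abs_of_nonneg (by positivity), smul_eq_mul]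
  rw [← e, ← lintegral_indicator hK]
  refine lintegral_mono fun x => ?_
  by_cases hx : x ∈ K
  · simp [hx, h x hx]
  · simp [hx]

/-- The segment estimate is integrated over all pairs of points of `K`; convexity keeps the segments
inside `K`, and for each fixed parameter an affine substitution removes the segment. -/
theorem lintegral_lintegral_sq_sub_le {v : Space d → ℝ} (hv : ContDiff ℝ ∞ v)
    {K : Set (Space d)} (hK : MeasurableSet K) (hc : Convex ℝ K) {D : ℝ}
    (hdiam : ∀ x ∈ K, ∀ y ∈ K, ‖y - x‖ ≤ D) :
    ∫⁻ x in K, ∫⁻ y in K, ENNReal.ofReal ((v y - v x) ^ 2)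
      ≤ ENNReal.ofReal (D ^ 2) * (ENNReal.ofReal (2 ^ d) * (volume K *
        ∫⁻ x in K, ENNReal.ofReal (∑ i, partialDeriv i v x ^ 2))) := by
  set g : Space d → ℝ≥0∞ := fun x => ENNReal.ofReal (∑ i, partialDeriv i v x ^ 2) with hg
  have hgm : Measurable g := (continuous_sum_sq_partialDeriv hv).measurable.ennreal_ofReal
  have hmT : Measurable fun p : (Space d × Space d) × ℝ => g (p.1.1 + p.2 • (p.1.2 - p.1.1)) :=
    hgm.comp (by fun_prop)
  have h1 : ∫⁻ x in K, ∫⁻ y in K, ENNReal.ofReal ((v y - v x) ^ 2)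
      ≤ ∫⁻ x in K, ∫⁻ y in K, ENNReal.ofReal (D ^ 2) *
        ∫⁻ t in Icc (0 : ℝ) 1, g (x + t • (y - x)) := by
    refine setLIntegral_mono' hK fun x hx => setLIntegral_mono' hK fun y hy => ?_
    refine (sq_sub_le_lintegral_segment hv x y).trans ?_
    have := hdiam x hx y hy
    gcongr
  have hmI : Measurable fun p : Space d × Space d =>
      ∫⁻ t in Icc (0 : ℝ) 1, g (p.1 + t • (p.2 - p.1)) := hmT.lintegral_prod_right'
  have hpull : ∫⁻ x in K, ∫⁻ y in K, ENNReal.ofReal (D ^ 2) *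
        ∫⁻ t in Icc (0 : ℝ) 1, g (x + t • (y - x))
      = ENNReal.ofReal (D ^ 2) * ∫⁻ t in Icc (0 : ℝ) 1, ∫⁻ x in K, ∫⁻ y in K,
        g (x + t • (y - x)) := by
    simp_rw [lintegral_const_mul' _ _ ENNReal.ofReal_ne_top]
    congr 1
    have e1 : ∀ x, ∫⁻ y in K, ∫⁻ t in Icc (0 : ℝ) 1, g (x + t • (y - x))
        = ∫⁻ t in Icc (0 : ℝ) 1, ∫⁻ y in K, g (x + t • (y - x)) := fun x =>
      lintegral_lintegral_swap (hgm.comp (by fun_prop :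
        Measurable fun q : Space d × ℝ => x + q.2 • (q.1 - x))).aemeasurable
    simp_rw [e1]
    refine lintegral_lintegral_swap (Measurable.aemeasurable ?_)
    have : Measurable fun q : (Space d × ℝ) × Space d => g (q.1.1 + q.1.2 • (q.2 - q.1.1)) :=
      hgm.comp (by fun_prop)
    exact this.lintegral_prod_right'
  refine h1.trans (hpull.le.trans (mul_le_mul_right ?_ _))
  have h2d : ∀ s : ℝ, 1 / 2 ≤ s → ENNReal.ofReal ((s ^ d)⁻¹) ≤ ENNReal.ofReal (2 ^ d) := by
    intro s hs
    refine ENNReal.ofReal_le_ofReal ?_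
    rw [← inv_pow]
    have : s⁻¹ ≤ 2 := by
      rw [inv_le_comm₀ (by linarith) (by norm_num)]; linarith
    gcongr
  have hkey : ∀ t ∈ Icc (0 : ℝ) 1, ∫⁻ x in K, ∫⁻ y in K, g (x + t • (y - x))
      ≤ ENNReal.ofReal (2 ^ d) * (volume K * ∫⁻ x in K, g x) := by
    intro t ht
    have hmem : ∀ x ∈ K, ∀ y ∈ K, x + t • (y - x) ∈ K := fun x hx y hy =>
      hc.add_smul_sub_mem hx hy ht
    have hbd : ∀ F : Space d → ℝ≥0∞, (∀ x ∈ K, F x ≤ ENNReal.ofReal (2 ^ d) * ∫⁻ x in K, g x) →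
        ∫⁻ x in K, F x ≤ ENNReal.ofReal (2 ^ d) * (volume K * ∫⁻ x in K, g x) := by
      intro F hF
      refine (setLIntegral_mono' hK hF).trans ?_
      rw [setLIntegral_const]
      exact le_of_eq (by ring)
    -- The point `x + t (y - x)` depends on `y` with factor `t` and on `x` with factor `1 - t`.
    -- Substituting in the variable whose factor is at least `1/2` bounds the Jacobian by `2 ^ d`.
    rcases le_total (1 / 2) t with h | h
    · refine hbd _ fun x hx => ?_
      have e : ∀ y, x + t • (y - x) = t • y + (x - t • x) := fun y => by rw [smul_sub]; abel
      simp_rw [e]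
      refine (setLIntegral_comp_affine_le hgm (by linarith) _ hK hK fun y hy => ?_).trans
        (mul_le_mul_left (h2d t h) _)
      rw [← e]; exact hmem x hx y hy
    · have hm2 : Measurable fun q : Space d × Space d => g (q.1 + t • (q.2 - q.1)) :=
        hgm.comp (by fun_prop)
      rw [lintegral_lintegral_swap (f := fun x y => g (x + t • (y - x))) hm2.aemeasurable]
      refine hbd _ fun y hy => ?_
      have e : ∀ x, x + t • (y - x) = (1 - t) • x + t • y := fun x => by
        rw [smul_sub, sub_smul, one_smul]; abel
      simp_rw [e]
      refine (setLIntegral_comp_affine_le hgm (by linarith) _ hK hK fun x hx => ?_).trans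
        (mul_le_mul_left (h2d (1 - t) (by linarith)) _)
      rw [← e]; exact hmem x hx y hy
  refine (setLIntegral_mono' measurableSet_Icc hkey).trans ?_
  rw [setLIntegral_const]
  simp

theorem MeasureTheory.MemLp.integral_sq_sub_const {X : Type*} [MeasurableSpace X]
    {μ : Measure X} [IsFiniteMeasure μ] {f : X → ℝ} (hf : MemLp f 2 μ) (c : ℝ) :
    ∫ y, (f y - c) ^ 2 ∂μ
      = (∫ y, f y ^ 2 ∂μ) - 2 * (∫ y, f y ∂μ) * c + μ.real univ * c ^ 2 := by
  have hi : Integrable f μ := hf.integrable (by norm_num)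
  have e : ∀ y, (f y - c) ^ 2 = f y ^ 2 + (-(2 * c)) * f y + c ^ 2 := fun y => by ring
  simp_rw [e]
  rw [integral_add (hf.integrable_sq.fun_add (hi.const_mul _)) (integrable_const _),
    integral_add hf.integrable_sq (hi.const_mul _), integral_const_mul, integral_const,
    smul_eq_mul]
  ring

theorem MeasureTheory.MemLp.integrable_integral_sq_sub {X : Type*} [MeasurableSpace X]
    {μ : Measure X} [IsFiniteMeasure μ] {f : X → ℝ} (hf : MemLp f 2 μ) :
    Integrable (fun x => ∫ y, (f y - f x) ^ 2 ∂μ) μ := by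
  simp_rw [hf.integral_sq_sub_const]
  exact ((integrable_const _).sub ((hf.integrable (by norm_num)).const_mul _)).add
    (hf.integrable_sq.const_mul _)

theorem MeasureTheory.MemLp.integral_integral_sq_sub {X : Type*} [MeasurableSpace X]
    {μ : Measure X} [IsFiniteMeasure μ] {f : X → ℝ} (hf : MemLp f 2 μ) :
    ∫ x, ∫ y, (f y - f x) ^ 2 ∂μ ∂μ
      = 2 * (μ.real univ * (∫ x, f x ^ 2 ∂μ) - (∫ x, f x ∂μ) ^ 2) := by
  have hi : Integrable f μ := hf.integrable (by norm_num)
  have e : ∀ x, ∫ y, (f y - f x) ^ 2 ∂μ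
      = (∫ y, f y ^ 2 ∂μ) + (-(2 * ∫ y, f y ∂μ)) * f x + μ.real univ * f x ^ 2 := fun x => by
    rw [hf.integral_sq_sub_const]; ring
  simp_rw [e]
  rw [integral_add ((integrable_const _).fun_add (hi.const_mul _)) (hf.integrable_sq.const_mul _),
    integral_add (integrable_const _) (hi.const_mul _), integral_const_mul, integral_const_mul,
    integral_const, smul_eq_mul]
  ring

/-- The left-hand side is half the double integral of `(v y - v x)^2`. Multiplying through by the
volume avoids division, so the inequality also makes sense on null sets. -/
theorem poincare_smooth {v : Space d → ℝ} (hv : ContDiff ℝ ∞ v) {R : ℝ}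
    {K : Set (Space d)} (hK : MeasurableSet K) (hKR : K ⊆ Metric.ball 0 R) (hc : Convex ℝ K)
    {D : ℝ} (hdiam : ∀ x ∈ K, ∀ y ∈ K, ‖y - x‖ ≤ D) :
    volume.real K * (∫ x in K, v x ^ 2) - (∫ x in K, v x) ^ 2
      ≤ D ^ 2 * 2 ^ d * volume.real K * ∑ i, ∫ x in K, partialDeriv i v x ^ 2 := by
  have hfin : IsFiniteMeasure (volume.restrict K) :=
    ⟨by rw [Measure.restrict_apply_univ]; exact (measure_mono hKR).trans_lt measure_ball_lt_top⟩
  have hmem : ∀ {f : Space d → ℝ}, ContDiff ℝ ∞ f → MemLp f 2 (volume.restrict K) := fun hf =>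
    (memLp_ball_of_continuous hf.continuous R).mono_measure (Measure.restrict_mono hKR le_rfl)
  have hvm := hmem hv
  have hgi : ∀ i, Integrable (fun x => partialDeriv i v x ^ 2) (volume.restrict K) := fun i =>
    (hmem (contDiff_partialDeriv hv i)).integrable_sq
  have h := lintegral_lintegral_sq_sub_le hv hK hc hdiam
  have hsq : ∀ x, Integrable (fun y => (v y - v x) ^ 2) (volume.restrict K) := fun x =>
    (hvm.sub_two (memLp_const (v x))).integrable_sq
  have e1 : ∀ x, ∫⁻ y in K, ENNReal.ofReal ((v y - v x) ^ 2)
      = ENNReal.ofReal (∫ y in K, (v y - v x) ^ 2) := fun x =>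
    (ofReal_integral_eq_lintegral_ofReal (hsq x) (Eventually.of_forall fun y => sq_nonneg _)).symm
  have hii := hvm.integrable_integral_sq_sub
  simp_rw [e1] at h
  rw [← ofReal_integral_eq_lintegral_ofReal hii (Eventually.of_forall fun x =>
      integral_nonneg fun y => sq_nonneg _), hvm.integral_integral_sq_sub,
    ← ofReal_integral_eq_lintegral_ofReal (integrable_finsetSum _ fun i _ => hgi i)
      (Eventually.of_forall fun x => Finset.sum_nonneg fun i _ => sq_nonneg _),
    integral_finsetSum _ fun i _ => hgi i] at h
  have hKv : volume K = ENNReal.ofReal (volume.real K) := by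
    rw [Measure.real, ENNReal.ofReal_toReal]
    exact ((measure_mono hKR).trans_lt measure_ball_lt_top).ne
  have hnn : 0 ≤ ∑ i, ∫ x in K, partialDeriv i v x ^ 2 :=
    Finset.sum_nonneg fun i _ => integral_nonneg fun x => sq_nonneg _
  rw [hKv, ← ENNReal.ofReal_mul measureReal_nonneg, ← ENNReal.ofReal_mul (by positivity),
    ← ENNReal.ofReal_mul (by positivity), ENNReal.ofReal_le_ofReal_iff (by positivity)] at h
  have hu : (volume.restrict K).real univ = volume.real K := by simp [Measure.real]
  rw [hu] at h
  have hp : 0 ≤ D ^ 2 * (2 ^ d * (volume.real K * ∑ i, ∫ x in K, partialDeriv i v x ^ 2)) := by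
    positivity
  nlinarith

theorem real_restrict_univ (μ : Measure (Space d)) (K : Set (Space d)) :
    (μ.restrict K).real univ = μ.real K := by simp [Measure.real]

/-- The Poincaré inequality on convex sets. -/
theorem IsH1On.poincare_convex {R : ℝ} {u : Space d → ℝ} {G : Space d → Space d}
    (h : IsH1On (Metric.ball 0 R) u G) {K : Set (Space d)} (hK : MeasurableSet K)
    (hKR : K ⊆ Metric.ball 0 R) (hc : Convex ℝ K) {D : ℝ}
    (hdiam : ∀ x ∈ K, ∀ y ∈ K, ‖y - x‖ ≤ D) :
    volume.real K * (∫ x in K, u x ^ 2) - (∫ x in K, u x) ^ 2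
      ≤ D ^ 2 * 2 ^ d * volume.real K * ∑ i, ∫ x in K, G x i ^ 2 := by
  have hfinK : IsFiniteMeasure (volume.restrict K) :=
    ⟨by rw [Measure.restrict_apply_univ]; exact (measure_mono hKR).trans_lt measure_ball_lt_top⟩
  -- Smooth approximation is available only on smaller concentric balls, so the inequality is proved
  -- on the convex pieces `K ∩ B(0,R')`, which then exhaust `K`.
  have hstep : ∀ R' < R, volume.real (K ∩ Metric.ball 0 R') *
      (∫ x in K ∩ Metric.ball 0 R', u x ^ 2) - (∫ x in K ∩ Metric.ball 0 R', u x) ^ 2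
      ≤ D ^ 2 * 2 ^ d * volume.real (K ∩ Metric.ball 0 R') *
        ∑ i, ∫ x in K ∩ Metric.ball 0 R', G x i ^ 2 := by
    intro R' hR'
    obtain ⟨v, hvs, hv, hvg⟩ := h.exists_smooth_approx hR'
    set K' := K ∩ Metric.ball 0 R'
    have hsubB : K' ⊆ Metric.ball 0 R' := inter_subset_right
    have hfin : IsFiniteMeasure (volume.restrict K') :=
      ⟨by rw [Measure.restrict_apply_univ]
          exact (measure_mono hsubB).trans_lt measure_ball_lt_top⟩
    have hres : volume.restrict K' ≤ volume.restrict (Metric.ball 0 R) :=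
      Measure.restrict_mono (inter_subset_left.trans hKR) le_rfl
    have hmem : ∀ {f : Space d → ℝ}, ContDiff ℝ ∞ f → MemLp f 2 (volume.restrict K') := fun hf =>
      (memLp_ball_of_continuous hf.continuous R).mono_measure hres
    have hu' := h.memLp_fun.mono_measure hres
    have hG' := fun i => (memLp_apply h.memLp_grad i).mono_measure hres
    have htr : ∀ {F : ℕ → Space d → ℝ} {f : Space d → ℝ}, (∀ n, ContDiff ℝ ∞ (F n)) →
        MemLp f 2 (volume.restrict (Metric.ball 0 R)) →
        Tendsto (fun n => ∫ x in Metric.ball 0 R', (F n x - f x) ^ 2) atTop (𝓝 0) →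
        Tendsto (fun n => ∫ x in K', (F n x - f x) ^ 2) atTop (𝓝 0) := by
      intro F f hF hf hlim
      refine squeeze_zero (fun n => integral_nonneg fun x => sq_nonneg _) (fun n => ?_) hlim
      refine setIntegral_mono_set ?_ (Eventually.of_forall fun x => sq_nonneg _)
        hsubB.eventuallyLE
      exact ((memLp_ball_of_continuous (hF n).continuous R').sub_two (hf.mono_measure
        (Measure.restrict_mono (Metric.ball_subset_ball hR'.le) le_rfl))).integrable_sq
    have hv' := htr hvs h.memLp_fun hv
    have hvg' := fun i => htr (fun n => contDiff_partialDeriv (hvs n) i)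
      (memLp_apply h.memLp_grad i) (hvg i)
    have l1 := tendsto_integral_sq_of_strong (Eventually.of_forall fun n => hmem (hvs n)) hu' hv'
    have l2 := tendsto_integral_mul_of_strong (Eventually.of_forall fun n => hmem (hvs n)) hu'
      (memLp_const (1 : ℝ)) hv'
    simp only [mul_one] at l2
    have l3 := fun i => tendsto_integral_sq_of_strong
      (Eventually.of_forall fun n => hmem (contDiff_partialDeriv (hvs n) i)) (hG' i) (hvg' i)
    refine le_of_tendsto_of_tendsto' ((l1.const_mul _).sub (l2.pow 2))
      ((tendsto_finsetSum _ fun i _ => l3 i).const_mul _) fun n => ?_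
    exact poincare_smooth (hvs n) (hK.inter Metric.isOpen_ball.measurableSet) hsubB
      (hc.inter (convex_ball _ _)) fun x hx y hy => hdiam x hx.1 y hy.1
  let S : ℕ → Set (Space d) := fun n => K ∩ Metric.ball 0 (R - 1 / ((n : ℝ) + 1))
  have hSm : ∀ n, MeasurableSet (S n) := fun n => hK.inter Metric.isOpen_ball.measurableSet
  have hmono : Monotone S := fun n m hnm => inter_subset_inter_right _ (Metric.ball_subset_ball (by
    have := one_div_le_one_div_of_le (by positivity : (0:ℝ) < n + 1)
      (by exact_mod_cast Nat.succ_le_succ hnm : (n : ℝ) + 1 ≤ m + 1)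
    linarith))
  have hU : ⋃ n, S n = K := by
    refine Subset.antisymm (iUnion_subset fun n => inter_subset_left) fun x hx => ?_
    have hxR := mem_ball_zero_iff.1 (hKR hx)
    obtain ⟨n, hn⟩ := exists_nat_one_div_lt (sub_pos.2 hxR)
    exact mem_iUnion.2 ⟨n, hx, mem_ball_zero_iff.2 (by linarith)⟩
  have hlim : ∀ {f : Space d → ℝ}, Integrable f (volume.restrict K) →
      Tendsto (fun n => ∫ x in S n, f x) atTop (𝓝 (∫ x in K, f x)) := by
    intro f hf
    have := tendsto_setIntegral_of_monotone (μ := (volume : Measure (Space d))) (f := f) hSm hmono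
      (by rw [hU]; exact hf)
    rwa [hU] at this
  have hres : volume.restrict K ≤ volume.restrict (Metric.ball 0 R) :=
    Measure.restrict_mono hKR le_rfl
  have hu' := h.memLp_fun.mono_measure hres
  have l0 : Tendsto (fun n => volume.real (S n)) atTop (𝓝 (volume.real K)) := by
    have := hlim (integrable_const (1 : ℝ))
    simpa using this
  refine le_of_tendsto_of_tendsto' ((l0.mul (hlim hu'.integrable_sq)).sub
    ((hlim (hu'.integrable (by norm_num))).pow 2))
    ((l0.const_mul _).mul (tendsto_finsetSum _ fun i _ =>
      hlim ((memLp_apply h.memLp_grad i).mono_measure hres).integrable_sq)) fun n => ?_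
  exact hstep _ (sub_lt_self _ (by positivity))

theorem volume_real_ball_pos (x : Space d) {R : ℝ} (hR : 0 < R) :
    0 < volume.real (Metric.ball x R) :=
  ENNReal.toReal_pos (Metric.measure_ball_pos _ _ hR).ne' measure_ball_lt_top.ne

/-- The Poincaré inequality on balls. -/
theorem IsH1On.poincare {R : ℝ} (hR : 0 < R) {u : Space d → ℝ} {G : Space d → Space d}
    (h : IsH1On (Metric.ball 0 R) u G) :
    ∫ x in Metric.ball 0 R, (u x - ⨍ y in Metric.ball 0 R, u y) ^ 2
      ≤ 2 ^ d * (2 * R) ^ 2 * ∫ x in Metric.ball 0 R, ‖G x‖ ^ 2 := by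
  have hV := volume_real_ball_pos (0 : Space d) hR
  have h1 := h.poincare_convex Metric.isOpen_ball.measurableSet Subset.rfl (convex_ball _ _)
    (D := 2 * R) fun x hx y hy => by
      rw [mem_ball_zero_iff] at hx hy
      linarith [norm_sub_le y x]
  rw [← integral_norm_sq_eq h.memLp_grad] at h1
  rw [h.memLp_fun.integral_sq_sub_const, real_restrict_univ, average_eq, real_restrict_univ,
    smul_eq_mul]
  set A := ∫ x in Metric.ball 0 R, u x ^ 2
  set m := ∫ x in Metric.ball 0 R, u x
  set V := volume.real (Metric.ball (0 : Space d) R)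
  have e : A - 2 * m * (V⁻¹ * m) + V * (V⁻¹ * m) ^ 2 = V⁻¹ * (V * A - m ^ 2) := by
    field_simp; ring
  rw [e, inv_mul_le_iff₀ hV]
  linarith

theorem IsH1On.sub_const {R : ℝ} {u : Space d → ℝ} {G : Space d → Space d}
    (h : IsH1On (Metric.ball 0 R) u G) (c : ℝ) :
    IsH1On (Metric.ball 0 R) (fun x => u x - c) G := by
  refine ⟨h.memLp_fun.sub_two (memLp_const c), h.memLp_grad, fun ψ hψ i => ?_⟩
  have e : ∀ x, (u x - c) * partialDeriv i ψ x
      = u x * partialDeriv i ψ x - c * partialDeriv i ψ x := fun x => by ring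
  simp_rw [e]
  have h1 := (hψ.partialDeriv i).memLp (volume.restrict (Metric.ball 0 R)) 2
  rw [integral_sub (h.memLp_fun.integrable_mul_two h1)
    ((h1.integrable (by norm_num)).const_mul _), integral_const_mul,
    integral_partialDeriv_eq_zero hψ, h.weak_grad ψ hψ i]
  ring

theorem difference_smooth {v : Space d → ℝ} (hv : ContDiff ℝ ∞ v) {r r' : ℝ} (h : Space d)
    (hr : r + ‖h‖ ≤ r') :
    ∫ x in Metric.ball 0 r, (v (x + h) - v x) ^ 2
      ≤ ‖h‖ ^ 2 * ∑ i, ∫ x in Metric.ball 0 r', partialDeriv i v x ^ 2 := by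
  set g : Space d → ℝ≥0∞ := fun x => ENNReal.ofReal (∑ i, partialDeriv i v x ^ 2) with hg
  have hgm : Measurable g := (continuous_sum_sq_partialDeriv hv).measurable.ennreal_ofReal
  have h1 : ∫⁻ x in Metric.ball 0 r, ENNReal.ofReal ((v (x + h) - v x) ^ 2)
      ≤ ENNReal.ofReal (‖h‖ ^ 2) * ∫⁻ x in Metric.ball 0 r', g x := by
    calc ∫⁻ x in Metric.ball 0 r, ENNReal.ofReal ((v (x + h) - v x) ^ 2)
        ≤ ∫⁻ x in Metric.ball 0 r, ENNReal.ofReal (‖h‖ ^ 2) *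
            ∫⁻ t in Icc (0 : ℝ) 1, g (x + t • h) := lintegral_mono fun x => by
          simpa using sq_sub_le_lintegral_segment hv x (x + h)
      _ = ENNReal.ofReal (‖h‖ ^ 2) * ∫⁻ t in Icc (0 : ℝ) 1,
            ∫⁻ x in Metric.ball 0 r, g (x + t • h) := by
          rw [lintegral_const_mul' _ _ ENNReal.ofReal_ne_top]
          congr 1
          exact lintegral_lintegral_swap (hgm.comp (by fun_prop :
            Measurable fun q : Space d × ℝ => q.1 + q.2 • h)).aemeasurable
      _ ≤ ENNReal.ofReal (‖h‖ ^ 2) * ∫⁻ t in Icc (0 : ℝ) 1,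
            ∫⁻ x in Metric.ball 0 r', g x := by
          refine mul_le_mul_right (setLIntegral_mono' measurableSet_Icc fun t ht => ?_) _
          have := setLIntegral_comp_affine_le hgm one_pos (t • h)
            (K := Metric.ball 0 r) (K' := Metric.ball 0 r') Metric.isOpen_ball.measurableSet
            Metric.isOpen_ball.measurableSet fun x hx => by
              rw [mem_ball_zero_iff] at hx ⊢
              have h2 : ‖t • h‖ ≤ ‖h‖ := by
                rw [norm_smul, Real.norm_eq_abs, abs_of_nonneg ht.1]
                exact mul_le_of_le_one_left (norm_nonneg _) ht.2
              have := norm_add_le ((1 : ℝ) • x) (t • h)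
              rw [one_smul] at this ⊢
              linarith
          simpa using this
      _ = _ := by rw [setLIntegral_const]; simp
  have hmem : ∀ {f : Space d → ℝ}, ContDiff ℝ ∞ f → ∀ r, MemLp f 2
      (volume.restrict (Metric.ball 0 r)) := fun hf r => memLp_ball_of_continuous hf.continuous r
  have hgi : ∀ i, Integrable (fun x => partialDeriv i v x ^ 2)
      (volume.restrict (Metric.ball 0 r')) := fun i =>
    (hmem (contDiff_partialDeriv hv i) r').integrable_sq
  have hvh : ContDiff ℝ ∞ fun x => v (x + h) := hv.comp (contDiff_id.add contDiff_const)
  rw [← ofReal_integral_eq_lintegral_ofReal ((hmem hvh r).sub_two (hmem hv r)).integrable_sq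
      (Eventually.of_forall fun x => sq_nonneg _),
    ← ofReal_integral_eq_lintegral_ofReal (integrable_finsetSum _ fun i _ => hgi i)
      (Eventually.of_forall fun x => Finset.sum_nonneg fun i _ => sq_nonneg _),
    integral_finsetSum _ fun i _ => hgi i, ← ENNReal.ofReal_mul (sq_nonneg _),
    ENNReal.ofReal_le_ofReal_iff (mul_nonneg (sq_nonneg _) (Finset.sum_nonneg fun i _ =>
      integral_nonneg fun x => sq_nonneg _))] at h1
  exact h1

theorem measurePreserving_add_ball (h : Space d) (r : ℝ) :
    MeasurePreserving (fun x => x + h) (volume.restrict (Metric.ball 0 r))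
      (volume.restrict (Metric.ball h r)) := by
  have h1 := (measurePreserving_add_right (volume : Measure (Space d)) h).restrict_preimage
    (s := Metric.ball h r) Metric.isOpen_ball.measurableSet
  have : (fun x => x + h) ⁻¹' Metric.ball h r = Metric.ball 0 r := by
    ext x; simp [dist_eq_norm]
  rwa [this] at h1

theorem ball_subset_of_add_le {h : Space d} {r r' : ℝ} (hr : r + ‖h‖ ≤ r') :
    Metric.ball h r ⊆ Metric.ball 0 r' :=
  Metric.ball_subset_ball' (by rwa [dist_zero_right])

theorem MeasureTheory.MemLp.translate {E : Type*} [NormedAddCommGroup E] {f : Space d → E}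
    {h : Space d} {r r' : ℝ}
    (hr : r + ‖h‖ ≤ r') (hf : MemLp f 2 (volume.restrict (Metric.ball 0 r'))) :
    MemLp (fun x => f (x + h)) 2 (volume.restrict (Metric.ball 0 r)) :=
  (hf.mono_measure (Measure.restrict_mono (ball_subset_of_add_le hr)
    le_rfl)).comp_measurePreserving (measurePreserving_add_ball h r)

theorem setIntegral_translate (f : Space d → ℝ) (h : Space d) (r : ℝ) :
    ∫ x in Metric.ball 0 r, f (x + h) = ∫ x in Metric.ball h r, f x :=
  (measurePreserving_add_ball h r).integral_comp (measurableEmbedding_addRight h) f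

theorem setIntegral_translate_le {f : Space d → ℝ} (hf0 : ∀ x, 0 ≤ f x) {h : Space d} {r r' : ℝ}
    (hr : r + ‖h‖ ≤ r') (hf : Integrable f (volume.restrict (Metric.ball 0 r'))) :
    ∫ x in Metric.ball 0 r, f (x + h) ≤ ∫ x in Metric.ball 0 r', f x := by
  rw [setIntegral_translate]
  exact setIntegral_mono_set hf (Eventually.of_forall hf0)
    (ball_subset_of_add_le hr).eventuallyLE

/-- The `L²` norm of a difference is controlled by the gradient. -/
theorem IsH1On.difference {R r r' : ℝ} {u : Space d → ℝ} {G : Space d → Space d}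
    (hu : IsH1On (Metric.ball 0 R) u G) (h : Space d) (hr : r + ‖h‖ ≤ r') (hr' : r' < R) :
    ∫ x in Metric.ball 0 r, (u (x + h) - u x) ^ 2
      ≤ ‖h‖ ^ 2 * ∫ x in Metric.ball 0 r', ‖G x‖ ^ 2 := by
  obtain ⟨v, hvs, hv, hvg⟩ := hu.exists_smooth_approx hr'
  have hu' := hu.mono (Metric.ball_subset_ball hr'.le)
  have hrr' : r ≤ r' := by linarith [norm_nonneg h]
  have hmem : ∀ {f : Space d → ℝ}, ContDiff ℝ ∞ f → ∀ r, MemLp f 2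
      (volume.restrict (Metric.ball 0 r)) := fun hf r => memLp_ball_of_continuous hf.continuous r
  have hur : MemLp u 2 (volume.restrict (Metric.ball 0 r)) :=
    hu'.memLp_fun.mono_measure (Measure.restrict_mono (Metric.ball_subset_ball hrr') le_rfl)
  have huh := hu'.memLp_fun.translate hr
  have hvh : ∀ n, ContDiff ℝ ∞ fun x => v n (x + h) := fun n =>
    (hvs n).comp (contDiff_id.add contDiff_const)
  have hdiff : Tendsto (fun n => ∫ x in Metric.ball 0 r,
      ((v n (x + h) - v n x) - (u (x + h) - u x)) ^ 2) atTop (𝓝 0) := by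
    have h4 := hv.const_mul 4
    rw [mul_zero] at h4
    refine squeeze_zero (fun n => integral_nonneg fun x => sq_nonneg _) (fun n => ?_) h4
    have e : ∀ x, ((v n (x + h) - v n x) - (u (x + h) - u x)) ^ 2
        = ((v n (x + h) - u (x + h)) - (v n x - u x)) ^ 2 := fun x => by ring
    simp_rw [e]
    refine (integral_sq_sub_le ((hmem (hvh n) r).sub_two huh)
      ((hmem (hvs n) r).sub_two hur)).trans ?_
    have hi := ((hmem (hvs n) r').sub_two hu'.memLp_fun).integrable_sq
    have h5 := setIntegral_translate_le (f := fun x => (v n x - u x) ^ 2)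
      (fun x => sq_nonneg _) hr hi
    have h6 : ∫ x in Metric.ball 0 r, (v n x - u x) ^ 2
        ≤ ∫ x in Metric.ball 0 r', (v n x - u x) ^ 2 :=
      setIntegral_mono_set hi (Eventually.of_forall fun x => sq_nonneg _)
        (Metric.ball_subset_ball hrr').eventuallyLE
    linarith
  have l1 := tendsto_integral_sq_of_strong
    (Eventually.of_forall fun n => (hmem (hvh n) r).sub_two (hmem (hvs n) r))
    (huh.sub_two hur) hdiff
  have l2 := fun i => tendsto_integral_sq_of_strong
    (Eventually.of_forall fun n => hmem (contDiff_partialDeriv (hvs n) i) r')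
    (memLp_apply hu'.memLp_grad i) (hvg i)
  rw [integral_norm_sq_eq hu'.memLp_grad]
  exact le_of_tendsto_of_tendsto' l1 ((tendsto_finsetSum _ fun i _ => l2 i).const_mul _)
    fun n => difference_smooth (hvs n) h hr

end Poincare


/-! ### Ellipticity and the Caccioppoli inequality -/

section Caccioppoli

variable {d : ℕ} {lam : ℝ}

/-- `λ |ξ|² ≤ ξ · A ξ` and `|A ξ|² ≤ λ⁻² |ξ|²` for all `ξ ∈ ℝ^d`. -/
def IsBoundedElliptic (lam : ℝ) (A : Matrix (Fin d) (Fin d) ℝ) : Prop :=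
  ∀ ξ : Fin d → ℝ, lam * (ξ ⬝ᵥ ξ) ≤ ξ ⬝ᵥ (A *ᵥ ξ) ∧
    (A *ᵥ ξ) ⬝ᵥ (A *ᵥ ξ) ≤ lam⁻¹ ^ 2 * (ξ ⬝ᵥ ξ)

theorem dotProduct_self_nonneg' (ξ : Fin d → ℝ) : 0 ≤ ξ ⬝ᵥ ξ :=
  Finset.sum_nonneg fun i _ => mul_self_nonneg (ξ i)

theorem sq_dotProduct_le (ξ η : Fin d → ℝ) : (ξ ⬝ᵥ η) ^ 2 ≤ (ξ ⬝ᵥ ξ) * (η ⬝ᵥ η) := by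
  have := Finset.sum_mul_sq_le_sq_mul_sq Finset.univ ξ η
  simpa [dotProduct, pow_two] using this

/-- Coercivity makes `A` invertible, so `A⁻¹` is its true inverse. Inserting `A ξ` into the second
inequality gives `λ |Aξ|² ≤ Aξ · ξ ≤ |Aξ| |ξ|`. Unlike the bound on the inverse, the resulting
closed condition passes directly to limits of matrices. -/
theorem IsEllipticMatrix.isBoundedElliptic (hlam : 0 < lam) {A : Matrix (Fin d) (Fin d) ℝ}
    (h : IsEllipticMatrix lam A) : IsBoundedElliptic lam A := by
  have hinj : ∀ ξ : Fin d → ℝ, A *ᵥ ξ = 0 → ξ = 0 := by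
    intro ξ hξ
    have h1 := (h ξ).1
    rw [hξ, dotProduct_zero] at h1
    have h2 : ξ ⬝ᵥ ξ = 0 := le_antisymm (by nlinarith [dotProduct_self_nonneg' ξ])
      (dotProduct_self_nonneg' ξ)
    exact dotProduct_self_eq_zero.1 h2
  have hunit : IsUnit A := by
    rw [← Matrix.mulVec_injective_iff_isUnit]
    intro ξ η hξη
    have := hinj (ξ - η) (by rw [Matrix.mulVec_sub]; exact sub_eq_zero.2 hξη)
    exact sub_eq_zero.1 this
  intro ξ
  refine ⟨(h ξ).1, ?_⟩
  have h2 := (h (A *ᵥ ξ)).2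
  rw [Matrix.mulVec_mulVec, Matrix.nonsing_inv_mul _ ((Matrix.isUnit_iff_isUnit_det A).1 hunit),
    Matrix.one_mulVec] at h2
  have h3 := sq_dotProduct_le (A *ᵥ ξ) ξ
  set P := (A *ᵥ ξ) ⬝ᵥ (A *ᵥ ξ)
  set q := (A *ᵥ ξ) ⬝ᵥ ξ
  have hP : 0 ≤ P := dotProduct_self_nonneg' _
  have hX := dotProduct_self_nonneg' ξ
  rcases hP.eq_or_lt with h0 | h0
  · rw [← h0]; positivity
  · have h4 : (lam * P) ^ 2 ≤ P * (ξ ⬝ᵥ ξ) :=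
      (pow_le_pow_left₀ (by positivity) h2 2).trans h3
    have h5 : lam ^ 2 * P ≤ ξ ⬝ᵥ ξ := by
      refine le_of_mul_le_mul_left ?_ h0
      linarith
    rw [inv_pow, ← div_eq_inv_mul, le_div_iff₀ (by positivity)]
    linarith

/-- A measurable coefficient field with uniform ellipticity constants. -/
structure IsBoundedEllipticField (lam : ℝ) (a : CoeffField d) : Prop where
  aemeasurable : ∀ i j, AEMeasurable (fun x => a x i j) volume
  elliptic : ∀ᵐ x ∂(volume : Measure (Space d)), IsBoundedElliptic lam (a x)

theorem dotProduct_self_eq_norm_sq (v : Space d) : v.ofLp ⬝ᵥ v.ofLp = ‖v‖ ^ 2 := by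
  rw [norm_sq_eq_sum]; simp [dotProduct, pow_two]

theorem IsBoundedElliptic.flux_sq_le {a : CoeffField d} {x : Space d}
    (h : IsBoundedElliptic lam (a x)) (G : Space d → Space d) :
    ∑ i, flux a G x i ^ 2 ≤ lam⁻¹ ^ 2 * ‖G x‖ ^ 2 := by
  have := (h (G x).ofLp).2
  rw [dotProduct_self_eq_norm_sq (G x)] at this
  exact (Finset.sum_congr rfl fun i _ => pow_two _).trans_le this

theorem IsBoundedElliptic.le_flux {a : CoeffField d} {x : Space d}
    (h : IsBoundedElliptic lam (a x)) (G : Space d → Space d) :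
    lam * ‖G x‖ ^ 2 ≤ ∑ i, flux a G x i * G x i := by
  have := (h (G x).ofLp).1
  rw [dotProduct_self_eq_norm_sq, dotProduct_comm] at this
  exact this

theorem IsBoundedEllipticField.memLp_flux {a : CoeffField d} (ha : IsBoundedEllipticField lam a)
    {S : Set (Space d)} {G : Space d → Space d}
    (hG : MemLp G 2 (volume.restrict S)) (i : Fin d) :
    MemLp (fun x => flux a G x i) 2 (volume.restrict S) := by
  refine hG.norm.of_le_mul (c := |lam⁻¹|) ?_ ?_
  · refine (Finset.aemeasurable_fun_sum _ fun j _ => ?_).aestronglyMeasurable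
    exact (ha.aemeasurable i j).restrict.mul (memLp_apply hG j).1.aemeasurable
  · filter_upwards [ae_restrict_of_ae ha.elliptic] with x hx
    have h1 := hx.flux_sq_le G
    have h2 : flux a G x i ^ 2 ≤ ∑ i, flux a G x i ^ 2 :=
      Finset.single_le_sum (f := fun i => flux a G x i ^ 2) (fun i _ => sq_nonneg _)
        (Finset.mem_univ i)
    rw [norm_norm, Real.norm_eq_abs]
    refine abs_le_of_sq_le_sq ?_ (by positivity)
    rw [mul_pow, sq_abs]
    exact h2.trans h1

theorem IsBoundedEllipticField.integral_flux_sq_le {a : CoeffField d}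
    (ha : IsBoundedEllipticField lam a) {S : Set (Space d)} {G : Space d → Space d}
    (hG : MemLp G 2 (volume.restrict S)) (i : Fin d) :
    ∫ x in S, flux a G x i ^ 2 ≤ lam⁻¹ ^ 2 * ∫ x in S, ‖G x‖ ^ 2 := by
  rw [← integral_const_mul]
  refine integral_mono_ae (ha.memLp_flux hG i).integrable_sq
    ((integrable_norm_sq hG).const_mul _) ?_
  filter_upwards [ae_restrict_of_ae ha.elliptic] with x hx
  exact (Finset.single_le_sum (f := fun i => flux a G x i ^ 2) (fun i _ => sq_nonneg _)
    (Finset.mem_univ i)).trans (hx.flux_sq_le G)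

/-- Cutoff functions with the natural scaling. -/
theorem exists_cutoff (d : ℕ) : ∃ M : ℝ, 0 ≤ M ∧ ∀ r : ℝ, 0 < r → ∃ η : Space d → ℝ,
    IsTestFunction (Metric.ball 0 (2 * r)) η ∧ (∀ x, 0 ≤ η x) ∧ (∀ x, η x ≤ 1) ∧
    (∀ x ∈ Metric.ball (0 : Space d) r, η x = 1) ∧
    ∀ x, ∑ i, partialDeriv i η x ^ 2 ≤ M / r ^ 2 := by
  -- The outer radius `3/2` places the closed support strictly inside the ball of radius `2`.
  let χ : ContDiffBump (0 : Space d) := ⟨1, 3 / 2, one_pos, by norm_num⟩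
  have hχ : ContDiff ℝ ∞ (χ : Space d → ℝ) := χ.contDiff
  have hcont : Continuous fun x => ∑ i, partialDeriv i χ x ^ 2 := continuous_sum_sq_partialDeriv hχ
  obtain ⟨M, hM⟩ := (isCompact_closedBall (0 : Space d) 2).exists_bound_of_continuousOn
    hcont.continuousOn
  have hM0 : 0 ≤ M := (norm_nonneg _).trans (hM 0 (by simp))
  have hMall : ∀ x, ∑ i, partialDeriv i χ x ^ 2 ≤ M := by
    intro x
    by_cases hx : x ∈ Metric.closedBall (0 : Space d) 2
    · exact (le_abs_self _).trans (hM x hx)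
    · have : x ∉ tsupport χ := by
        rw [χ.tsupport_eq]
        exact fun h => hx (Metric.closedBall_subset_closedBall (by norm_num [χ]) h)
      have h0 : ∀ i, partialDeriv i χ x = 0 := fun i =>
        image_eq_zero_of_notMem_tsupport fun h => this (tsupport_partialDeriv_subset _ i h)
      simp [h0, hM0]
  refine ⟨M, hM0, fun r hr => ⟨fun x => χ (r⁻¹ • x), ⟨?_, ?_, ?_⟩, fun x => χ.nonneg,
    fun x => χ.le_one, fun x hx => ?_, fun x => ?_⟩⟩
  · exact hχ.comp (contDiff_const_smul _)
  · exact χ.hasCompactSupport.comp_homeomorph (Homeomorph.smulOfNeZero r⁻¹ (inv_ne_zero hr.ne'))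
  · have hsupp : Function.support (fun x => χ (r⁻¹ • x))
        ⊆ Metric.closedBall 0 (3 / 2 * r) := by
      intro x hx
      have h1 : r⁻¹ • x ∈ Function.support χ := hx
      rw [χ.support_eq, mem_ball_zero_iff, norm_smul, norm_inv, Real.norm_eq_abs,
        abs_of_pos hr, inv_mul_lt_iff₀ hr] at h1
      rw [mem_closedBall_zero_iff]
      change ‖x‖ < r * (3 / 2) at h1
      linarith
    refine (closure_minimal hsupp Metric.isClosed_closedBall).trans ?_
    exact Metric.closedBall_subset_ball (by linarith)
  · refine χ.one_of_mem_closedBall ?_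
    rw [mem_ball_zero_iff] at hx
    rw [mem_closedBall_zero_iff, norm_smul, norm_inv, Real.norm_eq_abs, abs_of_pos hr,
      inv_mul_le_iff₀ hr]
    change ‖x‖ ≤ r * 1
    linarith
  · have h1 : ∀ i, partialDeriv i (fun x => χ (r⁻¹ • x)) x = r⁻¹ * partialDeriv i χ (r⁻¹ • x) := by
      intro i
      have h2 : HasFDerivAt (fun x : Space d => χ (r⁻¹ • x)) ((fderiv ℝ χ (r⁻¹ • x)).comp
          (r⁻¹ • ContinuousLinearMap.id ℝ (Space d))) x :=
        HasFDerivAt.comp (g := (χ : Space d → ℝ)) x (hχ.differentiable (by simp) _).hasFDerivAt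
          ((hasFDerivAt_id x).const_smul r⁻¹)
      simp [partialDeriv, h2.fderiv]
    simp_rw [h1, mul_pow]
    rw [← Finset.mul_sum, inv_pow, ← div_eq_inv_mul]
    exact div_le_div_of_nonneg_right (hMall _) (by positivity)

/-- The Caccioppoli inequality. -/
theorem exists_caccioppoli (d : ℕ) (hlam : 0 < lam) : ∃ C : ℝ, 0 < C ∧
    ∀ (a : CoeffField d), IsBoundedEllipticField lam a → ∀ (r : ℝ), 0 < r →
    ∀ (u : Space d → ℝ) (Du : Space d → Space d),
    IsHarmonicOn a (Metric.ball 0 (2 * r)) u Du → ∀ c : ℝ,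
    ∫ x in Metric.ball 0 r, ‖Du x‖ ^ 2
      ≤ C / r ^ 2 * ∫ x in Metric.ball 0 (2 * r), (u x - c) ^ 2 := by
  obtain ⟨M, hM0, hM⟩ := exists_cutoff d
  refine ⟨4 * lam⁻¹ ^ 4 * (M + 1), by positivity, fun a ha r hr u Du hu c => ?_⟩
  obtain ⟨η, hη, hη0, hη1, hηr, hηg⟩ := hM r hr
  set B := Metric.ball (0 : Space d) (2 * r)
  have hz := hu.h1.sub_const c
  have hQ := fun i => ha.memLp_flux hu.h1.memLp_grad i
  -- The equation is tested with `η² (u - c)`.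
  have ht := hu.eqn.integral_test_mul (by linarith) hQ hz (hη.mul_smooth hη.smooth)
  simp only [partialDeriv_mul hη.smooth hη.smooth] at ht
  have hDu := hu.h1.memLp_grad
  have hηDu : MemLp (fun x => η x * ‖Du x‖) 2 (volume.restrict B) := hDu.norm.mul_test hη
  have hI1 : Integrable (fun x => η x ^ 2 * ‖Du x‖ ^ 2) (volume.restrict B) := by
    have := hηDu.integrable_sq
    simpa only [mul_pow] using this
  have hI2 : Integrable (fun x => (u x - c) ^ 2) (volume.restrict B) := hz.memLp_fun.integrable_sq
  have hI3 : Integrable (fun x => η x * η x * ∑ i, flux a Du x i * Du x i)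
      (volume.restrict B) := by
    have : Integrable (fun x => ∑ i, (η x * flux a Du x i) * (η x * Du x i))
        (volume.restrict B) := integrable_finsetSum _ fun i _ =>
      ((hQ i).mul_test hη).integrable_mul_two ((memLp_apply hDu i).mul_test hη)
    refine this.congr (Eventually.of_forall fun x => ?_)
    simp only [Finset.mul_sum]
    exact Finset.sum_congr rfl fun i _ => by ring
  have hI4 : Integrable (fun x => (u x - c) * ∑ i, flux a Du x i *
      (η x * partialDeriv i η x + η x * partialDeriv i η x)) (volume.restrict B) := by
    have : Integrable (fun x => ∑ i, 2 * ((η x * flux a Du x i) *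
        (partialDeriv i η x * (u x - c)))) (volume.restrict B) := integrable_finsetSum _ fun i _ =>
      (((hQ i).mul_test hη).integrable_mul_two
        (hz.memLp_fun.mul_test (hη.partialDeriv i))).const_mul 2
    refine this.congr (Eventually.of_forall fun x => ?_)
    simp only [Finset.mul_sum]
    exact Finset.sum_congr rfl fun i _ => by ring
  have hmain : lam / 2 * ∫ x in B, η x ^ 2 * ‖Du x‖ ^ 2
      ≤ 2 * lam⁻¹ ^ 3 * (M / r ^ 2) * ∫ x in B, (u x - c) ^ 2 := by
    have h0 : ∫ x in B, (η x * η x * ∑ i, flux a Du x i * Du x i + (u x - c) *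
        ∑ i, flux a Du x i * (η x * partialDeriv i η x + η x * partialDeriv i η x)) = 0 := by
      rw [integral_add hI3 hI4]; linarith
    rw [← integral_const_mul, ← integral_const_mul, ← sub_nonpos,
      ← integral_sub (hI1.const_mul _) (hI2.const_mul _), ← h0]
    refine integral_mono_ae ((hI1.const_mul _).sub (hI2.const_mul _)) (hI3.add hI4) ?_
    filter_upwards [ae_restrict_of_ae ha.elliptic] with x hx
    have h1 := hx.le_flux Du
    have h2 := hx.flux_sq_le Du
    have h3 := Finset.sum_mul_sq_le_sq_mul_sq Finset.univ (flux a Du x) fun i => partialDeriv i η x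
    set S := ∑ i, flux a Du x i * partialDeriv i η x with hS
    have e : ∑ i, flux a Du x i * (η x * partialDeriv i η x + η x * partialDeriv i η x)
        = 2 * η x * S := by
      rw [hS, Finset.mul_sum]; exact Finset.sum_congr rfl fun i _ => by ring
    rw [e]
    set N := ‖Du x‖ ^ 2
    have hN : 0 ≤ N := by positivity
    have hS2 : S ^ 2 ≤ lam⁻¹ ^ 2 * N * (M / r ^ 2) :=
      h3.trans (mul_le_mul h2 (hηg x) (Finset.sum_nonneg fun i _ => sq_nonneg _) (by positivity))
    set z := u x - c
    have h4 : η x * η x * (lam * N) ≤ η x * η x * ∑ i, flux a Du x i * Du x i :=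
      mul_le_mul_of_nonneg_left h1 (mul_self_nonneg _)
    -- Young's inequality: `p` and `q` are chosen so that the square of the cross term is at most `4
    -- p q`, with `p` half of the coercive term and hence absorbable.
    have h5 : -(z * (2 * η x * S)) ≤ lam / 2 * (η x ^ 2 * N)
        + 2 * lam⁻¹ ^ 3 * (M / r ^ 2) * z ^ 2 := by
      have h6 : (2 * z * (η x * S)) ^ 2 ≤ 4 * z ^ 2 * (η x ^ 2 * (lam⁻¹ ^ 2 * N * (M / r ^ 2))) := by
        have := mul_le_mul_of_nonneg_left hS2 (by positivity : 0 ≤ 4 * z ^ 2 * η x ^ 2)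
        linarith
      set p := lam / 2 * (η x ^ 2 * N)
      set q := 2 * lam⁻¹ ^ 3 * (M / r ^ 2) * z ^ 2
      have hp : 0 ≤ p := by positivity
      have hq : 0 ≤ q := by positivity
      have hpq : 4 * z ^ 2 * (η x ^ 2 * (lam⁻¹ ^ 2 * N * (M / r ^ 2))) = 4 * (p * q) := by
        simp only [p, q]; field_simp
      rw [hpq] at h6
      have h7 : (2 * z * (η x * S)) ^ 2 ≤ (p + q) ^ 2 := by nlinarith [sq_nonneg (p - q)]
      have := abs_le_of_sq_le_sq h7 (by positivity)
      linarith [neg_abs_le (2 * z * (η x * S))]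
    nlinarith
  have hlow : ∫ x in Metric.ball 0 r, ‖Du x‖ ^ 2 ≤ ∫ x in B, η x ^ 2 * ‖Du x‖ ^ 2 := by
    have hsub : Metric.ball (0 : Space d) r ⊆ B := Metric.ball_subset_ball (by linarith)
    have e : ∫ x in Metric.ball 0 r, ‖Du x‖ ^ 2 = ∫ x in Metric.ball 0 r, η x ^ 2 * ‖Du x‖ ^ 2 :=
      setIntegral_congr_fun Metric.isOpen_ball.measurableSet fun x hx => by simp [hηr x hx]
    rw [e]
    exact setIntegral_mono_set hI1 (Eventually.of_forall fun x => by positivity) hsub.eventuallyLE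
  have hJ : 0 ≤ ∫ x in B, (u x - c) ^ 2 := integral_nonneg fun x => sq_nonneg _
  refine hlow.trans ?_
  have h8 : ∫ x in B, η x ^ 2 * ‖Du x‖ ^ 2 ≤ 4 * lam⁻¹ ^ 4 * (M / r ^ 2)
      * ∫ x in B, (u x - c) ^ 2 := by
    refine le_of_mul_le_mul_left ?_ (by positivity : 0 < lam / 2)
    refine hmain.trans (le_of_eq ?_)
    field_simp
    ring
  refine h8.trans (mul_le_mul_of_nonneg_right ?_ hJ)
  rw [mul_div_assoc]
  gcongr
  linarith

end Caccioppoli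


/-! ### Weak limits along an ultrafilter -/

section WeakLimits

variable {X : Type*} [MeasurableSpace X] {μ : Measure X} {ι : Type*}

/-- Weak convergence in `L²(μ)`. -/
def TendstoWeakly (l : Filter ι) (μ : Measure X) (F : ι → X → ℝ) (f : X → ℝ) : Prop :=
  ∀ g : X → ℝ, MemLp g 2 μ → Tendsto (fun n => ∫ x, F n x * g x ∂μ) l (𝓝 (∫ x, f x * g x ∂μ))

theorem MeasureTheory.MemLp.norm_toLp_sq {f : X → ℝ} (hf : MemLp f 2 μ) :
    ‖hf.toLp‖ ^ 2 = ∫ x, f x ^ 2 ∂μ := by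
  rw [← real_inner_self_eq_norm_sq, L2.inner_def]
  refine integral_congr_ae ?_
  filter_upwards [hf.coeFn_toLp] with x hx
  simp [hx, pow_two]

theorem inner_toLp {f g : X → ℝ} (hf : MemLp f 2 μ) (hg : MemLp g 2 μ) :
    inner ℝ hf.toLp hg.toLp = ∫ x, f x * g x ∂μ := by
  rw [L2.inner_def]
  refine integral_congr_ae ?_
  filter_upwards [hf.coeFn_toLp, hg.coeFn_toLp] with x hx hx'
  simp [hx, hx', mul_comm]

/-- Bounded families in `L²` converge weakly along ultrafilters. -/
theorem exists_tendstoWeakly (U : Ultrafilter ι) {F : ι → X → ℝ} {C : ℝ}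
    (hF : ∀ᶠ n in (U : Filter ι), MemLp (F n) 2 μ)
    (hC : ∀ᶠ n in (U : Filter ι), ∫ x, F n x ^ 2 ∂μ ≤ C) :
    ∃ f, MemLp f 2 μ ∧ ∫ x, f x ^ 2 ∂μ ≤ C ∧ TendstoWeakly U μ F f := by
  classical
  -- The default value `0` is taken only outside a set of the ultrafilter, hence does not affect the
  -- limit.
  let T : ι → Lp ℝ 2 μ := fun n => if h : MemLp (F n) 2 μ then h.toLp else 0
  let D := InnerProductSpace.toDual ℝ (Lp ℝ 2 μ)
  -- Banach–Alaoglu makes this ball weak-* compact, so the ultrafilter converges in it and no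
  -- subsequence has to be extracted.
  let K : Set (WeakDual ℝ (Lp ℝ 2 μ)) :=
    WeakDual.toStrongDual ⁻¹' Metric.closedBall (0 : StrongDual ℝ (Lp ℝ 2 μ)) (√C)
  have hK : IsCompact K := WeakDual.isCompact_closedBall _ _
  let Φ : ι → WeakDual ℝ (Lp ℝ 2 μ) := fun n => StrongDual.toWeakDual (D (T n))
  have hC0 : 0 ≤ C := by
    obtain ⟨n, hn⟩ := hC.exists
    exact (integral_nonneg fun x => sq_nonneg _).trans hn
  have hΦ : ∀ᶠ n in (U : Filter ι), Φ n ∈ K := by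
    filter_upwards [hF, hC] with n h1 h2
    change dist (D (T n)) 0 ≤ √C
    rw [dist_zero_right, LinearIsometryEquiv.norm_map]
    refine Real.le_sqrt_of_sq_le ?_
    simp only [T, h1, dif_pos]
    rwa [h1.norm_toLp_sq]
  obtain ⟨ℓ, hℓK, hℓ⟩ := hK.ultrafilter_le_nhds (U.map Φ)
    (by rw [Ultrafilter.coe_map, le_principal_iff]; exact hΦ)
  have hlim : ∀ g : Lp ℝ 2 μ, Tendsto (fun n => inner ℝ (T n) g) U (𝓝 (ℓ g)) := by
    intro g
    have h1 : Tendsto Φ U (𝓝 ℓ) := by rwa [Ultrafilter.coe_map] at hℓ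
    exact ((WeakDual.eval_continuous g).tendsto ℓ).comp h1
  let f : Lp ℝ 2 μ := D.symm (WeakDual.toStrongDual ℓ)
  have hf : ∀ g : Lp ℝ 2 μ, ℓ g = inner ℝ f g := fun g => by
    change WeakDual.toStrongDual ℓ g = _
    rw [← InnerProductSpace.toDual_apply_apply (𝕜 := ℝ)]
    simp [f, D]
  have hfm : MemLp f 2 μ := Lp.memLp f
  have hff : hfm.toLp = f := Lp.toLp_coeFn f hfm
  refine ⟨f, hfm, ?_, fun g hg => ?_⟩
  · rw [← hfm.norm_toLp_sq, hff]
    have : ‖f‖ ≤ √C := by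
      simp only [f, LinearIsometryEquiv.norm_map]
      have := hℓK
      change dist (WeakDual.toStrongDual ℓ) 0 ≤ √C at this
      rwa [dist_zero_right] at this
    calc ‖f‖ ^ 2 ≤ √C ^ 2 := by gcongr
      _ = C := Real.sq_sqrt hC0
  · have h1 := hlim hg.toLp
    rw [hf, ← hff, inner_toLp hfm hg] at h1
    refine h1.congr' ?_
    filter_upwards [hF] with n hn
    simp only [T, hn, dif_pos]
    exact inner_toLp hn hg

theorem TendstoWeakly.congr_limit {l : Filter ι} {F : ι → X → ℝ} {f f' : X → ℝ}
    (h : TendstoWeakly l μ F f) (hf : f =ᵐ[μ] f') : TendstoWeakly l μ F f' := fun g hg => by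
  have e : ∫ x, f x * g x ∂μ = ∫ x, f' x * g x ∂μ :=
    integral_congr_ae (hf.mul (ae_eq_refl g))
  exact e ▸ h g hg

theorem TendstoWeakly.add {l : Filter ι} {F F' : ι → X → ℝ} {f f' : X → ℝ}
    (h : TendstoWeakly l μ F f) (h' : TendstoWeakly l μ F' f')
    (hF : ∀ᶠ n in l, MemLp (F n) 2 μ) (hF' : ∀ᶠ n in l, MemLp (F' n) 2 μ)
    (hf : MemLp f 2 μ) (hf' : MemLp f' 2 μ) :
    TendstoWeakly l μ (fun n x => F n x + F' n x) (fun x => f x + f' x) := fun g hg => by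
  have e : ∫ x, (f x + f' x) * g x ∂μ = (∫ x, f x * g x ∂μ) + ∫ x, f' x * g x ∂μ := by
    rw [← integral_add (hf.integrable_mul_two hg) (hf'.integrable_mul_two hg)]
    simp only [add_mul]
  rw [e]
  refine ((h g hg).add (h' g hg)).congr' ?_
  filter_upwards [hF, hF'] with n h1 h2
  rw [← integral_add (h1.integrable_mul_two hg) (h2.integrable_mul_two hg)]
  simp only [add_mul]

theorem TendstoWeakly.mul_const {l : Filter ι} {F : ι → X → ℝ} {f : X → ℝ}
    {c : ι → ℝ} {c₀ : ℝ} (h : TendstoWeakly l μ F f) (hc : Tendsto c l (𝓝 c₀)) :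
    TendstoWeakly l μ (fun n x => c n * F n x) (fun x => c₀ * f x) := fun g hg => by
  simp only [mul_assoc, integral_const_mul]
  exact hc.mul (h g hg)

theorem TendstoWeakly.sum {l : Filter ι} {κ : Type*} (s : Finset κ) {F : κ → ι → X → ℝ}
    {f : κ → X → ℝ} (h : ∀ k ∈ s, TendstoWeakly l μ (F k) (f k))
    (hF : ∀ k ∈ s, ∀ᶠ n in l, MemLp (F k n) 2 μ) (hf : ∀ k ∈ s, MemLp (f k) 2 μ) :
    TendstoWeakly l μ (fun n x => ∑ k ∈ s, F k n x) (fun x => ∑ k ∈ s, f k x) := fun g hg => by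
  simp only [Finset.sum_mul]
  rw [integral_finsetSum _ fun k hk => (hf k hk).integrable_mul_two hg]
  refine (tendsto_finsetSum s fun k hk => h k hk g hg).congr' ?_
  filter_upwards [(Finset.eventually_all s).2 hF] with n hn
  rw [integral_finsetSum _ fun k hk => (hn k hk).integrable_mul_two hg]

theorem TendstoWeakly.ae_eq {l : Filter ι} [l.NeBot] {F : ι → X → ℝ} {f f' : X → ℝ}
    (h : TendstoWeakly l μ F f) (h' : TendstoWeakly l μ F f') (hf : MemLp f 2 μ)
    (hf' : MemLp f' 2 μ) : f =ᵐ[μ] f' := by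
  have hg := hf.sub_two hf'
  have e := tendsto_nhds_unique (h _ hg) (h' _ hg)
  have h0 : ∫ x, (f x - f' x) ^ 2 ∂μ = 0 := by
    have : ∀ x, (f x - f' x) ^ 2 = f x * (f x - f' x) - f' x * (f x - f' x) := fun x => by ring
    simp_rw [this]
    rw [integral_sub (hf.integrable_mul_two hg) (hf'.integrable_mul_two hg), e, sub_self]
  filter_upwards [ae_eq_zero_of_integral_sq_eq_zero hg h0] with x hx
  exact sub_eq_zero.1 hx

end WeakLimits

/-! ### Weak convergence tested with smooth functions -/

section WeakLimitsSpace

variable {d : ℕ} {ι : Type*}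

theorem ae_eq_zero_of_forall_test {V : Set (Space d)} (hV : IsOpen V) {f : Space d → ℝ}
    (hf : MemLp f 2 (volume.restrict V))
    (h : ∀ ψ, IsTestFunction V ψ → ∫ x in V, f x * ψ x = 0) : f =ᵐ[volume.restrict V] 0 := by
  have hloc : LocallyIntegrableOn f V volume := by
    rw [locallyIntegrableOn_iff hV.isLocallyClosed]
    intro K hKV hK
    have : IsFiniteMeasure (volume.restrict K) :=
      ⟨by rw [Measure.restrict_apply_univ]; exact hK.measure_lt_top⟩
    exact (hf.mono_measure (Measure.restrict_mono hKV le_rfl)).integrable (by norm_num)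
  have := hV.ae_eq_zero_of_integral_contDiff_smul_eq_zero hloc fun g hg hgc hgV => by
    have hψ : IsTestFunction V g := ⟨hg, hgc, hgV⟩
    have h1 := h g hψ
    rw [setIntegral_eq_of_test Subset.rfl fun x hx => by rw [hψ.eq_zero hx, mul_zero]] at h1
    simpa [mul_comm] using h1
  exact (ae_restrict_iff' hV.measurableSet).2 this

/-- Weak convergence of bounded families may be checked on test functions. -/
theorem tendstoWeakly_of_test (U : Ultrafilter ι) {V : Set (Space d)} (hV : IsOpen V)
    {F : ι → Space d → ℝ} {f : Space d → ℝ} {C : ℝ}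
    (hF : ∀ᶠ n in (U : Filter ι), MemLp (F n) 2 (volume.restrict V))
    (hC : ∀ᶠ n in (U : Filter ι), ∫ x in V, F n x ^ 2 ≤ C)
    (hf : MemLp f 2 (volume.restrict V))
    (h : ∀ ψ, IsTestFunction V ψ →
      Tendsto (fun n => ∫ x in V, F n x * ψ x) U (𝓝 (∫ x in V, f x * ψ x))) :
    TendstoWeakly U (volume.restrict V) F f := by
  obtain ⟨f', hf', -, hw⟩ := exists_tendstoWeakly U hF hC
  refine hw.congr_limit ?_
  have h0 : (fun x => f' x - f x) =ᵐ[volume.restrict V] 0 := by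
    refine ae_eq_zero_of_forall_test hV (hf'.sub_two hf) fun ψ hψ => ?_
    have hψm := hψ.memLp (volume.restrict V) 2
    simp only [sub_mul]
    rw [integral_sub (hf'.integrable_mul_two hψm) (hf.integrable_mul_two hψm),
      tendsto_nhds_unique (hw ψ hψm) (h ψ hψ), sub_self]
  filter_upwards [h0] with x hx
  exact sub_eq_zero.1 hx

end WeakLimitsSpace

/-! ### Rellich's theorem -/

section Rellich

variable {d : ℕ} {ι : Type*}

/-- A ball is a finite disjoint union of convex sets of small diameter. -/
theorem exists_convex_partition (d : ℕ) (R : ℝ) {ε : ℝ} (hε : 0 < ε) :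
    ∃ (t : Finset (Fin d → ℤ)) (K : (Fin d → ℤ) → Set (Space d)),
      (∀ k, MeasurableSet (K k)) ∧ (∀ k, Convex ℝ (K k)) ∧ (∀ k, K k ⊆ Metric.ball 0 R) ∧
      (∀ k, ∀ x ∈ K k, ∀ y ∈ K k, ‖y - x‖ ≤ ε) ∧ Pairwise (Function.onFun Disjoint K) ∧
      ⋃ k ∈ t, K k = Metric.ball 0 R := by
  -- A cube of side `s` has squared diameter at most `d s² ≤ ((d + 1) s)² = ε²`; the `+ 1` also
  -- covers `d = 0`.
  set s := ε / (d + 1) with hs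
  have hs0 : 0 < s := by positivity
  let K : (Fin d → ℤ) → Set (Space d) := fun k =>
    Metric.ball 0 R ∩ ⋂ i, {x : Space d | k i * s ≤ x i ∧ x i < (k i + 1) * s}
  have hmem : ∀ k x, x ∈ K k ↔ x ∈ Metric.ball 0 R ∧ ∀ i, ⌊x i / s⌋ = k i := by
    intro k x
    simp only [K, mem_inter_iff, mem_iInter, mem_ofPred_eq, Int.floor_eq_iff, le_div_iff₀ hs0,
      div_lt_iff₀ hs0]
  let N : ℕ := ⌈R / s⌉₊ + 1
  refine ⟨Fintype.piFinset fun _ => Finset.Icc (-(N : ℤ)) N, K, fun k => ?_, fun k => ?_,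
    fun k => inter_subset_left, fun k x hx y hy => ?_, fun k k' hkk' => ?_, ?_⟩
  · refine Metric.isOpen_ball.measurableSet.inter (MeasurableSet.iInter fun i => ?_)
    have hm : Measurable fun x : Space d => x i := (by fun_prop : Continuous _).measurable
    exact (measurableSet_le measurable_const hm).inter (measurableSet_lt hm measurable_const)
  · refine (convex_ball _ _).inter (convex_iInter fun i => ?_)
    have hl : IsLinearMap ℝ fun x : Space d => x i := ⟨fun _ _ => rfl, fun _ _ => rfl⟩
    exact (convex_halfSpace_ge hl _).inter (convex_halfSpace_lt hl _)
  · have h1 : ∀ i, |(y - x) i| ≤ s := by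
      intro i
      have hx' := (mem_iInter.1 hx.2 i)
      have hy' := (mem_iInter.1 hy.2 i)
      simp only [mem_ofPred_eq] at hx' hy'
      rw [PiLp.sub_apply, abs_le]
      constructor <;> nlinarith
    have h2 : ‖y - x‖ ^ 2 ≤ ε ^ 2 := by
      rw [norm_sq_eq_sum]
      calc ∑ i, (y - x) i ^ 2 ≤ ∑ _i : Fin d, s ^ 2 :=
            Finset.sum_le_sum fun i _ => sq_le_sq' (abs_le.1 (h1 i)).1 (abs_le.1 (h1 i)).2
        _ = d * s ^ 2 := by simp
        _ ≤ (d + 1) ^ 2 * s ^ 2 := by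
            have : (d : ℝ) ≤ (d + 1) ^ 2 := by nlinarith [(Nat.cast_nonneg d : (0 : ℝ) ≤ d)]
            gcongr
        _ = ε ^ 2 := by rw [hs]; field_simp
    exact le_of_sq_le_sq h2 hε.le
  · refine Set.disjoint_left.2 fun x hx hx' => hkk' ?_
    funext i
    rw [← ((hmem k x).1 hx).2 i, ((hmem k' x).1 hx').2 i]
  · refine Subset.antisymm (iUnion₂_subset fun k _ => inter_subset_left) fun x hx => ?_
    have hk := (hmem (fun i => ⌊x i / s⌋) x).2 ⟨hx, fun i => rfl⟩
    refine mem_iUnion₂.2 ⟨_, ?_, hk⟩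
    rw [Fintype.mem_piFinset]
    intro i
    have h1 : |x i / s| < N := by
      rw [abs_div, abs_of_pos hs0]
      have : |x i| / s ≤ R / s := by
        gcongr
        exact (abs_apply_le_norm x i).trans (mem_ball_zero_iff.1 hx).le
      have h2 := Nat.le_ceil (R / s)
      simp only [N, Nat.cast_add, Nat.cast_one]
      linarith
    rw [abs_lt] at h1
    rw [Finset.mem_Icc]
    refine ⟨Int.le_floor.2 (by push_cast; linarith [h1.1]), ?_⟩
    exact Int.floor_le_iff.2 (by push_cast; linarith [h1.2])

/-- A bounded family in `H¹` which converges weakly to zero in `L²` converges strongly. -/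
theorem tendsto_integral_sq_of_weakly_zero {l : Filter ι} {R C : ℝ} {u : ι → Space d → ℝ}
    {G : ι → Space d → Space d}
    (hu : ∀ᶠ n in l, IsH1On (Metric.ball 0 R) (u n) (G n))
    (hC : ∀ᶠ n in l, ∫ x in Metric.ball 0 R, ‖G n x‖ ^ 2 ≤ C)
    (hw : TendstoWeakly l (volume.restrict (Metric.ball 0 R)) u fun _ => 0) :
    Tendsto (fun n => ∫ x in Metric.ball 0 R, u n x ^ 2) l (𝓝 0) := by
  rcases l.eq_or_neBot with rfl | hl
  · exact tendsto_bot
  have hC0 : 0 ≤ C := by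
    obtain ⟨n, hn⟩ := hC.exists
    exact (integral_nonneg fun x => by positivity).trans hn
  -- On each small cell Poincaré controls `u` by its mean up to `ε²` times the energy. There are
  -- finitely many cells, and the means tend to zero by weak convergence tested with indicators.
  have key : ∀ ε : ℝ, 0 < ε → ∃ S : ι → ℝ, Tendsto S l (𝓝 0) ∧
      ∀ᶠ n in l, ∫ x in Metric.ball 0 R, u n x ^ 2 ≤ S n + ε ^ 2 * 2 ^ d * C := by
    intro ε hε
    obtain ⟨t, K, hKm, hKc, hKB, hKd, hdisj, hU⟩ := exists_convex_partition d R hε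
    have hres : ∀ k, volume.restrict (K k) ≤ volume.restrict (Metric.ball 0 R) := fun k =>
      Measure.restrict_mono (hKB k) le_rfl
    have hsum : ∀ f : Space d → ℝ, Integrable f (volume.restrict (Metric.ball 0 R)) →
        ∫ x in Metric.ball 0 R, f x = ∑ k ∈ t, ∫ x in K k, f x := by
      intro f hf
      rw [← hU, integral_biUnion_finset t (fun k _ => hKm k) (fun k _ k' _ h => hdisj h)]
      exact fun k _ => hf.mono_measure (hres k)
    refine ⟨fun n => ∑ k ∈ t, (volume.real (K k))⁻¹ * (∫ x in K k, u n x) ^ 2, ?_, ?_⟩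
    · have : Tendsto (fun n => ∑ k ∈ t, (volume.real (K k))⁻¹ * (∫ x in K k, u n x) ^ 2) l
          (𝓝 (∑ k ∈ t, (volume.real (K k))⁻¹ * (0 : ℝ) ^ 2)) := by
        refine tendsto_finsetSum t fun k _ => ((Tendsto.pow ?_ 2).const_mul _)
        have h1 := hw ((K k).indicator fun _ => 1)
          ((memLp_const (1 : ℝ)).indicator (hKm k))
        simp only [zero_mul, integral_zero] at h1
        refine h1.congr fun n => ?_
        have e : ∀ x, u n x * (K k).indicator (fun _ => (1 : ℝ)) x = (K k).indicator (u n) x := by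
          intro x
          by_cases hx : x ∈ K k <;> simp [hx]
        simp_rw [e]
        rw [integral_indicator (hKm k), Measure.restrict_restrict (hKm k),
          inter_eq_left.2 (hKB k)]
      simpa using this
    · filter_upwards [hu, hC] with n h1 h2
      rw [hsum _ h1.memLp_fun.integrable_sq]
      have h3 : ∀ k ∈ t, ∫ x in K k, u n x ^ 2 ≤ (volume.real (K k))⁻¹ * (∫ x in K k, u n x) ^ 2
          + ε ^ 2 * 2 ^ d * ∫ x in K k, ‖G n x‖ ^ 2 := by
        intro k _
        have hGk := h1.memLp_grad.mono_measure (hres k)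
        rcases (measureReal_nonneg (μ := (volume : Measure (Space d))) (s := K k)).eq_or_lt
          with h0 | h0
        · have hz : volume (K k) = 0 := by
            rcases (ENNReal.toReal_eq_zero_iff _).1 h0.symm with h | h
            · exact h
            · exact absurd h ((measure_mono (hKB k)).trans_lt measure_ball_lt_top).ne
          rw [Measure.restrict_eq_zero.2 hz]; simp
        · have hp := h1.poincare_convex (hKm k) (hKB k) (hKc k) (hKd k)
          rw [← integral_norm_sq_eq hGk] at hp
          rw [← sub_nonneg]
          have h4 : 0 ≤ (volume.real (K k))⁻¹ * (ε ^ 2 * 2 ^ d * volume.real (K k) *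
              (∫ x in K k, ‖G n x‖ ^ 2) - (volume.real (K k) * (∫ x in K k, u n x ^ 2)
              - (∫ x in K k, u n x) ^ 2)) := mul_nonneg (by positivity) (sub_nonneg.2 hp)
          refine h4.trans (le_of_eq ?_)
          field_simp
          ring
      refine (Finset.sum_le_sum h3).trans ?_
      rw [Finset.sum_add_distrib, ← Finset.mul_sum, ← hsum _ (integrable_norm_sq h1.memLp_grad)]
      gcongr
  refine tendsto_order.2 ⟨fun b hb => Eventually.of_forall fun n =>
    hb.trans_le (integral_nonneg fun x => sq_nonneg _), fun b hb => ?_⟩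
  set ε := √(b / (2 * (2 ^ d * (C + 1)))) with hεd
  have hε : 0 < ε := Real.sqrt_pos.2 (by positivity)
  have hε2 : ε ^ 2 * 2 ^ d * C ≤ b / 2 := by
    rw [hεd, Real.sq_sqrt (by positivity)]
    have : b / (2 * (2 ^ d * (C + 1))) * 2 ^ d * C = b / 2 * (C / (C + 1)) := by field_simp
    rw [this]
    refine mul_le_of_le_one_right (by positivity) ?_
    rw [div_le_one (by positivity)]; linarith
  obtain ⟨S, hS, hb'⟩ := key ε hε
  filter_upwards [hb', hS.eventually (gt_mem_nhds (half_pos hb))] with n h1 h2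
  linarith

/-- Rellich's theorem along an ultrafilter, for functions of mean zero. -/
theorem exists_strong_limit (U : Ultrafilter ι) {R C : ℝ} (hR : 0 < R) {u : ι → Space d → ℝ}
    {G : ι → Space d → Space d} {Z : Space d → Space d}
    (hu : ∀ᶠ n in (U : Filter ι), IsH1On (Metric.ball 0 R) (u n) (G n))
    (hC : ∀ᶠ n in (U : Filter ι), ∫ x in Metric.ball 0 R, ‖G n x‖ ^ 2 ≤ C)
    (hZ : MemLp Z 2 (volume.restrict (Metric.ball 0 R)))
    (hw : ∀ i, TendstoWeakly U (volume.restrict (Metric.ball 0 R)) (fun n x => G n x i)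
      fun x => Z x i) :
    ∃ z, IsH1On (Metric.ball 0 R) z Z ∧ Tendsto (fun n => ∫ x in Metric.ball 0 R,
      ((u n x - ⨍ y in Metric.ball 0 R, u n y) - z x) ^ 2) U (𝓝 0) := by
  set B := Metric.ball (0 : Space d) R
  set w : ι → Space d → ℝ := fun n x => u n x - ⨍ y in B, u n y
  have hw1 : ∀ᶠ n in (U : Filter ι), IsH1On B (w n) (G n) := by
    filter_upwards [hu] with n hn using hn.sub_const _
  have hwb : ∀ᶠ n in (U : Filter ι), ∫ x in B, w n x ^ 2 ≤ 2 ^ d * (2 * R) ^ 2 * C := by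
    filter_upwards [hu, hC] with n h1 h2
    refine (h1.poincare hR).trans ?_
    gcongr
  obtain ⟨z, hz, -, hwz⟩ := exists_tendstoWeakly U
    (hw1.mono fun n hn => hn.memLp_fun) hwb
  -- The weak gradient identity is linear and passes to weak limits, so the limit has gradient `Z`.
  -- Subtracting it reduces the claim to weakly null families.
  have hzH : IsH1On B z Z := by
    refine ⟨hz, hZ, fun ψ hψ i => ?_⟩
    have h1 := hwz _ ((hψ.partialDeriv i).memLp (volume.restrict B) 2)
    have h2 := (hw i _ (hψ.memLp (volume.restrict B) 2)).neg
    refine tendsto_nhds_unique h1 (h2.congr' ?_)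
    filter_upwards [hw1] with n hn
    exact (hn.weak_grad ψ hψ i).symm
  refine ⟨z, hzH, ?_⟩
  refine tendsto_integral_sq_of_weakly_zero (l := (U : Filter ι))
    (u := fun n x => w n x - z x) (G := fun n x => G n x - Z x)
    (C := 2 * C + 2 * ∫ x in B, ‖Z x‖ ^ 2) ?_ ?_ ?_
  · filter_upwards [hw1] with n hn
    refine ⟨hn.memLp_fun.sub_two hz, hn.memLp_grad.sub hZ, fun ψ hψ i => ?_⟩
    have hψ1 := (hψ.partialDeriv i).memLp (volume.restrict B) 2
    have hψ2 := hψ.memLp (volume.restrict B) 2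
    simp only [PiLp.sub_apply, sub_mul]
    rw [integral_sub (hn.memLp_fun.integrable_mul_two hψ1) (hz.integrable_mul_two hψ1),
      integral_sub ((memLp_apply hn.memLp_grad i).integrable_mul_two hψ2)
        ((memLp_apply hZ i).integrable_mul_two hψ2), hn.weak_grad ψ hψ i, hzH.weak_grad ψ hψ i]
    ring
  · filter_upwards [hw1, hC] with n hn h2
    have h3 : ∫ x in B, ‖G n x - Z x‖ ^ 2 ≤ 2 * (∫ x in B, ‖G n x‖ ^ 2)
        + 2 * ∫ x in B, ‖Z x‖ ^ 2 := by
      rw [← integral_const_mul, ← integral_const_mul, ← integral_add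
        ((integrable_norm_sq hn.memLp_grad).const_mul _) ((integrable_norm_sq hZ).const_mul _)]
      refine integral_mono (integrable_norm_sq (hn.memLp_grad.sub hZ))
        (((integrable_norm_sq hn.memLp_grad).const_mul _).fun_add
          ((integrable_norm_sq hZ).const_mul _)) fun x => ?_
      have h4 := norm_sub_le (G n x) (Z x)
      have h5 : ‖G n x - Z x‖ ^ 2 ≤ (‖G n x‖ + ‖Z x‖) ^ 2 := by gcongr
      nlinarith [sq_nonneg (‖G n x‖ - ‖Z x‖)]
    linarith
  · intro g hg
    have h1 := (hwz g hg).sub_const (∫ x in B, z x * g x)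
    simp only [sub_self, zero_mul, integral_zero] at h1 ⊢
    refine h1.congr' ?_
    filter_upwards [hw1] with n hn
    rw [← integral_sub (hn.memLp_fun.integrable_mul_two hg) (hz.integrable_mul_two hg)]
    simp only [sub_mul, B]

end Rellich


/-! ### Compensated compactness -/

section CompensatedCompactness

variable {d : ℕ} {lam : ℝ} {ι : Type*}

/-- A bump function centred at `x` is an admissible test function once its radius is below the
distance to the sphere, and Lebesgue differentiation recovers `f x` for almost every `x`. The
comparable inner and outer radii are needed for that theorem. -/
theorem ae_nonneg_of_forall_test {R : ℝ} {f : Space d → ℝ}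
    (hf : Integrable f (volume.restrict (Metric.ball 0 R)))
    (h : ∀ η, IsTestFunction (Metric.ball 0 R) η → (∀ x, 0 ≤ η x) →
      0 ≤ ∫ x in Metric.ball 0 R, η x * f x) :
    ∀ᵐ x ∂(volume.restrict (Metric.ball 0 R)), 0 ≤ f x := by
  set B := Metric.ball (0 : Space d) R with hB
  have hBm : MeasurableSet B := Metric.isOpen_ball.measurableSet
  let φ : ℕ → ContDiffBump (0 : Space d) := fun n =>
    ⟨1 / (2 * (n + 1)), 1 / (n + 1), by positivity, by
      apply div_lt_div_of_pos_left one_pos (by positivity)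
      linarith [(Nat.cast_nonneg n : (0:ℝ) ≤ n)]⟩
  have hφ : Tendsto (fun n => (φ n).rOut) atTop (𝓝 0) := tendsto_one_div_add_atTop_nhds_zero_nat
  have hφ' : ∀ᶠ n in atTop, (φ n).rOut ≤ 2 * (φ n).rIn := Eventually.of_forall fun n => by
    change 1 / ((n : ℝ) + 1) ≤ 2 * (1 / (2 * (n + 1)))
    apply le_of_eq; field_simp
  have hfi : Integrable (B.indicator f) volume := (integrable_indicator_iff hBm).2 hf
  have hae := ContDiffBump.ae_convolution_tendsto_right_of_locallyIntegrable
    (μ := (volume : Measure (Space d))) hφ hφ' hfi.locallyIntegrable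
  rw [ae_restrict_iff' hBm]
  filter_upwards [hae] with x hx hxB
  rw [indicator_of_mem hxB] at hx
  refine ge_of_tendsto hx ?_
  have hgap : 0 < R - ‖x‖ := sub_pos.2 (mem_ball_zero_iff.1 hxB)
  filter_upwards [hφ.eventually (gt_mem_nhds hgap)] with n hn
  rw [convolution_eq_swap]
  have hψ : IsTestFunction B fun y => (φ n).normed volume (x - y) := by
    refine ⟨(φ n).contDiff_normed.comp (contDiff_const.sub contDiff_id),
      (φ n).hasCompactSupport_normed.comp_homeomorph (Homeomorph.subLeft x), ?_⟩
    have hsupp : Function.support (fun y => (φ n).normed volume (x - y))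
        ⊆ Metric.closedBall x (φ n).rOut := by
      intro y hy
      have h1 : x - y ∈ Function.support ((φ n).normed volume) := hy
      rw [(φ n).support_normed_eq, mem_ball_zero_iff] at h1
      rw [Metric.mem_closedBall, dist_comm, dist_eq_norm]
      exact h1.le
    refine (closure_minimal hsupp Metric.isClosed_closedBall).trans ?_
    refine Metric.closedBall_subset_ball' ?_
    rw [dist_zero_right]; linarith
  have h1 := h _ hψ fun y => (φ n).nonneg_normed _
  rw [← integral_indicator hBm] at h1
  refine h1.trans (le_of_eq ?_)
  congr 1; ext y
  by_cases hy : y ∈ B <;> simp [hy]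

/-- The product of a weakly converging sequence of harmonic gradients and their fluxes has a
nonnegative limit (a consequence of the div-curl lemma). -/
theorem ae_nonneg_of_tendstoWeakly (U : Ultrafilter ι) {R C : ℝ} (hR : 0 < R)
    {a : ι → CoeffField d} {z : ι → Space d → ℝ} {Dz : ι → Space d → Space d}
    {Z Q : Space d → Space d} (ha : ∀ᶠ n in (U : Filter ι), IsBoundedEllipticField lam (a n))
    (hlam : 0 ≤ lam)
    (hz : ∀ᶠ n in (U : Filter ι), IsHarmonicOn (a n) (Metric.ball 0 R) (z n) (Dz n))
    (hC : ∀ᶠ n in (U : Filter ι), ∫ x in Metric.ball 0 R, ‖Dz n x‖ ^ 2 ≤ C)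
    (hZ : MemLp Z 2 (volume.restrict (Metric.ball 0 R)))
    (hQ : MemLp Q 2 (volume.restrict (Metric.ball 0 R)))
    (hwZ : ∀ i, TendstoWeakly U (volume.restrict (Metric.ball 0 R)) (fun n x => Dz n x i)
      fun x => Z x i)
    (hwQ : ∀ i, TendstoWeakly U (volume.restrict (Metric.ball 0 R))
      (fun n x => flux (a n) (Dz n) x i) fun x => Q x i) :
    ∀ᵐ x ∂(volume.restrict (Metric.ball 0 R)), 0 ≤ ∑ i, Q x i * Z x i := by
  set B := Metric.ball (0 : Space d) R
  obtain ⟨v, hv, hlim⟩ := exists_strong_limit U hR (hz.mono fun n hn => hn.h1) hC hZ hwZ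
  have hQi := fun i => memLp_apply hQ i
  have hZi := fun i => memLp_apply hZ i
  have hfluxm : ∀ i, ∀ᶠ n in (U : Filter ι),
      MemLp (fun x => flux (a n) (Dz n) x i) 2 (volume.restrict B) := fun i => by
    filter_upwards [ha, hz] with n h1 h2 using h1.memLp_flux h2.h1.memLp_grad i
  have hQdiv : WeakDivEqOn B (fun x => (Q x).ofLp) fun _ => 0 := by
    intro ψ hψ
    have hψm := fun i => (hψ.partialDeriv i).memLp (volume.restrict B) 2
    have h1 := tendsto_finsetSum Finset.univ fun i _ => hwQ i _ (hψm i)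
    rw [integral_finsetSum _ fun i _ => (hQi i).integrable_mul_two (hψm i)]
    simp only [zero_mul, integral_zero, neg_zero]
    refine tendsto_nhds_unique h1 (tendsto_const_nhds.congr' ?_)
    filter_upwards [hz, (eventually_all).2 hfluxm] with n h2 h3
    have := h2.eqn ψ hψ
    simp only [zero_mul, integral_zero, neg_zero] at this
    rw [integral_finsetSum _ fun i _ => (h3 i).integrable_mul_two (hψm i)] at this
    exact this.symm
  refine ae_nonneg_of_forall_test
    (integrable_finsetSum _ fun i _ => (hQi i).integrable_mul_two (hZi i)) fun η hη hη0 => ?_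
  -- Integrating by parts trades the weakly converging gradient for the function itself, which
  -- converges strongly by Rellich. The product with the weakly converging flux then passes to the
  -- limit, and before the limit it is nonnegative by ellipticity.
  rw [hQdiv.integral_test_mul hR hQi hv hη]
  have hlimit : Tendsto (fun n => -∑ i, ∫ x in B, (z n x - ⨍ y in B, z n y) *
      (partialDeriv i η x * flux (a n) (Dz n) x i)) U
      (𝓝 (-∑ i, ∫ x in B, v x * (partialDeriv i η x * Q x i))) := by
    refine (tendsto_finsetSum _ fun i _ => ?_).neg
    obtain ⟨M, hM0, hM⟩ := (hη.partialDeriv i).exists_bound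
    refine tendsto_integral_mul_of_strong_weak (C := M ^ 2 * (lam⁻¹ ^ 2 * C)) ?_ hv.memLp_fun ?_
      hlim ?_ ?_
    · filter_upwards [hz] with n hn using hn.h1.memLp_fun.sub_two (memLp_const _)
    · filter_upwards [hfluxm i] with n hn using hn.mul_test (hη.partialDeriv i)
    · filter_upwards [ha, hz, hC, hfluxm i] with n h1 h2 h3 h4
      calc ∫ x in B, (partialDeriv i η x * flux (a n) (Dz n) x i) ^ 2
          ≤ ∫ x in B, M ^ 2 * flux (a n) (Dz n) x i ^ 2 := by
            refine integral_mono (h4.mul_test (hη.partialDeriv i)).integrable_sq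
              (h4.integrable_sq.const_mul _) fun x => ?_
            have := sq_le_sq' (abs_le.1 (hM x)).1 (abs_le.1 (hM x)).2
            simp only [mul_pow]
            gcongr
        _ = M ^ 2 * ∫ x in B, flux (a n) (Dz n) x i ^ 2 := integral_const_mul _ _
        _ ≤ M ^ 2 * (lam⁻¹ ^ 2 * ∫ x in B, ‖Dz n x‖ ^ 2) := by
            gcongr; exact h1.integral_flux_sq_le h2.h1.memLp_grad i
        _ ≤ _ := by gcongr
    · have := hwQ i _ (hv.memLp_fun.mul_test (hη.partialDeriv i))
      simpa only [mul_assoc, mul_comm, mul_left_comm] using this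
  have e1 : ∀ x, v x * ∑ i, Q x i * partialDeriv i η x
      = ∑ i, v x * (partialDeriv i η x * Q x i) := fun x => by
    rw [Finset.mul_sum]; exact Finset.sum_congr rfl fun i _ => by ring
  simp_rw [e1]
  rw [integral_finsetSum _ fun i _ =>
    hv.memLp_fun.integrable_mul_two ((hQi i).mul_test (hη.partialDeriv i))]
  refine ge_of_tendsto hlimit ?_
  filter_upwards [ha, hz, (eventually_all).2 hfluxm] with n h1 h2 h3
  have h4 := h2.h1.sub_const (⨍ y in B, z n y)
  have h5 := h2.eqn.integral_test_mul hR h3 h4 hη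
  have e2 : ∀ x, (z n x - ⨍ y in B, z n y) * ∑ i, flux (a n) (Dz n) x i * partialDeriv i η x
      = ∑ i, (z n x - ⨍ y in B, z n y) * (partialDeriv i η x * flux (a n) (Dz n) x i) := fun x => by
    rw [Finset.mul_sum]; exact Finset.sum_congr rfl fun i _ => by ring
  simp_rw [e2] at h5
  rw [integral_finsetSum _ fun i _ =>
    h4.memLp_fun.integrable_mul_two ((h3 i).mul_test (hη.partialDeriv i))] at h5
  rw [← h5]
  refine integral_nonneg_of_ae ?_
  filter_upwards [ae_restrict_of_ae h1.elliptic] with x hx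
  have := hx.le_flux (Dz n)
  exact mul_nonneg (hη0 x) (le_trans (by positivity) this)

/-- If the gradients of harmonic functions converge weakly to zero, they converge strongly on
smaller balls. -/
theorem tendsto_integral_grad_sq_of_weakly_zero (U : Ultrafilter ι) {r C : ℝ} (hr : 0 < r)
    (hlam : 0 < lam) {a : ι → CoeffField d} {z : ι → Space d → ℝ} {Dz : ι → Space d → Space d}
    (ha : ∀ᶠ n in (U : Filter ι), IsBoundedEllipticField lam (a n))
    (hz : ∀ᶠ n in (U : Filter ι), IsHarmonicOn (a n) (Metric.ball 0 (2 * r)) (z n) (Dz n))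
    (hC : ∀ᶠ n in (U : Filter ι), ∫ x in Metric.ball 0 (2 * r), ‖Dz n x‖ ^ 2 ≤ C)
    (hw : ∀ i, TendstoWeakly U (volume.restrict (Metric.ball 0 (2 * r))) (fun n x => Dz n x i)
      fun _ => 0) :
    Tendsto (fun n => ∫ x in Metric.ball 0 r, ‖Dz n x‖ ^ 2) U (𝓝 0) := by
  have hr2 : 0 < 2 * r := by linarith
  set B := Metric.ball (0 : Space d) (2 * r)
  obtain ⟨K, hK, hcacc⟩ := exists_caccioppoli d hlam
  obtain ⟨v, hv, hlim⟩ := exists_strong_limit (Z := fun _ => 0) U hr2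
    (hz.mono fun n hn => hn.h1) hC MemLp.zero' (by simpa using hw)
  -- The strong limit `v` has zero gradient, so it equals its mean `c`. Caccioppoli can therefore be
  -- applied with the constant `m + c`, which makes the right-hand side vanish in the limit.
  have hp := hv.poincare hr2
  simp only [norm_zero, ne_eq, OfNat.ofNat_ne_zero, not_false_eq_true, zero_pow, integral_zero,
    mul_zero] at hp
  have hlim2 := hlim.const_mul (K / r ^ 2 * 2)
  rw [mul_zero] at hlim2
  refine squeeze_zero' (Eventually.of_forall fun n => integral_nonneg fun x => by positivity) ?_
    hlim2
  filter_upwards [ha, hz] with n h1 h2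
  set m := ⨍ y in B, z n y
  set c := ⨍ y in B, v y
  refine (hcacc (a n) h1 r hr (z n) (Dz n) h2 (m + c)).trans ?_
  rw [mul_assoc]
  refine mul_le_mul_of_nonneg_left ?_ (by positivity)
  have e : ∀ x, (z n x - (m + c)) ^ 2 = (((z n x - m) - v x) + (v x - c)) ^ 2 := fun x => by ring
  simp_rw [e]
  refine (integral_sq_add_le ((h2.h1.memLp_fun.sub_two (memLp_const m)).sub_two hv.memLp_fun)
    (hv.memLp_fun.sub_two (memLp_const c))).trans ?_
  linarith

end CompensatedCompactness


/-! ### Linear combinations of `H¹` and harmonic functions -/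

section LinearCombinations

variable {d : ℕ} {lam : ℝ} {U : Set (Space d)}

theorem IsH1On.linear {u v : Space d → ℝ} {Du Dv : Space d → Space d}
    [IsFiniteMeasureOnCompacts (volume.restrict U)]
    (hu : IsH1On U u Du) (hv : IsH1On U v Dv) (s t : ℝ) :
    IsH1On U (fun x => s * u x + t * v x) (fun x => s • Du x + t • Dv x) := by
  refine ⟨(hu.memLp_fun.const_mul s).add (hv.memLp_fun.const_mul t),
    (hu.memLp_grad.const_smul s).add (hv.memLp_grad.const_smul t), fun ψ hψ i => ?_⟩
  have h1 := (hψ.partialDeriv i).memLp (volume.restrict U) 2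
  have h2 := hψ.memLp (volume.restrict U) 2
  have e1 : ∀ x, (s * u x + t * v x) * partialDeriv i ψ x
      = s * (u x * partialDeriv i ψ x) + t * (v x * partialDeriv i ψ x) := fun x => by ring
  have e2 : ∀ x, (s • Du x + t • Dv x) i * ψ x = s * (Du x i * ψ x) + t * (Dv x i * ψ x) :=
    fun x => by simp only [PiLp.add_apply, PiLp.smul_apply, smul_eq_mul]; ring
  simp_rw [e1, e2]
  rw [integral_add ((hu.memLp_fun.integrable_mul_two h1).const_mul _)
      ((hv.memLp_fun.integrable_mul_two h1).const_mul _),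
    integral_add (((memLp_apply hu.memLp_grad i).integrable_mul_two h2).const_mul _)
      (((memLp_apply hv.memLp_grad i).integrable_mul_two h2).const_mul _)]
  simp only [integral_const_mul]
  rw [hu.weak_grad ψ hψ i, hv.weak_grad ψ hψ i]
  ring

theorem isH1On_zero : IsH1On U (fun _ => 0) (fun _ => 0) :=
  ⟨MemLp.zero', MemLp.zero', fun ψ _ i => by simp⟩

theorem flux_linear (a : CoeffField d) (G H : Space d → Space d) (s t : ℝ) (x : Space d)
    (i : Fin d) :
    flux a (fun y => s • G y + t • H y) x i = s * flux a G x i + t * flux a H x i := by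
  simp only [flux, PiLp.add_apply, PiLp.smul_apply, smul_eq_mul, Finset.mul_sum]
  rw [← Finset.sum_add_distrib]
  exact Finset.sum_congr rfl fun j _ => by ring

theorem flux_sum (a : CoeffField d) {κ : Type*} (s : Finset κ) (G : κ → Space d → Space d)
    (c : κ → ℝ) (x : Space d) (i : Fin d) :
    flux a (fun y => ∑ k ∈ s, c k • G k y) x i = ∑ k ∈ s, c k * flux a (G k) x i := by
  classical
  induction s using Finset.induction_on with
  | empty => simp [flux]
  | insert k s hk ih =>
    have h1 := flux_linear a (G k) (fun y => ∑ k ∈ s, c k • G k y) (c k) 1 x i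
    simp only [one_smul, one_mul, ih] at h1
    simp only [Finset.sum_insert hk]
    exact h1

theorem WeakDivEqOn.linear [IsFiniteMeasureOnCompacts (volume.restrict U)]
    {F F' : Space d → Fin d → ℝ} (h : WeakDivEqOn U F fun _ => 0)
    (h' : WeakDivEqOn U F' fun _ => 0) (hF : ∀ i, MemLp (fun x => F x i) 2 (volume.restrict U))
    (hF' : ∀ i, MemLp (fun x => F' x i) 2 (volume.restrict U)) (s t : ℝ) :
    WeakDivEqOn U (fun x i => s * F x i + t * F' x i) fun _ => 0 := by
  intro ψ hψ
  have h1 := h ψ hψ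
  have h2 := h' ψ hψ
  simp only [zero_mul, integral_zero, neg_zero] at h1 h2 ⊢
  have hm := fun i => (hψ.partialDeriv i).memLp (volume.restrict U) 2
  have e : ∀ x, ∑ i, (s * F x i + t * F' x i) * partialDeriv i ψ x
      = s * (∑ i, F x i * partialDeriv i ψ x) + t * ∑ i, F' x i * partialDeriv i ψ x := fun x => by
    rw [Finset.mul_sum, Finset.mul_sum, ← Finset.sum_add_distrib]
    exact Finset.sum_congr rfl fun i _ => by ring
  simp_rw [e]
  rw [integral_add ((integrable_finsetSum _ fun i _ => (hF i).integrable_mul_two (hm i)).const_mul _)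
    ((integrable_finsetSum _ fun i _ => (hF' i).integrable_mul_two (hm i)).const_mul _),
    integral_const_mul, integral_const_mul, h1, h2]
  ring

theorem IsHarmonicOn.linear [IsFiniteMeasureOnCompacts (volume.restrict U)] {a : CoeffField d}
    (ha : IsBoundedEllipticField lam a)
    {u v : Space d → ℝ} {Du Dv : Space d → Space d} (hu : IsHarmonicOn a U u Du)
    (hv : IsHarmonicOn a U v Dv) (s t : ℝ) :
    IsHarmonicOn a U (fun x => s * u x + t * v x) (fun x => s • Du x + t • Dv x) := by
  refine ⟨hu.h1.linear hv.h1 s t, ?_⟩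
  have := hu.eqn.linear hv.eqn (fun i => ha.memLp_flux hu.h1.memLp_grad i)
    (fun i => ha.memLp_flux hv.h1.memLp_grad i) s t
  intro ψ hψ
  simpa only [flux_linear] using this ψ hψ

theorem IsHarmonicOn.sum [IsFiniteMeasureOnCompacts (volume.restrict U)] {a : CoeffField d}
    (ha : IsBoundedEllipticField lam a) {κ : Type*} (s : Finset κ)
    {u : κ → Space d → ℝ} {Du : κ → Space d → Space d}
    (h : ∀ k ∈ s, IsHarmonicOn a U (u k) (Du k)) (c : κ → ℝ) :
    IsHarmonicOn a U (fun x => ∑ k ∈ s, c k * u k x) (fun x => ∑ k ∈ s, c k • Du k x) := by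
  classical
  induction s using Finset.induction_on with
  | empty =>
    refine ⟨by simpa using isH1On_zero, fun ψ hψ => ?_⟩
    simp [flux]
  | insert k s hk ih =>
    have h1 := (h k (Finset.mem_insert_self k s)).linear ha
      (ih fun k' hk' => h k' (Finset.mem_insert_of_mem hk')) (c k) 1
    simpa [Finset.sum_insert hk] using h1

end LinearCombinations

/-! ### Piecewise constant coefficients and harmonic coordinates -/

section Interface

variable {d : ℕ} {lam : ℝ}

theorem IsBoundedElliptic.le_diag {A : Matrix (Fin d) (Fin d) ℝ} (h : IsBoundedElliptic lam A)
    (i : Fin d) : lam ≤ A i i := by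
  have := (h (Pi.single i 1)).1
  simpa using this

theorem IsBoundedElliptic.abs_apply_le (hlam : 0 < lam) {A : Matrix (Fin d) (Fin d) ℝ}
    (h : IsBoundedElliptic lam A) (i j : Fin d) : |A i j| ≤ lam⁻¹ := by
  have h1 := (h (Pi.single j 1)).2
  simp only [Matrix.mulVec_single_one, dotProduct_single, mul_one, Pi.single_eq_same] at h1
  have h2 : A i j ^ 2 ≤ A.col j ⬝ᵥ A.col j := by
    simp only [dotProduct, Matrix.col_apply, ← pow_two]
    exact Finset.single_le_sum (f := fun i => A i j ^ 2) (fun i _ => sq_nonneg _)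
      (Finset.mem_univ i)
  exact abs_le_of_sq_le_sq (h2.trans h1) (by positivity)

variable [NeZero d]

/-- The slope `((ā₋)_{1k} - (ā₊)_{1k}) / (ā₊)_{11}` of the kink of `P_k`. -/
def kink (Am Ap : Matrix (Fin d) (Fin d) ℝ) (k : Fin d) : ℝ := (Am 0 k - Ap 0 k) / Ap 0 0

/-- The gradient of the harmonic coordinate `P_k` for an interface at `x^⊥ = s`. -/
def interfaceGrad (Am Ap : Matrix (Fin d) (Fin d) ℝ) (s : EReal) (k : Fin d) (x : Space d) :
    Space d :=
  basisVec k + (if s < (x 0 : ℝ) then kink Am Ap k else 0) • basisVec 0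

/-- The field equal to `Ap` for `x^⊥ > s` and to `Am` otherwise. -/
def interfaceField (Am Ap : Matrix (Fin d) (Fin d) ℝ) (s : EReal) : CoeffField d :=
  fun x => if s < (x 0 : ℝ) then Ap else Am

/-- `ξ_k ∇P_k`. -/
def interfaceComb (Am Ap : Matrix (Fin d) (Fin d) ℝ) (s : EReal) (ξ x : Space d) : Space d :=
  ∑ k, ξ k • interfaceGrad Am Ap s k x

theorem abs_kink_le (hlam : 0 < lam) {Am Ap : Matrix (Fin d) (Fin d) ℝ}
    (hm : IsBoundedElliptic lam Am) (hp : IsBoundedElliptic lam Ap) (k : Fin d) :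
    |kink Am Ap k| ≤ 2 * lam⁻¹ ^ 2 := by
  have h0 := hp.le_diag 0
  rw [kink, abs_div, abs_of_pos (hlam.trans_le h0), div_le_iff₀ (hlam.trans_le h0)]
  have h1 := abs_sub (Am 0 k) (Ap 0 k)
  have h2 := hm.abs_apply_le hlam 0 k
  have h3 := hp.abs_apply_le hlam 0 k
  have h4 : 2 * lam⁻¹ ^ 2 * lam = 2 * lam⁻¹ := by field_simp
  have h5 : 2 * lam⁻¹ ^ 2 * lam ≤ 2 * lam⁻¹ ^ 2 * Ap 0 0 := by gcongr
  linarith [h1, abs_sub (Am 0 k) (Ap 0 k)]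

theorem interfaceGrad_norm_le (hlam : 0 < lam) {Am Ap : Matrix (Fin d) (Fin d) ℝ}
    (hm : IsBoundedElliptic lam Am) (hp : IsBoundedElliptic lam Ap) (s : EReal) (k : Fin d)
    (x : Space d) : ‖interfaceGrad Am Ap s k x‖ ≤ 1 + 2 * lam⁻¹ ^ 2 := by
  refine (norm_add_le _ _).trans ?_
  rw [norm_smul]
  simp only [basisVec, PiLp.norm_single, norm_one, mul_one]
  gcongr
  split_ifs
  · exact abs_kink_le hlam hm hp k
  · simp; positivity

theorem measurableSet_interface (s : EReal) : MeasurableSet {x : Space d | s < (x 0 : ℝ)} := by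
  have hm : Measurable fun x : Space d => ((x 0 : ℝ) : EReal) :=
    measurable_coe_real_ereal.comp ((by fun_prop : Continuous fun x : Space d => x 0).measurable)
  exact measurableSet_lt measurable_const hm

theorem measurable_interfaceGrad (Am Ap : Matrix (Fin d) (Fin d) ℝ) (s : EReal) (k : Fin d) :
    Measurable (interfaceGrad Am Ap s k) := by
  refine measurable_const.add (Measurable.smul_const ?_ _)
  exact Measurable.ite (measurableSet_interface s) measurable_const measurable_const

theorem memLp_interfaceGrad (hlam : 0 < lam) {Am Ap : Matrix (Fin d) (Fin d) ℝ}
    (hm : IsBoundedElliptic lam Am) (hp : IsBoundedElliptic lam Ap) (s : EReal) (k : Fin d)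
    (R : ℝ) : MemLp (interfaceGrad Am Ap s k) 2 (volume.restrict (Metric.ball 0 R)) :=
  MemLp.of_bound (measurable_interfaceGrad Am Ap s k).aestronglyMeasurable _
    (Eventually.of_forall fun x => interfaceGrad_norm_le hlam hm hp s k x)

theorem isBoundedEllipticField_interfaceField {Am Ap : Matrix (Fin d) (Fin d) ℝ}
    (hm : IsBoundedElliptic lam Am) (hp : IsBoundedElliptic lam Ap) (s : EReal) :
    IsBoundedEllipticField lam (interfaceField Am Ap s) := by
  refine ⟨fun i j => Measurable.aemeasurable ?_, Eventually.of_forall fun x => ?_⟩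
  · have : (fun x => interfaceField Am Ap s x i j)
        = fun x : Space d => if s < (x 0 : ℝ) then Ap i j else Am i j := by
      ext x; unfold interfaceField; split_ifs <;> rfl
    rw [this]
    exact Measurable.ite (measurableSet_interface s) measurable_const measurable_const
  · unfold interfaceField; split_ifs <;> assumption

theorem interfaceComb_apply (Am Ap : Matrix (Fin d) (Fin d) ℝ) (s : EReal) (ξ x : Space d) :
    interfaceComb Am Ap s ξ x
      = ξ + (if s < (x 0 : ℝ) then ∑ k, ξ k * kink Am Ap k else 0) • basisVec 0 := by
  have h1 : ξ = ∑ k, ξ k • (basisVec k : Space d) := by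
    ext j; simp [Finset.sum_apply, Pi.single_apply]
  conv_rhs => rw [h1]
  simp only [interfaceComb, interfaceGrad, smul_add, Finset.sum_add_distrib, smul_smul,
    ← Finset.sum_smul]
  congr 2
  split_ifs <;> simp [Finset.sum_apply, Pi.single_apply]

theorem interfaceComb_tangential (Am Ap : Matrix (Fin d) (Fin d) ℝ) (s : EReal) (ξ x : Space d)
    {j : Fin d} (hj : j ≠ 0) : interfaceComb Am Ap s ξ x j = ξ j := by
  rw [interfaceComb_apply]; split_ifs <;> simp [hj]

/-- The kink is defined exactly so that the normal flux agrees on both sides: `(Ap)_{0k} + kink *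
(Ap)_{00} = (Am)_{0k}`. Together with the tangential components this yields `d` quantities that do
not see the interface. -/
theorem flux_interface_normal {Am Ap : Matrix (Fin d) (Fin d) ℝ} (hp : Ap 0 0 ≠ 0) (s : EReal)
    (k : Fin d) (x : Space d) :
    flux (interfaceField Am Ap s) (interfaceGrad Am Ap s k) x 0 = Am 0 k := by
  simp only [flux, interfaceField, interfaceGrad]
  split_ifs
  · simp only [PiLp.add_apply, PiLp.smul_apply, basisVec, PiLp.single_apply,
      smul_eq_mul, mul_add, Finset.sum_add_distrib]
    simp [kink, mul_div_cancel₀ _ hp]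
  · simp [basisVec]

/-- A vector is controlled by its tangential components and the normal flux. -/
theorem norm_le_of_tangential_of_flux (hlam : 0 < lam) {A : Matrix (Fin d) (Fin d) ℝ}
    (hA : IsBoundedElliptic lam A) {ξ : Space d} {T : ℝ} (h1 : ∀ j, j ≠ 0 → |ξ j| ≤ T)
    (h2 : |∑ k, A 0 k * ξ k| ≤ T) : ‖ξ‖ ≤ d * (1 + lam⁻¹ * (1 + d * lam⁻¹)) * T := by
  have hT : 0 ≤ T := (abs_nonneg _).trans h2
  have h0 := hA.le_diag 0
  have hd0 : (0 : ℝ) ≤ d := Nat.cast_nonneg d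
  have h3 : |ξ 0| ≤ lam⁻¹ * (1 + d * lam⁻¹) * T := by
    have e : A 0 0 * ξ 0 = (∑ k, A 0 k * ξ k) - ∑ k ∈ Finset.univ.erase 0, A 0 k * ξ k := by
      rw [← Finset.add_sum_erase Finset.univ _ (Finset.mem_univ (0 : Fin d))]; ring
    have h4 : |∑ k ∈ Finset.univ.erase 0, A 0 k * ξ k| ≤ d * lam⁻¹ * T := by
      refine (Finset.abs_sum_le_sum_abs _ _).trans ?_
      calc ∑ k ∈ Finset.univ.erase 0, |A 0 k * ξ k|
          ≤ ∑ _k ∈ (Finset.univ : Finset (Fin d)).erase 0, lam⁻¹ * T := by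
            refine Finset.sum_le_sum fun k hk => ?_
            rw [abs_mul]
            exact mul_le_mul (hA.abs_apply_le hlam 0 k) (h1 k (Finset.ne_of_mem_erase hk))
              (abs_nonneg _) (by positivity)
        _ ≤ ∑ _k : Fin d, lam⁻¹ * T :=
            Finset.sum_le_sum_of_subset_of_nonneg (Finset.erase_subset _ _)
              fun _ _ _ => by positivity
        _ = d * lam⁻¹ * T := by simp; ring
    have h5 : lam * |ξ 0| ≤ (1 + d * lam⁻¹) * T := by
      calc lam * |ξ 0| ≤ A 0 0 * |ξ 0| := by gcongr
        _ = |A 0 0 * ξ 0| := by rw [abs_mul, abs_of_pos (hlam.trans_le h0)]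
        _ ≤ |∑ k, A 0 k * ξ k| + |∑ k ∈ Finset.univ.erase 0, A 0 k * ξ k| := by
            rw [e]; exact abs_sub _ _
        _ ≤ _ := by linarith
    rw [mul_assoc, ← div_eq_inv_mul, le_div_iff₀ hlam]
    linarith
  have h6 : ∀ j, |ξ j| ≤ (1 + lam⁻¹ * (1 + d * lam⁻¹)) * T := by
    intro j
    by_cases hj : j = 0
    · subst hj; nlinarith
    · have := h1 j hj
      have h7 : 0 ≤ lam⁻¹ * (1 + d * lam⁻¹) * T := by positivity
      nlinarith
  have h7 : ξ = ∑ k, ξ k • (basisVec k : Space d) := by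
    ext j; simp [Finset.sum_apply, Pi.single_apply]
  calc ‖ξ‖ = ‖∑ k, ξ k • (basisVec k : Space d)‖ := by rw [← h7]
    _ ≤ ∑ k, ‖ξ k • (basisVec k : Space d)‖ := norm_sum_le _ _
    _ ≤ ∑ _k : Fin d, (1 + lam⁻¹ * (1 + d * lam⁻¹)) * T := by
        refine Finset.sum_le_sum fun k _ => ?_
        rw [norm_smul]
        simpa [basisVec] using h6 k
    _ = _ := by simp; ring

end Interface


/-! ### Correctors on a ball -/

section LocalCorrector

variable {d : ℕ} [NeZero d] {lam : ℝ}

/-- The corrected gradients `ξ_k (∇P_k + ∇φ_k)` for an interface at `x^⊥ = s`. -/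
def correctedComb (Am Ap : Matrix (Fin d) (Fin d) ℝ) (s : EReal) (Dφ : Fin d → Space d → Space d)
    (ξ x : Space d) : Space d :=
  ∑ k, ξ k • (interfaceGrad Am Ap s k x + Dφ k x)

/-- An extended corrector on the ball of radius `N` around the origin, for an interface at
`x^⊥ = s`. -/
structure IsLocalCorrector (lam N : ℝ) (a : CoeffField d) (Am Ap : Matrix (Fin d) (Fin d) ℝ)
    (s : EReal) (φ : Fin d → Space d → ℝ) (Dφ : Fin d → Space d → Space d)
    (σ : Fin d → Fin d → Fin d → Space d → ℝ) : Prop where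
  field : IsBoundedEllipticField lam a
  minus : IsBoundedElliptic lam Am
  plus : IsBoundedElliptic lam Ap
  coord : ∀ k, ∃ p, IsH1On (Metric.ball 0 N) p (interfaceGrad Am Ap s k)
  phi : ∀ k, IsH1On (Metric.ball 0 N) (φ k) (Dφ k)
  eqn : ∀ k, WeakDivEqOn (Metric.ball 0 N)
    (flux a fun x => interfaceGrad Am Ap s k x + Dφ k x) (fun _ => 0)
  sigma : ∀ i j k, MemLp (σ i j k) 2 (volume.restrict (Metric.ball 0 N))
  sigma_eqn : ∀ j k, WeakDivEqOn (Metric.ball 0 N) (fun x i => σ i j k x) (fun x =>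
    flux (interfaceField Am Ap s) (interfaceGrad Am Ap s k) x j
      - flux a (fun y => interfaceGrad Am Ap s k y + Dφ k y) x j)

/-- The mean square oscillation of `(φ, σ)` on the ball of radius `r` is at most `(δ r)²`. -/
structure HasOscLe (φ : Fin d → Space d → ℝ) (σ : Fin d → Fin d → Fin d → Space d → ℝ)
    (r δ : ℝ) : Prop where
  phi : ∀ k, ∫ x in Metric.ball 0 r, (φ k x - ⨍ y in Metric.ball 0 r, φ k y) ^ 2
    ≤ (δ * r) ^ 2 * volume.real (Metric.ball (0 : Space d) r)
  sigma : ∀ i j k, ∫ x in Metric.ball 0 r, (σ i j k x - ⨍ y in Metric.ball 0 r, σ i j k y) ^ 2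
    ≤ (δ * r) ^ 2 * volume.real (Metric.ball (0 : Space d) r)

variable {N : ℝ} {a : CoeffField d} {Am Ap : Matrix (Fin d) (Fin d) ℝ} {s : EReal}
  {φ : Fin d → Space d → ℝ} {Dφ : Fin d → Space d → Space d}
  {σ : Fin d → Fin d → Fin d → Space d → ℝ}

theorem IsLocalCorrector.mono (h : IsLocalCorrector lam N a Am Ap s φ Dφ σ) {N' : ℝ}
    (hN : N' ≤ N) : IsLocalCorrector lam N' a Am Ap s φ Dφ σ := by
  have hs : Metric.ball (0 : Space d) N' ⊆ Metric.ball 0 N := Metric.ball_subset_ball hN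
  exact ⟨h.field, h.minus, h.plus, fun k => let ⟨p, hp⟩ := h.coord k; ⟨p, hp.mono hs⟩,
    fun k => (h.phi k).mono hs, fun k => (h.eqn k).mono hs,
    fun i j k => (h.sigma i j k).mono_measure (Measure.restrict_mono hs le_rfl),
    fun j k => (h.sigma_eqn j k).mono hs⟩

theorem correctedComb_eq (Am Ap : Matrix (Fin d) (Fin d) ℝ) (s : EReal)
    (Dφ : Fin d → Space d → Space d) (ξ x : Space d) :
    correctedComb Am Ap s Dφ ξ x = interfaceComb Am Ap s ξ x + ∑ k, ξ k • Dφ k x := by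
  simp [correctedComb, interfaceComb, smul_add, Finset.sum_add_distrib]

/-- The corrected coordinates are harmonic. -/
theorem IsLocalCorrector.exists_harmonic (h : IsLocalCorrector lam N a Am Ap s φ Dφ σ)
    (ξ : Space d) : ∃ p : Fin d → Space d → ℝ,
      (∀ k, IsH1On (Metric.ball 0 N) (p k) (interfaceGrad Am Ap s k)) ∧
      IsHarmonicOn a (Metric.ball 0 N) (fun x => ∑ k, ξ k * (p k x + φ k x))
        (correctedComb Am Ap s Dφ ξ) := by
  choose p hp using h.coord
  refine ⟨p, hp, ?_⟩
  refine IsHarmonicOn.sum h.field Finset.univ (u := fun k x => p k x + φ k x)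
    (Du := fun k x => interfaceGrad Am Ap s k x + Dφ k x) (fun k _ => ⟨?_, h.eqn k⟩) ξ.ofLp
  simpa using (hp k).linear (h.phi k) 1 1

theorem IsLocalCorrector.memLp_correctedComb (h : IsLocalCorrector lam N a Am Ap s φ Dφ σ)
    (ξ : Space d) :
    MemLp (correctedComb Am Ap s Dφ ξ) 2 (volume.restrict (Metric.ball 0 N)) :=
  let ⟨_, _, hu⟩ := h.exists_harmonic ξ
  hu.h1.memLp_grad

/-- Upper bound on the corrected gradients. -/
theorem exists_correctedComb_upper (d : ℕ) [NeZero d] (hlam : 0 < lam) : ∃ C : ℝ, 0 < C ∧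
    ∀ (a : CoeffField d) (Am Ap : Matrix (Fin d) (Fin d) ℝ) (s : EReal)
      (φ : Fin d → Space d → ℝ) (Dφ : Fin d → Space d → Space d)
      (σ : Fin d → Fin d → Fin d → Space d → ℝ) (r : ℝ), 0 < r →
      IsLocalCorrector lam (2 * r) a Am Ap s φ Dφ σ → HasOscLe φ σ (2 * r) 1 →
      ∀ ξ : Space d, ∫ x in Metric.ball 0 r, ‖correctedComb Am Ap s Dφ ξ x‖ ^ 2
        ≤ C * volume.real (Metric.ball (0 : Space d) (2 * r)) * ‖ξ‖ ^ 2 := by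
  obtain ⟨K, hK, hcacc⟩ := exists_caccioppoli d hlam
  set κ := 1 + 2 * lam⁻¹ ^ 2 with hκ
  refine ⟨K * (d * (2 * (2 ^ d * 16 * κ ^ 2) + 8)) + 1, by positivity, ?_⟩
  intro a Am Ap s φ Dφ σ r hr h hosc ξ
  have hr2 : 0 < 2 * r := by linarith
  set B := Metric.ball (0 : Space d) (2 * r)
  set V := volume.real B
  obtain ⟨p, hp, hu⟩ := h.exists_harmonic ξ
  -- Caccioppoli is used with the constant `∑ ξ_k m_k`. The coordinate part of the remainder is
  -- controlled by Poincaré and the bound `κ` on `∇P_k`, the corrector part by the oscillation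
  -- hypothesis.
  let m : Fin d → ℝ := fun k => (⨍ y in B, p k y) + ⨍ y in B, φ k y
  have h1 := hcacc a h.field r hr _ _ hu (∑ k, ξ k * m k)
  have hwm : ∀ k, MemLp (fun x => p k x + φ k x - m k) 2 (volume.restrict B) := fun k =>
    ((hp k).memLp_fun.add_two (h.phi k).memLp_fun).sub_two (memLp_const _)
  have hk : ∀ k, ∫ x in B, (p k x + φ k x - m k) ^ 2
      ≤ (2 * (2 ^ d * 16 * κ ^ 2) + 8) * r ^ 2 * V := by
    intro k
    have e : ∀ x, (p k x + φ k x - m k) ^ 2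
        = ((p k x - ⨍ y in B, p k y) + (φ k x - ⨍ y in B, φ k y)) ^ 2 := fun x => by
      simp only [m]; ring
    simp_rw [e]
    refine (integral_sq_add_le ((hp k).memLp_fun.sub_two (memLp_const _))
      ((h.phi k).memLp_fun.sub_two (memLp_const _))).trans ?_
    have h2 := (hp k).poincare hr2
    have h3 : ∫ x in B, ‖interfaceGrad Am Ap s k x‖ ^ 2 ≤ κ ^ 2 * V := by
      calc ∫ x in B, ‖interfaceGrad Am Ap s k x‖ ^ 2 ≤ ∫ _x in B, κ ^ 2 := by
            refine integral_mono (integrable_norm_sq (hp k).memLp_grad) (integrable_const _)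
              fun x => ?_
            have := interfaceGrad_norm_le hlam h.minus h.plus s k x
            simp only
            gcongr
        _ = κ ^ 2 * V := by
            rw [integral_const, real_restrict_univ, smul_eq_mul, mul_comm]
    have h4 := hosc.phi k
    have h5 : 2 ^ d * (2 * (2 * r)) ^ 2 * ∫ x in B, ‖interfaceGrad Am Ap s k x‖ ^ 2
        ≤ 2 ^ d * (2 * (2 * r)) ^ 2 * (κ ^ 2 * V) := by gcongr
    calc _ ≤ 2 * (2 ^ d * (2 * (2 * r)) ^ 2 * (κ ^ 2 * V)) + 2 * ((1 * (2 * r)) ^ 2 * V) := by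
          gcongr
          exact h2.trans h5
      _ = _ := by ring
  have hsum : ∫ x in B, ((∑ k, ξ k * (p k x + φ k x)) - ∑ k, ξ k * m k) ^ 2
      ≤ ‖ξ‖ ^ 2 * (d * ((2 * (2 ^ d * 16 * κ ^ 2) + 8) * r ^ 2 * V)) := by
    calc ∫ x in B, ((∑ k, ξ k * (p k x + φ k x)) - ∑ k, ξ k * m k) ^ 2
        ≤ ∫ x in B, ‖ξ‖ ^ 2 * ∑ k, (p k x + φ k x - m k) ^ 2 := by
          refine integral_mono (hu.h1.memLp_fun.sub_two (memLp_const _)).integrable_sq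
            ((integrable_finsetSum _ fun k _ => (hwm k).integrable_sq).const_mul _) fun x => ?_
          simp only
          rw [← Finset.sum_sub_distrib, norm_sq_eq_sum]
          simp only [← mul_sub]
          exact Finset.sum_mul_sq_le_sq_mul_sq _ _ _
      _ = ‖ξ‖ ^ 2 * ∑ k, ∫ x in B, (p k x + φ k x - m k) ^ 2 := by
          rw [integral_const_mul, integral_finsetSum _ fun k _ => (hwm k).integrable_sq]
      _ ≤ ‖ξ‖ ^ 2 * ∑ _k : Fin d, (2 * (2 ^ d * 16 * κ ^ 2) + 8) * r ^ 2 * V := by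
          gcongr with k; exact hk k
      _ = _ := by simp
  refine h1.trans ?_
  have hV : 0 ≤ V := measureReal_nonneg
  calc K / r ^ 2 * ∫ x in B, ((∑ k, ξ k * (p k x + φ k x)) - ∑ k, ξ k * m k) ^ 2
      ≤ K / r ^ 2 * (‖ξ‖ ^ 2 * (d * ((2 * (2 ^ d * 16 * κ ^ 2) + 8) * r ^ 2 * V))) := by gcongr
    _ = K * (d * (2 * (2 ^ d * 16 * κ ^ 2) + 8)) * V * ‖ξ‖ ^ 2 := by field_simp
    _ ≤ _ := by gcongr; linarith

/-- Lower bound on the corrected gradients. -/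
theorem exists_correctedComb_lower (d : ℕ) [NeZero d] (hlam : 0 < lam) : ∃ C δ : ℝ, 0 < C ∧ 0 < δ ∧
    ∀ (a : CoeffField d) (Am Ap : Matrix (Fin d) (Fin d) ℝ) (s : EReal)
      (φ : Fin d → Space d → ℝ) (Dφ : Fin d → Space d → Space d)
      (σ : Fin d → Fin d → Fin d → Space d → ℝ),
      IsLocalCorrector lam 1 a Am Ap s φ Dφ σ → HasOscLe φ σ 1 δ →
      ∀ ξ : Space d, ‖ξ‖ ^ 2 ≤ C * ∫ x in Metric.ball 0 1, ‖correctedComb Am Ap s Dφ ξ x‖ ^ 2 := by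
  obtain ⟨M, hM0, hM⟩ := exists_cutoff d
  obtain ⟨η, hη, hη0, hη1, hηr, hηg⟩ := hM (1 / 2) (by norm_num)
  rw [show (2 : ℝ) * (1 / 2) = 1 by norm_num] at hη
  rw [show M / (1 / 2) ^ 2 = 4 * M by ring] at hηg
  set B := Metric.ball (0 : Space d) 1
  set V := volume.real B
  have hV : 0 < V := volume_real_ball_pos _ one_pos
  have hηm := hη.memLp (volume.restrict B) 2
  set m := ∫ x in B, η x with hm
  have hm0 : 0 < m := by
    have h1 : ∫ x in Metric.ball (0 : Space d) (1 / 2), η x ≤ m :=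
      setIntegral_mono_set (hηm.integrable (by norm_num)) (Eventually.of_forall hη0)
        (Metric.ball_subset_ball (by norm_num)).eventuallyLE
    rw [setIntegral_congr_fun Metric.isOpen_ball.measurableSet hηr] at h1
    simp only [integral_const, smul_eq_mul, mul_one, real_restrict_univ] at h1
    exact (volume_real_ball_pos _ (by norm_num)).trans_le h1
  set κ := d * (1 + lam⁻¹ * (1 + d * lam⁻¹)) with hκ
  have hd0 : (0 : ℝ) < d := by exact_mod_cast Nat.pos_of_ne_zero (NeZero.ne d)
  have hκ0 : 0 < κ := by positivity
  set A := (1 + lam⁻¹) * √V / m with hA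
  set b := (d + d * d) * (√V * √(4 * M * V)) / m with hb
  have hb0 : 0 ≤ b := by positivity
  refine ⟨(2 * κ * A) ^ 2 + 1, 1 / (2 * κ * (b + 1)), by positivity, by positivity, ?_⟩
  -- With this choice `κ b δ ≤ 1/2`, so the error proportional to `‖ξ‖` can be absorbed at the end.
  set δ := 1 / (2 * κ * (b + 1)) with hδ
  have hδ0 : 0 < δ := by positivity
  intro a Am Ap s φ Dφ σ h hosc ξ
  set X := correctedComb Am Ap s Dφ ξ with hX
  have hXm : MemLp X 2 (volume.restrict B) := h.memLp_correctedComb ξ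
  set E := √(∫ x in B, ‖X x‖ ^ 2) with hE
  have hηsq : ∫ x in B, η x ^ 2 ≤ V := by
    calc ∫ x in B, η x ^ 2 ≤ ∫ _x in B, (1 : ℝ) :=
          integral_mono hηm.integrable_sq (integrable_const _) fun x =>
            pow_le_one₀ (hη0 x) (hη1 x)
      _ = V := by simp [V]
  have hηgsq : ∀ i, ∫ x in B, partialDeriv i η x ^ 2 ≤ 4 * M * V := by
    intro i
    calc ∫ x in B, partialDeriv i η x ^ 2 ≤ ∫ _x in B, 4 * M :=
          integral_mono ((hη.partialDeriv i).memLp _ 2).integrable_sq (integrable_const _) fun x =>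
            (Finset.single_le_sum (f := fun i => partialDeriv i η x ^ 2) (fun i _ => sq_nonneg _)
              (Finset.mem_univ i)).trans (hηg x)
      _ = 4 * M * V := by
          rw [integral_const, real_restrict_univ, smul_eq_mul, mul_comm]
  -- Subtracting the mean costs nothing because `∂_i η` integrates to zero; the smallness of the
  -- oscillation then enters through Cauchy–Schwarz.
  have hbound : ∀ f : Space d → ℝ, MemLp f 2 (volume.restrict B) →
      ∫ x in B, (f x - ⨍ y in B, f y) ^ 2 ≤ (δ * 1) ^ 2 * V → ∀ i,
      |∫ x in B, f x * partialDeriv i η x| ≤ δ * (√V * √(4 * M * V)) := by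
    intro f hf hfo i
    have hi := (hη.partialDeriv i).memLp (volume.restrict B) 2
    have e : ∫ x in B, f x * partialDeriv i η x
        = ∫ x in B, (f x - ⨍ y in B, f y) * partialDeriv i η x := by
      simp only [sub_mul]
      rw [integral_sub (hf.integrable_mul_two hi) ((memLp_const _).integrable_mul_two hi),
        integral_const_mul, integral_partialDeriv_eq_zero hη, mul_zero, sub_zero]
    rw [e]
    refine (abs_integral_mul_le (hf.sub_two (memLp_const _)) hi).trans ?_
    rw [← mul_assoc]
    gcongr
    · rw [mul_one] at hfo
      calc √(∫ x in B, (f x - ⨍ y in B, f y) ^ 2) ≤ √(δ ^ 2 * V) := Real.sqrt_le_sqrt hfo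
        _ = δ * √V := by rw [Real.sqrt_mul (sq_nonneg _), Real.sqrt_sq hδ0.le]
    · exact hηgsq i
  have hηbound : ∀ f : Space d → ℝ, MemLp f 2 (volume.restrict B) → ∀ c, 0 ≤ c →
      ∫ x in B, f x ^ 2 ≤ c ^ 2 * ∫ x in B, ‖X x‖ ^ 2 → |∫ x in B, η x * f x| ≤ √V * (c * E) := by
    intro f hf c hc hfc
    refine (abs_integral_mul_le hηm hf).trans ?_
    gcongr
    calc √(∫ x in B, f x ^ 2) ≤ √(c ^ 2 * ∫ x in B, ‖X x‖ ^ 2) := Real.sqrt_le_sqrt hfc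
      _ = c * E := by rw [Real.sqrt_mul (sq_nonneg _), Real.sqrt_sq hc]
  have hPm : ∀ k i, MemLp (fun x => interfaceGrad Am Ap s k x i) 2 (volume.restrict B) :=
    fun k i => memLp_apply (memLp_interfaceGrad hlam h.minus h.plus s k 1) i
  have hDm : ∀ k i, MemLp (fun x => Dφ k x i) 2 (volume.restrict B) :=
    fun k i => memLp_apply (h.phi k).memLp_grad i
  have hE0 : 0 ≤ E := Real.sqrt_nonneg _
  set W := √V * √(4 * M * V) with hW
  have hW0 : 0 ≤ W := by positivity
  have hT : ∀ q : ℝ, |q * m| ≤ √V * ((1 + lam⁻¹) * E) + (d + d * d) * (δ * W) * ‖ξ‖ →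
      |q| ≤ A * E + b * δ * ‖ξ‖ := by
    intro q hq
    rw [abs_mul, abs_of_pos hm0, ← le_div_iff₀ hm0] at hq
    refine hq.trans (le_of_eq ?_)
    simp only [hA, hb]
    field_simp
  -- Averaging the tangential components of the corrected gradient against `η` gives `ξ j` times the
  -- mass of `η`, up to terms in `∇φ` that are integrated by parts.
  have htan : ∀ j, j ≠ 0 → |ξ j| ≤ A * E + b * δ * ‖ξ‖ := by
    intro j hj
    refine hT _ ?_
    have e1 : ∀ x, η x * X x j = ξ j * η x + ∑ k, ξ k * (Dφ k x j * η x) := by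
      intro x
      rw [hX, correctedComb_eq, PiLp.add_apply, interfaceComb_tangential _ _ _ _ _ hj]
      simp only [WithLp.ofLp_sum, Finset.sum_apply, PiLp.smul_apply, smul_eq_mul, mul_add, Finset.mul_sum]
      congr 1
      · ring
      · exact Finset.sum_congr rfl fun k _ => by ring
    have e2 : ∫ x in B, η x * X x j
        = ξ j * m - ∑ k, ξ k * ∫ x in B, φ k x * partialDeriv j η x := by
      simp_rw [e1]
      rw [integral_add ((hηm.integrable (by norm_num)).const_mul _) (integrable_finsetSum _
        fun k _ => ((hDm k j).integrable_mul_two hηm).const_mul _), integral_const_mul,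
        integral_finsetSum _ fun k _ => ((hDm k j).integrable_mul_two hηm).const_mul _, sub_eq_add_neg,
        ← Finset.sum_neg_distrib]
      congr 1
      refine Finset.sum_congr rfl fun k _ => ?_
      rw [integral_const_mul, (h.phi k).weak_grad η hη j]
      ring
    have h1 := hηbound _ (memLp_apply hXm j) 1 zero_le_one (by
      rw [one_pow, one_mul]
      refine integral_mono (memLp_apply hXm j).integrable_sq (integrable_norm_sq hXm) fun x => ?_
      exact sq_le_sq' (abs_le.1 (abs_apply_le_norm _ _)).1 (abs_le.1 (abs_apply_le_norm _ _)).2)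
    have h2 : |∑ k, ξ k * ∫ x in B, φ k x * partialDeriv j η x| ≤ d * (δ * W) * ‖ξ‖ := by
      calc _ ≤ ∑ k, |ξ k * ∫ x in B, φ k x * partialDeriv j η x| := Finset.abs_sum_le_sum_abs _ _
        _ ≤ ∑ _k : Fin d, ‖ξ‖ * (δ * W) := by
            refine Finset.sum_le_sum fun k _ => ?_
            rw [abs_mul]
            exact mul_le_mul (abs_apply_le_norm _ _)
              (hbound _ (h.phi k).memLp_fun (hosc.phi k) j) (abs_nonneg _) (norm_nonneg _)
        _ = _ := by simp; ring
    have h3 : ξ j * m = (∫ x in B, η x * X x j)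
        + ∑ k, ξ k * ∫ x in B, φ k x * partialDeriv j η x := by rw [e2]; ring
    rw [h3]
    refine (abs_add_le _ _).trans (add_le_add (h1.trans ?_) (h2.trans ?_))
    · have : 0 ≤ lam⁻¹ := by positivity
      gcongr
      linarith
    · gcongr
      linarith [mul_self_nonneg (d : ℝ)]
  -- The remaining datum is the normal flux. Averaging `a` times the corrected gradient against `η`
  -- gives it up to `div σ`, again integrated by parts.
  have hnor : |∑ k, Am 0 k * ξ k| ≤ A * E + b * δ * ‖ξ‖ := by
    refine hT _ ?_
    have hp0 : Ap 0 0 ≠ 0 := (hlam.trans_le (h.plus.le_diag 0)).ne'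
    have hFm : ∀ k, MemLp (fun x => flux a (fun y => interfaceGrad Am Ap s k y + Dφ k y) x 0) 2
        (volume.restrict B) := fun k => h.field.memLp_flux
      ((memLp_interfaceGrad hlam h.minus h.plus s k 1).add (h.phi k).memLp_grad) 0
    have e1 : ∀ x, η x * flux a X x 0
        = ∑ k, ξ k * (η x * flux a (fun y => interfaceGrad Am Ap s k y + Dφ k y) x 0) := by
      intro x
      have : flux a X x 0 = _ := flux_sum a Finset.univ
        (fun k y => interfaceGrad Am Ap s k y + Dφ k y) ξ.ofLp x 0
      rw [this, Finset.mul_sum]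
      exact Finset.sum_congr rfl fun k _ => by ring
    have e2 : ∀ k, ∫ x in B, η x * flux a (fun y => interfaceGrad Am Ap s k y + Dφ k y) x 0
        = Am 0 k * m + ∑ i, ∫ x in B, σ i 0 k x * partialDeriv i η x := by
      intro k
      have h1 := h.sigma_eqn 0 k η hη
      rw [integral_finsetSum _ fun i _ => (h.sigma i 0 k).integrable_mul_two
        ((hη.partialDeriv i).memLp (volume.restrict B) 2)] at h1
      rw [h1]
      simp only [flux_interface_normal hp0, sub_mul]
      rw [integral_sub ((hηm.integrable (by norm_num)).const_mul _)
        ((hFm k).integrable_mul_two hηm), integral_const_mul]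
      have : ∀ x, flux a (fun y => interfaceGrad Am Ap s k y + Dφ k y) x 0 * η x
        = η x * flux a (fun y => interfaceGrad Am Ap s k y + Dφ k y) x 0 := fun x => mul_comm _ _
      simp_rw [this]
      ring
    have h1 := hηbound _ (h.field.memLp_flux hXm 0) lam⁻¹ (by positivity)
      (h.field.integral_flux_sq_le hXm 0)
    have h2 : |∑ k, ξ k * ∑ i, ∫ x in B, σ i 0 k x * partialDeriv i η x|
        ≤ d * d * (δ * W) * ‖ξ‖ := by
      calc _ ≤ ∑ k, |ξ k * ∑ i, ∫ x in B, σ i 0 k x * partialDeriv i η x| :=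
            Finset.abs_sum_le_sum_abs _ _
        _ ≤ ∑ _k : Fin d, ‖ξ‖ * ∑ _i : Fin d, δ * W := by
            refine Finset.sum_le_sum fun k _ => ?_
            rw [abs_mul]
            refine mul_le_mul (abs_apply_le_norm _ _) ((Finset.abs_sum_le_sum_abs _ _).trans
              (Finset.sum_le_sum fun i _ => ?_)) (abs_nonneg _) (norm_nonneg _)
            exact hbound _ (h.sigma i 0 k) (hosc.sigma i 0 k) i
        _ = _ := by simp; ring
    have h3 : (∑ k, Am 0 k * ξ k) * m = (∫ x in B, η x * flux a X x 0)
        - ∑ k, ξ k * ∑ i, ∫ x in B, σ i 0 k x * partialDeriv i η x := by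
      simp_rw [e1]
      rw [integral_finsetSum _ fun k _ => (hηm.integrable_mul_two (hFm k)).const_mul _,
        Finset.sum_mul, ← Finset.sum_sub_distrib]
      refine Finset.sum_congr rfl fun k _ => ?_
      rw [integral_const_mul, e2]
      ring
    rw [h3]
    refine (abs_sub _ _).trans (add_le_add (h1.trans ?_) (h2.trans ?_))
    · gcongr
      linarith
    · gcongr
      linarith
  have hfin := norm_le_of_tangential_of_flux hlam h.minus htan hnor
  rw [← hκ] at hfin
  have h4 : κ * (b * δ * ‖ξ‖) ≤ 1 / 2 * ‖ξ‖ := by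
    have : κ * (b * δ) ≤ 1 / 2 := by
      rw [hδ, mul_one_div, ← mul_div_assoc, div_le_iff₀ (by positivity)]
      linarith
    nlinarith [norm_nonneg ξ]
  have h5 : ‖ξ‖ ≤ 2 * κ * A * E := by linarith
  calc ‖ξ‖ ^ 2 ≤ (2 * κ * A * E) ^ 2 := by gcongr
    _ = (2 * κ * A) ^ 2 * ∫ x in B, ‖X x‖ ^ 2 := by
        rw [mul_pow, hE, Real.sq_sqrt (integral_nonneg fun x => by positivity)]
    _ ≤ _ := by
        have : 0 ≤ ∫ x in B, ‖X x‖ ^ 2 := integral_nonneg fun x => by positivity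
        gcongr
        linarith

end LocalCorrector


/-! ### Rescaling -/

section Rescaling

open scoped ENNReal

variable {d : ℕ} {x₀ : Space d} {ρ : ℝ}

theorem measurePreserving_scale (x₀ : Space d) (hρ : 0 < ρ) :
    MeasurePreserving (fun y : Space d => x₀ + ρ • y) (ENNReal.ofReal (ρ ^ d) • volume) volume := by
  refine ⟨by fun_prop, ?_⟩
  have h1 : Measure.map (fun y : Space d => x₀ + ρ • y) volume
      = ENNReal.ofReal ((ρ ^ d)⁻¹) • volume := by
    have : (fun y : Space d => x₀ + ρ • y) = (fun y => x₀ + y) ∘ fun y => ρ • y := rfl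
    rw [this, ← Measure.map_map (by fun_prop) (by fun_prop), Measure.map_addHaar_smul _ hρ.ne',
      Measure.map_smul, map_add_left_eq_self, finrank_euclideanSpace_fin,
      abs_of_nonneg (by positivity)]
  rw [Measure.map_smul, h1, smul_smul, ← ENNReal.ofReal_mul (by positivity),
    mul_inv_cancel₀ (by positivity), ENNReal.ofReal_one, one_smul]

theorem preimage_scale_ball (x₀ : Space d) (hρ : 0 < ρ) (r : ℝ) :
    (fun y : Space d => x₀ + ρ • y) ⁻¹' Metric.ball x₀ (ρ * r) = Metric.ball 0 r := by
  ext y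
  simp [dist_eq_norm, norm_smul, abs_of_pos hρ, hρ]

theorem measurePreserving_scale_ball (x₀ : Space d) (hρ : 0 < ρ) (r : ℝ) :
    MeasurePreserving (fun y : Space d => x₀ + ρ • y)
      (ENNReal.ofReal (ρ ^ d) • volume.restrict (Metric.ball 0 r))
      (volume.restrict (Metric.ball x₀ (ρ * r))) := by
  have h := (measurePreserving_scale x₀ hρ).restrict_preimage (s := Metric.ball x₀ (ρ * r))
    Metric.isOpen_ball.measurableSet
  rwa [preimage_scale_ball x₀ hρ, Measure.restrict_smul] at h

theorem measurableEmbedding_scale (x₀ : Space d) (hρ : 0 < ρ) :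
    MeasurableEmbedding fun y : Space d => x₀ + ρ • y :=
  ((Homeomorph.smulOfNeZero ρ hρ.ne').trans (Homeomorph.addLeft x₀)).measurableEmbedding

theorem setIntegral_scale (x₀ : Space d) (hρ : 0 < ρ) (r : ℝ) (f : Space d → ℝ) :
    ∫ x in Metric.ball x₀ (ρ * r), f x = ρ ^ d * ∫ y in Metric.ball 0 r, f (x₀ + ρ • y) := by
  rw [← (measurePreserving_scale_ball x₀ hρ r).integral_comp (measurableEmbedding_scale x₀ hρ) f,
    integral_smul_measure, ENNReal.toReal_ofReal (by positivity), smul_eq_mul]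

theorem average_scale (x₀ : Space d) (hρ : 0 < ρ) (r : ℝ) (f : Space d → ℝ) :
    ⨍ x in Metric.ball x₀ (ρ * r), f x = ⨍ y in Metric.ball 0 r, f (x₀ + ρ • y) := by
  have h1 : volume.real (Metric.ball x₀ (ρ * r))
      = ρ ^ d * volume.real (Metric.ball (0 : Space d) r) := by
    have := setIntegral_scale x₀ hρ r fun _ => (1 : ℝ)
    simpa using this
  rw [setAverage_eq, setAverage_eq, setIntegral_scale x₀ hρ, h1, smul_eq_mul, smul_eq_mul,
    mul_inv_rev, mul_assoc, inv_mul_cancel_left₀ (by positivity)]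

theorem MeasureTheory.MemLp.scale {E : Type*} [NormedAddCommGroup E] {f : Space d → E}
    (hρ : 0 < ρ) {r : ℝ}
    (hf : MemLp f 2 (volume.restrict (Metric.ball x₀ (ρ * r)))) :
    MemLp (fun y => f (x₀ + ρ • y)) 2 (volume.restrict (Metric.ball 0 r)) := by
  have h1 := hf.comp_measurePreserving (measurePreserving_scale_ball x₀ hρ r)
  have h2 := h1.smul_measure (c := ENNReal.ofReal ((ρ ^ d)⁻¹)) ENNReal.ofReal_ne_top
  rwa [smul_smul, ← ENNReal.ofReal_mul (by positivity), inv_mul_cancel₀ (by positivity),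
    ENNReal.ofReal_one, one_smul] at h2

theorem quasiMeasurePreserving_scale (x₀ : Space d) (hρ : 0 < ρ) :
    Measure.QuasiMeasurePreserving (fun y : Space d => x₀ + ρ • y) volume volume := by
  refine ⟨by fun_prop, ?_⟩
  have h1 := (measurePreserving_scale x₀ hρ).map_eq
  rw [Measure.map_smul] at h1
  conv_rhs => rw [← h1]
  exact Measure.absolutelyContinuous_smul (by simpa using pow_pos hρ d)

/-- The pull-back of a test function under the inverse scaling. -/
theorem IsTestFunction.unscale (hρ : 0 < ρ) {r : ℝ} {ψ : Space d → ℝ}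
    (hψ : IsTestFunction (Metric.ball 0 r) ψ) :
    IsTestFunction (Metric.ball x₀ (ρ * r)) fun x => ψ (ρ⁻¹ • (x - x₀)) := by
  refine ⟨hψ.smooth.comp ((contDiff_id.sub contDiff_const).const_smul _),
    hψ.compact.comp_homeomorph ((Homeomorph.subRight x₀).trans
      (Homeomorph.smulOfNeZero ρ⁻¹ (inv_ne_zero hρ.ne'))), ?_⟩
  let e : Space d ≃ₜ Space d := (Homeomorph.subRight x₀).trans
      (Homeomorph.smulOfNeZero ρ⁻¹ (inv_ne_zero hρ.ne'))
  have h1 : tsupport (fun x => ψ (ρ⁻¹ • (x - x₀))) = e ⁻¹' tsupport ψ :=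
    tsupport_comp_eq_preimage ψ e
  rw [h1]
  intro x hx
  have h2 : ρ⁻¹ • (x - x₀) ∈ Metric.ball (0 : Space d) r := hψ.support_subset hx
  rw [mem_ball_zero_iff, norm_smul, norm_inv, Real.norm_eq_abs, abs_of_pos hρ,
    inv_mul_lt_iff₀ hρ] at h2
  rwa [Metric.mem_ball, dist_eq_norm]

theorem unscale_apply (hρ : 0 < ρ) (y : Space d) : ρ⁻¹ • ((x₀ + ρ • y) - x₀) = y := by
  rw [add_sub_cancel_left, smul_smul, inv_mul_cancel₀ hρ.ne', one_smul]

theorem partialDeriv_unscale (hρ : 0 < ρ) {ψ : Space d → ℝ}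
    (hψ : ContDiff ℝ ∞ ψ) (i : Fin d) (y : Space d) :
    partialDeriv i (fun x => ψ (ρ⁻¹ • (x - x₀))) (x₀ + ρ • y) = ρ⁻¹ * partialDeriv i ψ y := by
  have h2 : HasFDerivAt (fun x : Space d => ψ (ρ⁻¹ • (x - x₀)))
      ((fderiv ℝ ψ (ρ⁻¹ • ((x₀ + ρ • y) - x₀))).comp
      (ρ⁻¹ • ContinuousLinearMap.id ℝ (Space d))) (x₀ + ρ • y) :=
    HasFDerivAt.comp (g := ψ) _ (hψ.differentiable (by simp) _).hasFDerivAt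
      (((hasFDerivAt_id _).sub_const x₀).const_smul ρ⁻¹)
  rw [partialDeriv, h2.fderiv, unscale_apply hρ]
  simp [partialDeriv]

theorem IsH1On.scale (hρ : 0 < ρ) {r : ℝ} {u : Space d → ℝ} {G : Space d → Space d}
    (h : IsH1On (Metric.ball x₀ (ρ * r)) u G) :
    IsH1On (Metric.ball 0 r) (fun y => ρ⁻¹ * u (x₀ + ρ • y)) (fun y => G (x₀ + ρ • y)) := by
  refine ⟨(h.memLp_fun.scale hρ).const_mul _, h.memLp_grad.scale hρ, fun ψ hψ i => ?_⟩
  have h1 := h.weak_grad _ (hψ.unscale (x₀ := x₀) hρ) i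
  rw [setIntegral_scale x₀ hρ, setIntegral_scale x₀ hρ] at h1
  simp only [partialDeriv_unscale hρ hψ.smooth, unscale_apply hρ] at h1
  rw [← mul_neg] at h1
  rw [← mul_left_cancel₀ (by positivity) h1]
  congr 1; ext y; ring

/-- The factor `c` covers two scalings: `c = 1` for fluxes, which are scale invariant, and `c = ρ⁻¹`
for `σ`, which scales like a potential. -/
theorem WeakDivEqOn.scale (hρ : 0 < ρ) {r : ℝ} {F : Space d → Fin d → ℝ} {g : Space d → ℝ}
    (h : WeakDivEqOn (Metric.ball x₀ (ρ * r)) F g) (c : ℝ) :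
    WeakDivEqOn (Metric.ball 0 r) (fun y i => c * F (x₀ + ρ • y) i)
      (fun y => c * ρ * g (x₀ + ρ • y)) := by
  intro ψ hψ
  have h1 := h _ (hψ.unscale (x₀ := x₀) hρ)
  rw [setIntegral_scale x₀ hρ, setIntegral_scale x₀ hρ] at h1
  simp only [partialDeriv_unscale hρ hψ.smooth, unscale_apply hρ] at h1
  rw [← mul_neg] at h1
  have h2 := congrArg (fun t => c * ρ * t) (mul_left_cancel₀ (by positivity) h1)
  simp only [mul_neg, ← integral_const_mul] at h2
  have e1 : ∀ y, ∑ i, c * F (x₀ + ρ • y) i * partialDeriv i ψ y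
      = c * ρ * ∑ i, F (x₀ + ρ • y) i * (ρ⁻¹ * partialDeriv i ψ y) := fun y => by
    rw [Finset.mul_sum]
    exact Finset.sum_congr rfl fun i _ => by field_simp
  simp_rw [e1, h2, mul_assoc]

theorem IsHarmonicOn.scale (hρ : 0 < ρ) {r : ℝ} {a : CoeffField d} {u : Space d → ℝ}
    {Du : Space d → Space d} (h : IsHarmonicOn a (Metric.ball x₀ (ρ * r)) u Du) :
    IsHarmonicOn (fun y => a (x₀ + ρ • y)) (Metric.ball 0 r) (fun y => ρ⁻¹ * u (x₀ + ρ • y))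
      (fun y => Du (x₀ + ρ • y)) := by
  refine ⟨h.h1.scale hρ, ?_⟩
  have := h.eqn.scale hρ 1
  simp only [one_mul, mul_zero] at this
  exact this

theorem IsBoundedEllipticField.scale {lam : ℝ} (hρ : 0 < ρ) {a : CoeffField d}
    (h : IsBoundedEllipticField lam a) (x₀ : Space d) :
    IsBoundedEllipticField lam fun y => a (x₀ + ρ • y) :=
  ⟨fun i j => (h.aemeasurable i j).comp_quasiMeasurePreserving (quasiMeasurePreserving_scale x₀ hρ),
    (quasiMeasurePreserving_scale x₀ hρ).ae h.elliptic⟩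

theorem IsEllipticField.isBoundedEllipticField {lam : ℝ} (hlam : 0 < lam) {a : CoeffField d}
    (h : IsEllipticField lam a) : IsBoundedEllipticField lam a :=
  ⟨h.aemeasurable, h.elliptic.mono fun _ hx => hx.isBoundedElliptic hlam⟩

end Rescaling

/-! ### Harmonic coordinates as Sobolev functions -/

section HarmonicCoord

variable {d : ℕ} [NeZero d] {lam : ℝ}

theorem harmonicCoord_eq (Am Ap : Matrix (Fin d) (Fin d) ℝ) (k : Fin d) (x : Space d) :
    harmonicCoord Am Ap k x = x k + (Am 0 k - Ap 0 k) / Ap 0 0 * max (x 0) 0 := by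
  unfold harmonicCoord
  split_ifs with h
  · rw [max_eq_left h.le]
  · rw [max_eq_right (not_lt.1 h)]; ring

theorem exists_lipschitzWith_harmonicCoord (Am Ap : Matrix (Fin d) (Fin d) ℝ) (k : Fin d) :
    ∃ K, LipschitzWith K (harmonicCoord Am Ap k) := by
  have h1 : ∀ i, LipschitzWith 1 fun x : Space d => x i := fun i => LipschitzWith.mk_one
    fun x y => by rw [Real.dist_eq, dist_eq_norm x y]; exact abs_apply_le_norm (x - y) i
  have h2 : LipschitzWith _ fun x : Space d =>
      ((Am 0 k - Ap 0 k) / Ap 0 0) • max (x 0) 0 := (lipschitzWith_smul ((Am 0 k - Ap 0 k) / Ap 0 0)).comp ((h1 0).max_const 0)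
  have e : harmonicCoord Am Ap k
      = fun x => x k + ((Am 0 k - Ap 0 k) / Ap 0 0) • max (x 0) 0 :=
    funext fun x => by rw [harmonicCoord_eq, smul_eq_mul]
  rw [e]
  exact ⟨_, (h1 k).add h2⟩

theorem ae_ne_zero (d : ℕ) [NeZero d] : ∀ᵐ x ∂(volume : Measure (Space d)), x 0 ≠ 0 := by
  let L : Space d →ₗ[ℝ] ℝ := (EuclideanSpace.proj (𝕜 := ℝ) (0 : Fin d)).toLinearMap
  have h := Measure.addHaar_submodule (volume : Measure (Space d)) (LinearMap.ker L) (by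
    intro h
    have h1 : (basisVec 0 : Space d) ∈ LinearMap.ker L := by rw [h]; trivial
    simp [L] at h1)
  rw [ae_iff]
  refine measure_mono_null (fun x hx => ?_) h
  simpa [L] using hx

/-- `P_k` is Lipschitz, so it may be integrated by parts with its line derivatives, and these agree
with the explicit gradient off the null hyperplane `x 0 = 0`. -/
theorem isH1On_harmonicCoord (hlam : 0 < lam) {Am Ap : Matrix (Fin d) (Fin d) ℝ}
    (hm : IsBoundedElliptic lam Am) (hp : IsBoundedElliptic lam Ap) (k : Fin d) (R : ℝ) :
    IsH1On (Metric.ball 0 R) (harmonicCoord Am Ap k) (gradHarmonicCoord Am Ap k) := by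
  obtain ⟨K, hK⟩ := exists_lipschitzWith_harmonicCoord Am Ap k
  have hg : gradHarmonicCoord Am Ap k = interfaceGrad Am Ap 0 k := by
    ext1 x
    unfold gradHarmonicCoord interfaceGrad kink
    have : ((0 : EReal) < (x 0 : ℝ)) ↔ 0 < x 0 := EReal.coe_pos
    simp only [this]
    split_ifs <;> simp
  refine ⟨memLp_ball_of_continuous hK.continuous R, ?_, fun ψ hψ i => ?_⟩
  · rw [hg]; exact memLp_interfaceGrad hlam hm hp 0 k R
  · obtain ⟨D, hD⟩ := ContDiff.lipschitzWith_of_hasCompactSupport hψ.compact hψ.smooth (by simp)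
    have h1 := LipschitzWith.integral_lineDeriv_mul_eq (μ := (volume : Measure (Space d))) hK hD
      hψ.compact (basisVec i)
    rw [setIntegral_eq_of_test Subset.rfl fun x hx => by rw [(hψ.partialDeriv i).eq_zero hx, mul_zero],
      setIntegral_eq_of_test Subset.rfl fun x hx => by rw [hψ.eq_zero hx, mul_zero]]
    have e1 : ∫ x, gradHarmonicCoord Am Ap k x i * ψ x
        = ∫ x, lineDeriv ℝ (harmonicCoord Am Ap k) x (basisVec i) * ψ x := by
      refine integral_congr_ae ?_
      filter_upwards [ae_ne_zero d] with x hx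
      have := (hasGradientAt_harmonicCoord Am Ap k x hx).hasFDerivAt
      rw [(this.hasLineDerivAt (basisVec i)).lineDeriv]
      simp [basisVec, EuclideanSpace.inner_single_right]
    rw [e1, h1, ← integral_neg]
    congr 1; ext x
    rw [(hψ.smooth.differentiable (by simp) x).lineDeriv_eq_fderiv]
    simp [partialDeriv, mul_comm]

end HarmonicCoord

/-! ### From the whole space to balls -/

section Localization

variable {d : ℕ}

theorem ball_subset_ball_zero (x₀ : Space d) (r : ℝ) :
    Metric.ball x₀ r ⊆ Metric.ball 0 (max r 0 + ‖x₀‖ + 1) :=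
  Metric.ball_subset_ball' (by rw [dist_zero_right]; linarith [le_max_left r 0])

theorem radius_pos (x₀ : Space d) (r : ℝ) : 0 < max r 0 + ‖x₀‖ + 1 := by
  have := le_max_right r 0
  positivity

theorem IsH1Loc.isH1On_ball {f : Space d → ℝ} {G : Space d → Space d} (h : IsH1Loc f G)
    (x₀ : Space d) (r : ℝ) : IsH1On (Metric.ball x₀ r) f G :=
  (h _ (radius_pos x₀ r)).mono (ball_subset_ball_zero x₀ r)

theorem IsL2Loc.memLp_ball {f : Space d → ℝ} (h : IsL2Loc f) (x₀ : Space d) (r : ℝ) :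
    MemLp f 2 (volume.restrict (Metric.ball x₀ r)) :=
  (h _ (radius_pos x₀ r)).mono_measure (Measure.restrict_mono (ball_subset_ball_zero x₀ r) le_rfl)

variable [NeZero d] {lam : ℝ} {x₀ : Space d} {ρ : ℝ}

/-- Zooming at `x₀` by `ρ` moves the interface to height `-(x₀ 0) / ρ`; no other feature of the
homogenized problem changes. -/
theorem interface_lt_iff (hρ : 0 < ρ) (x₀ y : Space d) :
    ((-(x₀ 0) / ρ : ℝ) : EReal) < (y 0 : ℝ) ↔ 0 < (x₀ + ρ • y) 0 := by
  rw [EReal.coe_lt_coe_iff, div_lt_iff₀ hρ]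
  simp only [PiLp.add_apply, PiLp.smul_apply, smul_eq_mul]
  constructor <;> intro h <;> linarith

theorem gradHarmonicCoord_scale (hρ : 0 < ρ) (Am Ap : Matrix (Fin d) (Fin d) ℝ) (k : Fin d)
    (y : Space d) :
    gradHarmonicCoord Am Ap k (x₀ + ρ • y)
      = interfaceGrad Am Ap ((-(x₀ 0) / ρ : ℝ) : EReal) k y := by
  unfold gradHarmonicCoord interfaceGrad kink
  simp only [interface_lt_iff hρ]
  split_ifs <;> simp

theorem homogenizedField_scale (hρ : 0 < ρ) (Am Ap : Matrix (Fin d) (Fin d) ℝ) (y : Space d) :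
    homogenizedField Am Ap (x₀ + ρ • y)
      = interfaceField Am Ap ((-(x₀ 0) / ρ : ℝ) : EReal) y := by
  unfold homogenizedField interfaceField
  simp only [interface_lt_iff hρ]

theorem correctedGrad_scale (hρ : 0 < ρ) (Am Ap : Matrix (Fin d) (Fin d) ℝ)
    (Dφ : Fin d → Space d → Space d) (ξ y : Space d) :
    correctedGrad Am Ap Dφ ξ (x₀ + ρ • y)
      = correctedComb Am Ap ((-(x₀ 0) / ρ : ℝ) : EReal) (fun k y => Dφ k (x₀ + ρ • y)) ξ y := by
  simp only [correctedGrad, correctedComb, gradHarmonicCoord_scale hρ]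

variable {a : CoeffField d} {Am Ap : Matrix (Fin d) (Fin d) ℝ} {φ : Fin d → Space d → ℝ}
  {Dφ : Fin d → Space d → Space d} {σ : Fin d → Fin d → Fin d → Space d → ℝ}

/-- The potentials `φ` and `σ` acquire the factor `ρ⁻¹`, while gradients and coefficients are merely
composed with the zoom. Every scale of the given problem is thereby an instance of one class on
balls about the origin. -/
theorem IsUngaugedCorrector.isLocalCorrector (hlam : 0 < lam) (hρ : 0 < ρ)
    (ha : IsEllipticField lam a) (hm : IsEllipticMatrix lam Am) (hp : IsEllipticMatrix lam Ap)
    (h : IsUngaugedCorrector a Am Ap φ Dφ σ) (x₀ : Space d) (N : ℝ) :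
    IsLocalCorrector lam N (fun y => a (x₀ + ρ • y)) Am Ap ((-(x₀ 0) / ρ : ℝ) : EReal)
      (fun k y => ρ⁻¹ * φ k (x₀ + ρ • y)) (fun k y => Dφ k (x₀ + ρ • y))
      (fun i j k y => ρ⁻¹ * σ i j k (x₀ + ρ • y)) where
  field := (ha.isBoundedEllipticField hlam).scale hρ x₀
  minus := hm.isBoundedElliptic hlam
  plus := hp.isBoundedElliptic hlam
  coord k := by
    have h1 := (isH1On_harmonicCoord hlam (hm.isBoundedElliptic hlam) (hp.isBoundedElliptic hlam)
      k _).mono (ball_subset_ball_zero x₀ (ρ * N))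
    have h2 := h1.scale hρ
    simp only [gradHarmonicCoord_scale hρ] at h2
    exact ⟨_, h2⟩
  phi k := ((h.phi_h1 k).isH1On_ball x₀ _).scale hρ
  eqn k := by
    have h1 := ((h.phi_eqn k).mono (subset_univ (Metric.ball x₀ (ρ * N)))).scale hρ 1
    simp only [one_mul, mul_zero] at h1
    simp only [← gradHarmonicCoord_scale hρ]
    exact h1
  sigma i j k := ((h.sigma_l2 i j k).memLp_ball x₀ _).scale hρ |>.const_mul _
  sigma_eqn j k := by
    have h1 := ((h.sigma_eqn j k).mono (subset_univ (Metric.ball x₀ (ρ * N)))).scale hρ ρ⁻¹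
    simp only [inv_mul_cancel₀ hρ.ne', one_mul] at h1
    simp only [← gradHarmonicCoord_scale hρ]
    simp only [flux, ← homogenizedField_scale hρ, ← gradHarmonicCoord_scale hρ]
    exact h1

end Localization

/-! ### Scaling of the corrector oscillation -/

section Oscillation

variable {d : ℕ} {x₀ : Space d} {ρ : ℝ} {φ : Fin d → Space d → ℝ}
  {Dφ : Fin d → Space d → Space d} {σ : Fin d → Fin d → Fin d → Space d → ℝ}

theorem HasOscLe.mono {r δ δ' : ℝ} (h : HasOscLe φ σ r δ) (hδ : 0 ≤ δ) (hr : 0 ≤ r)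
    (hδ' : δ ≤ δ') : HasOscLe φ σ r δ' := by
  have h1 : (δ * r) ^ 2 * volume.real (Metric.ball (0 : Space d) r)
      ≤ (δ' * r) ^ 2 * volume.real (Metric.ball (0 : Space d) r) := by gcongr
  exact ⟨fun k => (h.phi k).trans h1, fun i j k => (h.sigma i j k).trans h1⟩

/-- The factor `ρ⁻¹` on the correctors matches the normalization by the radius, so `δ` is unchanged;
each component is bounded by the full sum of squares. -/
theorem hasOscLe_of_correctorOsc_le (hρ : 0 < ρ) (hφ : ∀ k, IsH1Loc (φ k) (Dφ k))
    (hσ : ∀ i j k, IsL2Loc (σ i j k)) {r δ : ℝ} (hr : 0 < r)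
    (h : correctorOsc φ σ x₀ (ρ * r) ≤ δ) :
    HasOscLe (fun k y => ρ⁻¹ * φ k (x₀ + ρ • y)) (fun i j k y => ρ⁻¹ * σ i j k (x₀ + ρ • y))
      r δ := by
  set B := Metric.ball x₀ (ρ * r)
  have hρr : 0 < ρ * r := by positivity
  have hV := volume_real_ball_pos x₀ hρr
  have hV' := volume_real_ball_pos (0 : Space d) hr
  have hφm : ∀ k, MemLp (fun y => φ k y - ⨍ z in B, φ k z) 2 (volume.restrict B) := fun k =>
    ((hφ k).isH1On_ball x₀ _).memLp_fun.sub_two (memLp_const _)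
  have hσm : ∀ i j k, MemLp (fun y => σ i j k y - ⨍ z in B, σ i j k z) 2 (volume.restrict B) :=
    fun i j k => ((hσ i j k).memLp_ball x₀ _).sub_two (memLp_const _)
  set g : Space d → ℝ := fun y => (∑ k, (φ k y - ⨍ z in B, φ k z) ^ 2)
      + ∑ i, ∑ j, ∑ k, (σ i j k y - ⨍ z in B, σ i j k z) ^ 2 with hg
  have hgi : Integrable g (volume.restrict B) :=
    (integrable_finsetSum _ fun k _ => (hφm k).integrable_sq).add
      (integrable_finsetSum _ fun i _ => integrable_finsetSum _ fun j _ =>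
        integrable_finsetSum _ fun k _ => (hσm i j k).integrable_sq)
  have hδ : 0 ≤ δ := le_trans (by unfold correctorOsc; positivity) h
  have h1 : ⨍ y in B, g y ≤ (δ * (ρ * r)) ^ 2 := by
    have h2 : √(⨍ y in B, g y) ≤ δ * (ρ * r) := by
      unfold correctorOsc at h
      rw [one_div, inv_mul_le_iff₀ hρr] at h
      exact h.trans_eq (mul_comm _ _)
    have := Real.sqrt_le_left (by positivity) |>.1 h2
    exact this
  have key : ∀ f : Space d → ℝ, MemLp (fun y => f y - ⨍ z in B, f z) 2 (volume.restrict B) →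
      (∀ y, (f y - ⨍ z in B, f z) ^ 2 ≤ g y) →
      ∫ y in Metric.ball 0 r, (ρ⁻¹ * f (x₀ + ρ • y)
        - ⨍ z in Metric.ball 0 r, ρ⁻¹ * f (x₀ + ρ • z)) ^ 2
      ≤ (δ * r) ^ 2 * volume.real (Metric.ball (0 : Space d) r) := by
    intro f hf hfg
    have e1 : ⨍ z in Metric.ball 0 r, ρ⁻¹ * f (x₀ + ρ • z) = ρ⁻¹ * ⨍ z in B, f z := by
      rw [average_scale x₀ hρ r f, setAverage_eq, setAverage_eq, integral_const_mul, smul_eq_mul,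
        smul_eq_mul]
      ring
    have e2 : ∀ y, (ρ⁻¹ * f (x₀ + ρ • y) - ⨍ z in Metric.ball 0 r, ρ⁻¹ * f (x₀ + ρ • z)) ^ 2
        = ρ⁻¹ ^ 2 * (f (x₀ + ρ • y) - ⨍ z in B, f z) ^ 2 := fun y => by rw [e1]; ring
    simp_rw [e2]
    rw [integral_const_mul]
    have h3 : ⨍ y in B, (f y - ⨍ z in B, f z) ^ 2 ≤ (δ * (ρ * r)) ^ 2 := by
      refine le_trans ?_ h1
      generalize ⨍ z in B, f z = m at hf hfg ⊢
      rw [setAverage_eq, setAverage_eq, smul_eq_mul, smul_eq_mul]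
      exact mul_le_mul_of_nonneg_left (integral_mono hf.integrable_sq hgi hfg) (by positivity)
    generalize ⨍ z in B, f z = m at h3 ⊢
    rw [average_scale x₀ hρ r, setAverage_eq, smul_eq_mul, inv_mul_le_iff₀ hV'] at h3
    calc ρ⁻¹ ^ 2 * ∫ y in Metric.ball 0 r, (f (x₀ + ρ • y) - m) ^ 2
        ≤ ρ⁻¹ ^ 2 * (volume.real (Metric.ball (0 : Space d) r) * (δ * (ρ * r)) ^ 2) := by gcongr
      _ = (δ * r) ^ 2 * volume.real (Metric.ball (0 : Space d) r) := by field_simp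
  constructor
  · intro k
    refine key (φ k) (hφm k) fun y => ?_
    refine le_add_of_le_of_nonneg (Finset.single_le_sum
      (f := fun k => (φ k y - ⨍ z in B, φ k z) ^ 2) (fun _ _ => sq_nonneg _)
      (Finset.mem_univ k)) ?_
    exact Finset.sum_nonneg fun _ _ => Finset.sum_nonneg fun _ _ => Finset.sum_nonneg
      fun _ _ => sq_nonneg _
  · intro i j k
    refine key (σ i j k) (hσm i j k) fun y => ?_
    refine le_add_of_nonneg_of_le (Finset.sum_nonneg fun _ _ => sq_nonneg _) ?_
    refine le_trans ?_ (Finset.single_le_sum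
      (f := fun i => ∑ j, ∑ k, (σ i j k y - ⨍ z in B, σ i j k z) ^ 2)
      (fun _ _ => Finset.sum_nonneg fun _ _ => Finset.sum_nonneg fun _ _ => sq_nonneg _)
      (Finset.mem_univ i))
    refine le_trans ?_ (Finset.single_le_sum
      (f := fun j => ∑ k, (σ i j k y - ⨍ z in B, σ i j k z) ^ 2)
      (fun _ _ => Finset.sum_nonneg fun _ _ => sq_nonneg _) (Finset.mem_univ j))
    exact Finset.single_le_sum (f := fun k => (σ i j k y - ⨍ z in B, σ i j k z) ^ 2)
      (fun _ _ => sq_nonneg _) (Finset.mem_univ k)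

end Oscillation


/-! ### Entire harmonic gradients for piecewise constant coefficients -/

section WeakConstancy

variable {d : ℕ}

theorem partialDeriv_comm {ψ : Space d → ℝ} (hψ : ContDiff ℝ ∞ ψ) (i j : Fin d) (x : Space d) :
    partialDeriv i (partialDeriv j ψ) x = partialDeriv j (partialDeriv i ψ) x := by
  have h1 : DifferentiableAt ℝ (fderiv ℝ ψ) x :=
    (hψ.fderiv_right (m := 1) (by norm_cast)).differentiable (by simp) x
  have h2 : ∀ i j, partialDeriv i (partialDeriv j ψ) x
      = fderiv ℝ (fderiv ℝ ψ) x (basisVec i) (basisVec j) := fun i j => by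
    have h3 : HasFDerivAt (fun y => fderiv ℝ ψ y (basisVec j))
        ((fderiv ℝ (fderiv ℝ ψ) x).flip (basisVec j)) x := by
      simpa using h1.hasFDerivAt.clm_apply (hasFDerivAt_const (basisVec j) x)
    change fderiv ℝ (fun y => fderiv ℝ ψ y (basisVec j)) x (basisVec i) = _
    rw [h3.fderiv]
    rfl
  rw [h2, h2]
  exact (hψ.contDiffAt.isSymmSndFDerivAt (by
    rw [minSmoothness_of_isRCLikeNormedField]; exact WithTop.coe_le_coe.2 le_top)) _ _

theorem IsTestFunction.exists_ball {ψ : Space d → ℝ} (hψ : IsTestFunction univ ψ) :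
    ∃ R : ℝ, 0 < R ∧ IsTestFunction (Metric.ball 0 R) ψ := by
  obtain ⟨R, hR⟩ := hψ.compact.isCompact.isBounded.subset_ball (0 : Space d)
  exact ⟨max R 1, by positivity, hψ.smooth, hψ.compact,
    hR.trans (Metric.ball_subset_ball (le_max_left _ _))⟩

theorem ae_of_forall_ball {p : Space d → Prop}
    (h : ∀ n : ℕ, ∀ᵐ x ∂(volume.restrict (Metric.ball (0 : Space d) (n + 1))), p x) :
    ∀ᵐ x ∂(volume : Measure (Space d)), p x := by
  have h1 : ∀ n : ℕ, ∀ᵐ x ∂(volume : Measure (Space d)),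
      x ∈ Metric.ball (0 : Space d) (n + 1) → p x := fun n =>
    (ae_restrict_iff' Metric.isOpen_ball.measurableSet).1 (h n)
  filter_upwards [ae_all_iff.2 h1] with x hx
  obtain ⟨n, hn⟩ := exists_nat_gt ‖x‖
  exact hx n (by rw [mem_ball_zero_iff]; linarith)

theorem volume_real_ball_eq (x₀ : Space d) {r : ℝ} (hr : 0 < r) :
    volume.real (Metric.ball x₀ r) = r ^ d * volume.real (Metric.ball (0 : Space d) 1) := by
  have := setIntegral_scale x₀ hr 1 fun _ => (1 : ℝ)
  simpa using this

/-- A function with vanishing weak gradient is constant. -/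
theorem exists_ae_eq_const {f : Space d → ℝ}
    (hf : ∀ R : ℝ, MemLp f 2 (volume.restrict (Metric.ball 0 R)))
    (h : ∀ ψ, IsTestFunction univ ψ → ∀ i, ∫ x, f x * partialDeriv i ψ x = 0) :
    ∃ c : ℝ, ∀ᵐ x ∂(volume : Measure (Space d)), f x = c := by
  have h1 : ∀ R : ℝ, 0 < R → ∃ c, ∀ᵐ x ∂(volume.restrict (Metric.ball (0 : Space d) R)),
      f x = c := by
    intro R hR
    have h2 : IsH1On (Metric.ball 0 R) f fun _ => 0 := by
      refine ⟨hf R, MemLp.zero', fun ψ hψ i => ?_⟩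
      rw [setIntegral_eq_of_test Subset.rfl fun x hx => by
        rw [(hψ.partialDeriv i).eq_zero hx, mul_zero], h ψ (hψ.mono (subset_univ _)) i]
      simp
    have h3 := h2.poincare hR
    have h4 : ∫ x in Metric.ball 0 R, (f x - ⨍ y in Metric.ball 0 R, f y) ^ 2 = 0 :=
      le_antisymm (by simpa using h3) (integral_nonneg fun _ => sq_nonneg _)
    refine ⟨⨍ y in Metric.ball 0 R, f y, ?_⟩
    filter_upwards [ae_eq_zero_of_integral_sq_eq_zero ((hf R).sub_two (memLp_const _)) h4] with x hx
    exact sub_eq_zero.1 hx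
  obtain ⟨c, hc⟩ := h1 1 one_pos
  refine ⟨c, ae_of_forall_ball fun n => ?_⟩
  obtain ⟨c', hc'⟩ := h1 (n + 1) (by positivity)
  have h2 : ∀ᵐ x ∂(volume.restrict (Metric.ball (0 : Space d) 1)), c' = c := by
    have h3 : ∀ᵐ x ∂(volume.restrict (Metric.ball (0 : Space d) 1)), f x = c' :=
      ae_mono (Measure.restrict_mono (Metric.ball_subset_ball (by simp)) le_rfl) hc'
    filter_upwards [hc, h3] with x hx hx'
    rw [← hx, hx']
  have h3 : c' = c := by
    have : (ae (volume.restrict (Metric.ball (0 : Space d) 1))).NeBot := by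
      rw [ae_neBot]
      intro h0
      have := volume_real_ball_pos (0 : Space d) one_pos
      rw [← real_restrict_univ, h0] at this
      simp at this
    exact h2.exists.choose_spec
  rwa [h3] at hc'

/-- The difference quotient of `ψ` can be shifted onto `f`, where it vanishes by invariance.
Truncating `f` to a ball one unit larger than the support of `ψ` makes it integrable and does not
interfere with shifts shorter than one. -/
theorem integral_mul_partialDeriv_eq_zero {f : Space d → ℝ}
    (hf : ∀ R : ℝ, MemLp f 2 (volume.restrict (Metric.ball 0 R))) (i : Fin d)
    (h : ∀ t : ℝ, ∀ᵐ x ∂(volume : Measure (Space d)), f (x + t • basisVec i) = f x)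
    {ψ : Space d → ℝ} (hψ : IsTestFunction univ ψ) : ∫ x, f x * partialDeriv i ψ x = 0 := by
  obtain ⟨R, hR, hψR⟩ := hψ.exists_ball
  obtain ⟨C, hC⟩ := ContDiff.lipschitzWith_of_hasCompactSupport hψ.compact hψ.smooth (by simp)
  set B := Metric.ball (0 : Space d) (R + 1)
  set g : Space d → ℝ := B.indicator f with hg
  have hBm : MeasurableSet B := Metric.isOpen_ball.measurableSet
  have hgi : Integrable g := by
    rw [hg, integrable_indicator_iff hBm]
    exact (hf _).integrable (by norm_num)
  have h1 := hC.integral_inv_smul_sub_mul_tendsto_integral_lineDeriv_mul hgi (basisVec i)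
  have hv : ‖(basisVec i : Space d)‖ = 1 := by simp [basisVec]
  have h2 : ∀ᶠ t : ℝ in 𝓝[>] 0,
      ∫ x, (t⁻¹ • (ψ (x + t • basisVec i) - ψ x)) * g x = 0 := by
    filter_upwards [Ioo_mem_nhdsGT (zero_lt_one (α := ℝ))] with t ht
    have hψt : Continuous fun x => ψ (x + t • basisVec i) :=
      hψ.smooth.continuous.comp (continuous_id.add continuous_const)
    obtain ⟨M, hM0, hM⟩ := hψ.exists_bound
    have i1 : Integrable fun x => ψ (x + t • basisVec i) * g x :=
      hgi.bdd_mul hψt.aestronglyMeasurable (Eventually.of_forall fun x => hM _)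
    have i2 : Integrable fun x => ψ x * g x :=
      hgi.bdd_mul hψ.smooth.continuous.aestronglyMeasurable (Eventually.of_forall fun x => hM _)
    have e1 : ∫ x, ψ (x + t • basisVec i) * g x = ∫ x, ψ x * g x := by
      rw [← integral_add_right_eq_self (fun x => ψ x * g x) (t • basisVec i)]
      refine integral_congr_ae ?_
      filter_upwards [h t] with x hx
      by_cases hxR : x + t • basisVec i ∈ Metric.ball (0 : Space d) R
      · have hn : ‖t • (basisVec i : Space d)‖ < 1 := by
          rw [norm_smul, hv, mul_one, Real.norm_eq_abs, abs_of_pos ht.1]; exact ht.2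
        have m1 : x + t • basisVec i ∈ B := Metric.ball_subset_ball (by linarith) hxR
        have m2 : x ∈ B := by
          rw [mem_ball_zero_iff] at hxR ⊢
          have : x = (x + t • basisVec i) - t • basisVec i := by abel
          rw [this]
          exact (norm_sub_le _ _).trans_lt (by linarith)
        simp only [hg, indicator_of_mem m1, indicator_of_mem m2, hx]
      · simp only [hψR.eq_zero hxR, zero_mul]
    have e2 : ∀ x, (t⁻¹ • (ψ (x + t • basisVec i) - ψ x)) * g x
        = t⁻¹ * (ψ (x + t • basisVec i) * g x - ψ x * g x) := fun x => by
      rw [smul_eq_mul]; ring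
    simp_rw [e2]
    rw [integral_const_mul, integral_sub i1 i2, e1, sub_self, mul_zero]
  have h3 := tendsto_nhds_unique (h1.congr' h2) tendsto_const_nhds
  rw [← h3]
  congr 1; ext x
  rw [(hψ.smooth.differentiable (by simp) x).lineDeriv_eq_fderiv]
  by_cases hxR : x ∈ Metric.ball (0 : Space d) R
  · have m1 : x ∈ B := Metric.ball_subset_ball (by linarith) hxR
    simp only [hg, indicator_of_mem m1, partialDeriv]
    ring
  · have := (hψR.partialDeriv i).eq_zero hxR
    rw [this, mul_zero]
    unfold partialDeriv at this
    rw [this, zero_mul]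

end WeakConstancy

/-! ### The Liouville theorem for an interface -/

section Liouville

variable {d : ℕ} {lam : ℝ}

/-- `G` is the gradient of an entire `a`-harmonic function. -/
def IsEntireHarmonicGrad (a : CoeffField d) (G : Space d → Space d) : Prop :=
  ∀ R : ℝ, 0 < R → ∃ v, IsHarmonicOn a (Metric.ball 0 R) v G

/-- The Dirichlet integral of `G` on balls grows at most like the power `γ` of the radius. -/
def HasGrowth (γ : ℝ) (G : Space d → Space d) : Prop :=
  ∃ C : ℝ, ∀ r : ℝ, 1 ≤ r → ∫ x in Metric.ball 0 r, ‖G x‖ ^ 2 ≤ C * r ^ γ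

theorem IsEntireHarmonicGrad.memLp {a : CoeffField d} {G : Space d → Space d}
    (h : IsEntireHarmonicGrad a G) (R : ℝ) : MemLp G 2 (volume.restrict (Metric.ball 0 R)) := by
  obtain ⟨v, hv⟩ := h (max R 1) (by positivity)
  exact hv.h1.memLp_grad.mono_measure
    (Measure.restrict_mono (Metric.ball_subset_ball (le_max_left _ _)) le_rfl)

theorem IsHarmonicOn.translate {a : CoeffField d} {h : Space d} (ha : ∀ x, a (x + h) = a x)
    {r r' : ℝ} (hr : r + ‖h‖ ≤ r') {u : Space d → ℝ} {G : Space d → Space d}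
    (hu : IsHarmonicOn a (Metric.ball 0 r') u G) :
    IsHarmonicOn a (Metric.ball 0 r) (fun x => u (x + h)) (fun x => G (x + h)) := by
  have h1 := hu.mono (ball_subset_of_add_le hr)
  rw [← one_mul r] at h1
  have h2 := h1.scale one_pos
  simp only [one_smul, inv_one, one_mul, add_comm h] at h2
  have e : (fun y => a (y + h)) = a := funext ha
  rwa [e] at h2

/-- The exponent is repeatedly lowered by two and may become negative, hence the constant `K ^ |γ|`
valid for both signs. -/
theorem rpow_le_mul_rpow {x y K : ℝ} (hx : 0 < x) (hxy : x ≤ y) (hyK : y ≤ K * x) (γ : ℝ) :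
    y ^ γ ≤ K ^ |γ| * x ^ γ := by
  have hK : 1 ≤ K := by
    by_contra hK
    nlinarith
  rcases le_total 0 γ with hγ | hγ
  · rw [abs_of_nonneg hγ, ← Real.mul_rpow (by positivity) hx.le]
    exact Real.rpow_le_rpow (hx.le.trans hxy) hyK hγ
  · calc y ^ γ ≤ x ^ γ := Real.rpow_le_rpow_of_nonpos hx hxy hγ
      _ = 1 * x ^ γ := (one_mul _).symm
      _ ≤ K ^ |γ| * x ^ γ := by
        gcongr
        exact Real.one_le_rpow hK (abs_nonneg _)

/-- Differences along directions of invariance gain two powers. -/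
theorem IsEntireHarmonicGrad.difference (hlam : 0 < lam) {a : CoeffField d}
    (hE : IsBoundedEllipticField lam a) {G : Space d → Space d} (hG : IsEntireHarmonicGrad a G)
    {h : Space d} (ha : ∀ x, a (x + h) = a x) {γ : ℝ} (hg : HasGrowth γ G) :
    IsEntireHarmonicGrad a (fun x => G (x + h) - G x) ∧
      HasGrowth (γ - 2) (fun x => G (x + h) - G x) := by
  have key : ∀ R : ℝ, 0 < R → ∃ v : Space d → ℝ,
      IsHarmonicOn a (Metric.ball 0 (R + ‖h‖ + 1)) v G ∧
      IsHarmonicOn a (Metric.ball 0 R) (fun x => v (x + h) - v x) (fun x => G (x + h) - G x) := by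
    intro R hR
    obtain ⟨v, hv⟩ := hG (R + ‖h‖ + 1) (by positivity)
    have h1 := hv.translate ha (r := R) (by linarith)
    have h2 := hv.mono (Metric.ball_subset_ball
      (by linarith [norm_nonneg h] : R ≤ R + ‖h‖ + 1))
    refine ⟨v, hv, ?_⟩
    have h3 := h1.linear hE h2 1 (-1)
    simpa only [one_mul, neg_mul, one_smul, neg_smul, ← sub_eq_add_neg] using h3
  refine ⟨fun R hR => ?_, ?_⟩
  · obtain ⟨v, -, hv⟩ := key R hR
    exact ⟨_, hv⟩
  · obtain ⟨C, hC⟩ := hg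
    obtain ⟨K, hK, hcac⟩ := exists_caccioppoli d hlam
    refine ⟨K * ‖h‖ ^ 2 * |C| * (2 + ‖h‖) ^ |γ|, fun r hr => ?_⟩
    have hr0 : 0 < r := by linarith
    obtain ⟨v, hv, hw⟩ := key (2 * r) (by positivity)
    -- Caccioppoli bounds the energy of the difference by `r⁻²` times its `L²` norm, and that norm
    -- costs only `‖h‖²` times the energy of `G`. This is the gain of two powers.
    have h1 := hcac a hE r hr0 _ _ hw 0
    simp only [sub_zero] at h1
    have h2 := hv.h1.difference h (r := 2 * r) le_rfl (by linarith)
    have h3 := hC (2 * r + ‖h‖) (by linarith [norm_nonneg h])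
    have h4 := rpow_le_mul_rpow (K := 2 + ‖h‖) hr0
      (by linarith [norm_nonneg h] : r ≤ 2 * r + ‖h‖)
      (by nlinarith [norm_nonneg h]) γ
    have h5 : (0 : ℝ) ≤ (2 * r + ‖h‖) ^ γ := by positivity
    calc _ ≤ K / r ^ 2 * ∫ x in Metric.ball 0 (2 * r), (v (x + h) - v x) ^ 2 := h1
      _ ≤ K / r ^ 2 * (‖h‖ ^ 2 * (|C| * ((2 + ‖h‖) ^ |γ| * r ^ γ))) := by
        have h6 : C * (2 * r + ‖h‖) ^ γ ≤ |C| * ((2 + ‖h‖) ^ |γ| * r ^ γ) :=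
          (mul_le_mul_of_nonneg_right (le_abs_self C) h5).trans
            (mul_le_mul_of_nonneg_left h4 (abs_nonneg C))
        refine mul_le_mul_of_nonneg_left (h2.trans ?_) (by positivity)
        exact mul_le_mul_of_nonneg_left (h3.trans h6) (by positivity)
      _ = K * ‖h‖ ^ 2 * |C| * (2 + ‖h‖) ^ |γ| * r ^ (γ - 2) := by
        rw [Real.rpow_sub hr0, Real.rpow_two]
        field_simp

/-- The Dirichlet integral on a fixed ball is bounded by the integrals on all larger balls, which
tend to zero. -/
theorem HasGrowth.ae_eq_zero {G : Space d → Space d}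
    (hG : ∀ R : ℝ, MemLp G 2 (volume.restrict (Metric.ball 0 R))) {γ : ℝ} (hγ : γ < 0)
    (hg : HasGrowth γ G) : ∀ᵐ x ∂(volume : Measure (Space d)), G x = 0 := by
  obtain ⟨C, hC⟩ := hg
  have hlim : Tendsto (fun r : ℝ => C * r ^ γ) atTop (𝓝 0) := by
    have := (tendsto_rpow_neg_atTop (neg_pos.2 hγ)).const_mul C
    simpa using this
  refine ae_of_forall_ball fun n => ?_
  have h1 : ∫ x in Metric.ball (0 : Space d) (n + 1), ‖G x‖ ^ 2 ≤ 0 := by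
    refine ge_of_tendsto hlim ?_
    filter_upwards [eventually_ge_atTop (n + 1 : ℝ)] with r hr
    refine le_trans ?_ (hC r (le_trans (by simp) hr))
    exact setIntegral_mono_set (integrable_norm_sq (hG r))
      (Eventually.of_forall fun x => sq_nonneg _) (Metric.ball_subset_ball hr).eventuallyLE
  have h2 := ae_eq_zero_of_integral_sq_eq_zero (hG (n + 1)).norm
    (le_antisymm h1 (integral_nonneg fun _ => sq_nonneg _))
  filter_upwards [h2] with x hx
  exact norm_eq_zero.1 hx

variable [NeZero d] {Am Ap : Matrix (Fin d) (Fin d) ℝ} {s : EReal}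

theorem interfaceField_add (Am Ap : Matrix (Fin d) (Fin d) ℝ) (s : EReal) {h : Space d}
    (hh : h 0 = 0) (x : Space d) :
    interfaceField Am Ap s (x + h) = interfaceField Am Ap s x := by
  simp [interfaceField, hh]

theorem flux_interfaceComb_normal (hp : Ap 0 0 ≠ 0) (s : EReal) (ξ x : Space d) :
    flux (interfaceField Am Ap s) (interfaceComb Am Ap s ξ) x 0 = ∑ k, Am 0 k * ξ k := by
  have h1 := flux_sum (interfaceField Am Ap s) Finset.univ (interfaceGrad Am Ap s) ξ.ofLp x 0
  simp only [flux_interface_normal hp] at h1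
  rw [show interfaceComb Am Ap s ξ = fun y => ∑ k, ξ k • interfaceGrad Am Ap s k y from rfl, h1]
  exact Finset.sum_congr rfl fun k _ => mul_comm _ _

/-- At every point `ξ` is recovered from the tangential components and the normal flux of `ξ_k
∇P_k`, on whichever side of the interface the point lies. -/
theorem norm_le_norm_interfaceComb (hlam : 0 < lam) (hm : IsBoundedElliptic lam Am)
    (hp : IsBoundedElliptic lam Ap) (s : EReal) (ξ x : Space d) :
    ‖ξ‖ ≤ d * (1 + lam⁻¹ * (1 + d * lam⁻¹)) * ((1 + lam⁻¹) * ‖interfaceComb Am Ap s ξ x‖) := by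
  have hl := inv_pos.2 hlam
  refine norm_le_of_tangential_of_flux hlam hm (fun j hj => ?_) ?_
  · rw [← interfaceComb_tangential Am Ap s ξ x hj]
    refine (abs_apply_le_norm _ j).trans ?_
    nlinarith [norm_nonneg (interfaceComb Am Ap s ξ x)]
  · rw [← flux_interfaceComb_normal (hlam.trans_le (hp.le_diag 0)).ne' s ξ x]
    have h1 := ((by unfold interfaceField; split_ifs <;> assumption :
      IsBoundedElliptic lam (interfaceField Am Ap s x))).flux_sq_le (interfaceComb Am Ap s ξ)
    have h2 := (Finset.single_le_sum (f := fun i =>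
      flux (interfaceField Am Ap s) (interfaceComb Am Ap s ξ) x i ^ 2)
      (fun i _ => sq_nonneg _) (Finset.mem_univ 0)).trans h1
    rw [← mul_pow] at h2
    refine (abs_le_of_sq_le_sq h2 (by positivity)).trans ?_
    nlinarith [norm_nonneg (interfaceComb Am Ap s ξ x)]

/-- The translation invariant entire solutions are spanned by the harmonic coordinates. -/
theorem IsEntireHarmonicGrad.exists_eq_interfaceComb (hlam : 0 < lam)
    (hm : IsBoundedElliptic lam Am) (hp : IsBoundedElliptic lam Ap) {G : Space d → Space d}
    (hG : IsEntireHarmonicGrad (interfaceField Am Ap s) G)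
    (hinv : ∀ h : Space d, h 0 = 0 → ∀ᵐ x ∂(volume : Measure (Space d)), G (x + h) = G x) :
    ∃ ξ : Space d, ∀ᵐ x ∂(volume : Measure (Space d)), G x = interfaceComb Am Ap s ξ x := by
  have hE := isBoundedEllipticField_interfaceField hm hp s
  have hGm := fun j R => memLp_apply (hG.memLp R) j
  have hqm := fun j R => hE.memLp_flux (hG.memLp R) j
  have hbasis : ∀ i : Fin d, i ≠ 0 → ∀ t : ℝ, (t • (basisVec i : Space d)) 0 = 0 :=
    fun i hi t => by simp [basisVec, hi.symm]
  have hGi : ∀ i : Fin d, i ≠ 0 → ∀ j, ∀ ψ, IsTestFunction univ ψ →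
      ∫ x, G x j * partialDeriv i ψ x = 0 := fun i hi j ψ hψ =>
    integral_mul_partialDeriv_eq_zero (hGm j) i (fun t => by
      filter_upwards [hinv _ (hbasis i hi t)] with x hx
      rw [hx]) hψ
  have hqi : ∀ i : Fin d, i ≠ 0 → ∀ j, ∀ ψ, IsTestFunction univ ψ →
      ∫ x, flux (interfaceField Am Ap s) G x j * partialDeriv i ψ x = 0 := fun i hi j ψ hψ =>
    integral_mul_partialDeriv_eq_zero (hqm j) i (fun t => by
      filter_upwards [hinv _ (hbasis i hi t)] with x hx
      simp only [flux, interfaceField_add Am Ap s (hbasis i hi t), hx]) hψ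
  have hcurl : ∀ i j, ∀ ψ, IsTestFunction univ ψ →
      ∫ x, G x j * partialDeriv i ψ x = ∫ x, G x i * partialDeriv j ψ x := by
    intro i j ψ hψ
    obtain ⟨R, hR, hψR⟩ := hψ.exists_ball
    obtain ⟨v, hv⟩ := hG R hR
    have h1 := hv.h1.weak_grad _ (hψR.partialDeriv i) j
    have h2 := hv.h1.weak_grad _ (hψR.partialDeriv j) i
    simp only [partialDeriv_comm hψ.smooth i j] at h2
    rw [h1] at h2
    have h3 := neg_injective h2
    rwa [setIntegral_eq_of_test Subset.rfl fun x hx => by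
        rw [(hψR.partialDeriv i).eq_zero hx, mul_zero],
      setIntegral_eq_of_test Subset.rfl fun x hx => by
        rw [(hψR.partialDeriv j).eq_zero hx, mul_zero]] at h3
  -- All tangential derivatives of the flux vanish, so the divergence equation reduces to the normal
  -- derivative of the normal flux.
  have hdiv : ∀ ψ, IsTestFunction univ ψ →
      ∫ x, flux (interfaceField Am Ap s) G x 0 * partialDeriv 0 ψ x = 0 := by
    intro ψ hψ
    obtain ⟨R, hR, hψR⟩ := hψ.exists_ball
    obtain ⟨v, hv⟩ := hG R hR
    have h1 := hv.eqn ψ hψR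
    rw [integral_finsetSum _ fun i _ => (hqm i R).integrable_mul_two
      ((hψR.partialDeriv i).memLp _ 2)] at h1
    have e : ∀ i, ∫ x in Metric.ball 0 R, flux (interfaceField Am Ap s) G x i * partialDeriv i ψ x
        = ∫ x, flux (interfaceField Am Ap s) G x i * partialDeriv i ψ x := fun i =>
      setIntegral_eq_of_test Subset.rfl fun x hx => by
        rw [(hψR.partialDeriv i).eq_zero hx, mul_zero]
    simp only [e, zero_mul, integral_zero, neg_zero] at h1
    rwa [Finset.sum_eq_single 0 (fun i _ hi => hqi i hi i ψ hψ) (by simp)] at h1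
  -- Since `G` is curl-free, any derivative of the tangential component `G_j` equals the `j`-th
  -- derivative of another component, which vanishes by invariance.
  have hc : ∀ j : Fin d, j ≠ 0 → ∃ c : ℝ, ∀ᵐ x ∂(volume : Measure (Space d)), G x j = c := by
    intro j hj
    refine exists_ae_eq_const (hGm j) fun ψ hψ i => ?_
    rw [hcurl i j ψ hψ]
    exact hGi j hj i ψ hψ
  obtain ⟨c, hc0⟩ : ∃ c : Fin d → ℝ, ∀ j, j ≠ 0 →
      ∀ᵐ x ∂(volume : Measure (Space d)), G x j = c j := by
    choose! c hc using hc
    exact ⟨c, hc⟩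
  obtain ⟨q, hq⟩ : ∃ q : ℝ, ∀ᵐ x ∂(volume : Measure (Space d)),
      flux (interfaceField Am Ap s) G x 0 = q := by
    refine exists_ae_eq_const (hqm 0) fun ψ hψ i => ?_
    by_cases hi : i = 0
    · subst hi; exact hdiv ψ hψ
    · exact hqi i hi 0 ψ hψ
  have hm0 : Am 0 0 ≠ 0 := (hlam.trans_le (hm.le_diag 0)).ne'
  have hp0 : Ap 0 0 ≠ 0 := (hlam.trans_le (hp.le_diag 0)).ne'
  -- The tangential entries are the constants found above; the normal entry solves `∑ k, Am 0 k * ξ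
  -- k = q`, which is possible because `Am 0 0 > 0`.
  let ξ : Space d := WithLp.toLp 2 fun j =>
    if j = 0 then (q - ∑ k ∈ Finset.univ.erase 0, Am 0 k * c k) / Am 0 0 else c j
  have hξ : ∀ j, j ≠ 0 → ξ j = c j := fun j hj => by simp [ξ, hj]
  have hξ0 : ∑ k, Am 0 k * ξ k = q := by
    rw [← Finset.add_sum_erase Finset.univ _ (Finset.mem_univ (0 : Fin d)),
      Finset.sum_congr rfl fun k hk => by rw [hξ k (Finset.ne_of_mem_erase hk)]]
    simp only [ξ, if_true]
    rw [mul_div_cancel₀ _ hm0]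
    ring
  have hc1 : ∀ᵐ x ∂(volume : Measure (Space d)), ∀ j, j ≠ 0 → G x j = c j := by
    rw [ae_all_iff]
    intro j
    by_cases hj : j = 0
    · simp [hj]
    · filter_upwards [hc0 j hj] with x hx _ using hx
  refine ⟨ξ, ?_⟩
  filter_upwards [hc1, hq] with x hx hqx
  have ht : ∀ j, j ≠ 0 → G x j = interfaceComb Am Ap s ξ x j := fun j hj => by
    rw [interfaceComb_tangential Am Ap s ξ x hj, hξ j hj, hx j hj]
  have hn : flux (interfaceField Am Ap s) G x 0
      = flux (interfaceField Am Ap s) (interfaceComb Am Ap s ξ) x 0 := by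
    rw [flux_interfaceComb_normal hp0, hξ0, hqx]
  have h00 : interfaceField Am Ap s x 0 0 ≠ 0 := by
    unfold interfaceField; split_ifs <;> assumption
  ext j
  by_cases hj : j = 0
  · subst hj
    simp only [flux] at hn
    rw [← Finset.add_sum_erase Finset.univ _ (Finset.mem_univ (0 : Fin d)),
      ← Finset.add_sum_erase Finset.univ _ (Finset.mem_univ (0 : Fin d)),
      Finset.sum_congr rfl fun k hk => by rw [ht k (Finset.ne_of_mem_erase hk)]] at hn
    exact mul_left_cancel₀ h00 (add_right_cancel hn)
  · exact ht j hj

/-- The norm of `ξ_k ∇P_k` is bounded below by a multiple of `‖ξ‖`, so a nonzero `ξ` forces the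
Dirichlet integral to grow at least like `r ^ d`. -/
theorem eq_zero_of_hasGrowth_interfaceComb (hlam : 0 < lam)
    (hm : IsBoundedElliptic lam Am) (hp : IsBoundedElliptic lam Ap) {G : Space d → Space d}
    (hGm : ∀ R : ℝ, MemLp G 2 (volume.restrict (Metric.ball 0 R)))
    {γ : ℝ} (hγ : γ < d) (hg : HasGrowth γ G) {ξ : Space d}
    (hξ : ∀ᵐ x ∂(volume : Measure (Space d)), G x = interfaceComb Am Ap s ξ x) : ξ = 0 := by
  obtain ⟨C, hC⟩ := hg
  set K : ℝ := d * (1 + lam⁻¹ * (1 + d * lam⁻¹)) * (1 + lam⁻¹) with hK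
  have hl := inv_pos.2 hlam
  have hV := volume_real_ball_pos (0 : Space d) one_pos
  have h1 : ∀ r : ℝ, 1 ≤ r → ‖ξ‖ ^ 2 * volume.real (Metric.ball (0 : Space d) 1)
      ≤ K ^ 2 * C * r ^ (γ - d) := by
    intro r hr
    have hr0 : 0 < r := by linarith
    have h2 : ∫ x in Metric.ball (0 : Space d) r, ‖ξ‖ ^ 2
        ≤ ∫ x in Metric.ball (0 : Space d) r, K ^ 2 * ‖G x‖ ^ 2 := by
      refine integral_mono_ae (integrable_const _) ((integrable_norm_sq (hGm r)).const_mul _) ?_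
      filter_upwards [ae_restrict_of_ae hξ] with x hx
      rw [hx, ← mul_pow]
      refine pow_le_pow_left₀ (norm_nonneg _) ?_ 2
      rw [hK, mul_assoc]
      exact norm_le_norm_interfaceComb hlam hm hp s ξ x
    rw [integral_const_mul, setIntegral_const, volume_real_ball_eq 0 hr0, smul_eq_mul] at h2
    have h3 := h2.trans (mul_le_mul_of_nonneg_left (hC r hr) (sq_nonneg K))
    rw [Real.rpow_sub hr0, Real.rpow_natCast, mul_div_assoc', le_div_iff₀ (by positivity)]
    linarith
  have hlim : Tendsto (fun r : ℝ => K ^ 2 * C * r ^ (γ - d)) atTop (𝓝 0) := by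
    have := (tendsto_rpow_neg_atTop (by linarith : 0 < -(γ - d))).const_mul (K ^ 2 * C)
    simpa using this
  have h2 : ‖ξ‖ ^ 2 * volume.real (Metric.ball (0 : Space d) 1) ≤ 0 :=
    ge_of_tendsto hlim (by filter_upwards [eventually_ge_atTop (1 : ℝ)] with r hr using h1 r hr)
  have h3 : ‖ξ‖ ^ 2 ≤ 0 := by
    by_contra h
    push Not at h
    nlinarith [mul_pos h hV]
  exact norm_eq_zero.1 (pow_eq_zero_iff (by norm_num) |>.1 (le_antisymm h3 (sq_nonneg _)))

/-- Induction on the number of differences needed to reach a negative exponent. Tangential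
differences vanish by the induction hypothesis, so `G` is a combination of the `∇P_k`, and growth
below `r ^ d` excludes all but the zero combination. -/
theorem IsEntireHarmonicGrad.ae_eq_zero (hlam : 0 < lam)
    (hm : IsBoundedElliptic lam Am) (hp : IsBoundedElliptic lam Ap) (k : ℕ) :
    ∀ {γ : ℝ} {G : Space d → Space d}, IsEntireHarmonicGrad (interfaceField Am Ap s) G →
      γ < d → γ < 2 * k → HasGrowth γ G → ∀ᵐ x ∂(volume : Measure (Space d)), G x = 0 := by
  have hE := isBoundedEllipticField_interfaceField hm hp s
  induction k with
  | zero => intro γ G hG _ hγ hg; exact hg.ae_eq_zero hG.memLp (by simpa using hγ)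
  | succ k ih =>
    intro γ G hG hγd hγ hg
    push_cast at hγ
    obtain ⟨ξ, hξ⟩ := hG.exists_eq_interfaceComb hlam hm hp fun h hh => by
      have hD := hG.difference hlam hE (interfaceField_add Am Ap s hh) hg
      filter_upwards [ih hD.1 (by linarith) (by linarith) hD.2] with x hx
      exact sub_eq_zero.1 hx
    have h0 := eq_zero_of_hasGrowth_interfaceComb hlam hm hp hG.memLp hγd hg hξ
    filter_upwards [hξ] with x hx
    rw [hx, h0]
    simp [interfaceComb]

/-- Liouville theorem: subquadratic entire solutions are spanned by the harmonic coordinates. -/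
theorem IsEntireHarmonicGrad.liouville (hlam : 0 < lam)
    (hm : IsBoundedElliptic lam Am) (hp : IsBoundedElliptic lam Ap) {γ : ℝ} (hγ : γ < d + 2)
    {G : Space d → Space d} (hG : IsEntireHarmonicGrad (interfaceField Am Ap s) G)
    (hg : HasGrowth γ G) :
    ∃ ξ : Space d, ∀ᵐ x ∂(volume : Measure (Space d)), G x = interfaceComb Am Ap s ξ x := by
  have hE := isBoundedEllipticField_interfaceField hm hp s
  obtain ⟨k, hk⟩ := exists_nat_gt γ
  refine hG.exists_eq_interfaceComb hlam hm hp fun h hh => ?_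
  -- The difference has exponent `γ - 2 < d`, the threshold below which entire solutions vanish;
  -- this is the origin of the condition `γ < d + 2`.
  have hD := hG.difference hlam hE (interfaceField_add Am Ap s hh) hg
  have hk0 : (0 : ℝ) ≤ k := Nat.cast_nonneg k
  filter_upwards [hD.1.ae_eq_zero hlam hm hp k (by linarith) (by linarith) hD.2] with x hx
  exact sub_eq_zero.1 hx

end Liouville


/-! ### Limits of correctors -/

section CorrectorLimits

variable {d : ℕ} {lam : ℝ} {ι : Type*}

theorem exists_tendsto_of_isCompact {X : Type*} [TopologicalSpace X] (U : Ultrafilter ι)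
    {K : Set X} (hK : IsCompact K) {x : ι → X} (hx : ∀ᶠ n in (U : Filter ι), x n ∈ K) :
    ∃ y ∈ K, Tendsto x U (𝓝 y) :=
  hK.ultrafilter_le_nhds (U.map x) (le_principal_iff.2 hx)

theorem exists_tendsto_isBoundedElliptic (U : Ultrafilter ι) (hlam : 0 < lam)
    {A : ι → Matrix (Fin d) (Fin d) ℝ} (hA : ∀ᶠ n in (U : Filter ι), IsBoundedElliptic lam (A n)) :
    ∃ A₀, IsBoundedElliptic lam A₀ ∧ ∀ i j, Tendsto (fun n => A n i j) U (𝓝 (A₀ i j)) := by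
  have h1 : ∀ i j, ∃ y ∈ Icc (-lam⁻¹) lam⁻¹, Tendsto (fun n => A n i j) U (𝓝 y) := fun i j =>
    exists_tendsto_of_isCompact U isCompact_Icc
      (hA.mono fun n hn => abs_le.1 (hn.abs_apply_le hlam i j))
  choose A₀ _ hA₀ using h1
  have h2 : ∀ ξ : Fin d → ℝ, ∀ i, Tendsto (fun n => (A n *ᵥ ξ) i) U (𝓝 ((Matrix.of A₀ *ᵥ ξ) i)) :=
    fun ξ i => by
      simp only [Matrix.mulVec, dotProduct, Matrix.of_apply]
      exact tendsto_finsetSum _ fun j _ => (hA₀ i j).mul_const _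
  refine ⟨Matrix.of A₀, fun ξ => ⟨?_, ?_⟩, hA₀⟩
  · exact ge_of_tendsto (tendsto_finsetSum _ fun i _ => (h2 ξ i).const_mul _)
      (hA.mono fun n hn => (hn ξ).1)
  · exact le_of_tendsto (tendsto_finsetSum _ fun i _ => (h2 ξ i).mul (h2 ξ i))
      (hA.mono fun n hn => (hn ξ).2)

theorem integral_apply_sq_le {μ : Measure (Space d)} {G : Space d → Space d} (h : MemLp G 2 μ)
    (i : Fin d) : ∫ x, G x i ^ 2 ∂μ ≤ ∫ x, ‖G x‖ ^ 2 ∂μ := by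
  rw [integral_norm_sq_eq h]
  exact Finset.single_le_sum (f := fun i => ∫ x, G x i ^ 2 ∂μ)
    (fun _ _ => integral_nonneg fun _ => sq_nonneg _) (Finset.mem_univ i)

/-- Vanishing oscillation makes all derivatives vanish as distributions, since the mean is invisible
to a derivative. Both `∇φ` and `div σ` disappear in the limit for this reason. -/
theorem tendsto_integral_mul_partialDeriv {l : Filter ι} {R : ℝ} {f : ι → Space d → ℝ}
    (hf : ∀ᶠ n in l, MemLp (f n) 2 (volume.restrict (Metric.ball 0 R)))
    (h0 : Tendsto (fun n => ∫ x in Metric.ball 0 R, (f n x - ⨍ y in Metric.ball 0 R, f n y) ^ 2)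
      l (𝓝 0)) {ψ : Space d → ℝ} (hψ : IsTestFunction (Metric.ball 0 R) ψ) (i : Fin d) :
    Tendsto (fun n => ∫ x in Metric.ball 0 R, f n x * partialDeriv i ψ x) l (𝓝 0) := by
  have hm := (hψ.partialDeriv i).memLp (volume.restrict (Metric.ball 0 R)) 2
  have h1 : Tendsto (fun n => √(∫ x in Metric.ball 0 R,
      (f n x - ⨍ y in Metric.ball 0 R, f n y) ^ 2)
      * √(∫ x in Metric.ball 0 R, partialDeriv i ψ x ^ 2)) l (𝓝 0) := by
    simpa using (h0.sqrt).mul_const (√(∫ x in Metric.ball 0 R, partialDeriv i ψ x ^ 2))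
  refine squeeze_zero_norm' ?_ h1
  filter_upwards [hf] with n hn
  generalize ⨍ y in Metric.ball 0 R, f n y = c
  have e : ∫ x in Metric.ball 0 R, f n x * partialDeriv i ψ x
      = ∫ x in Metric.ball 0 R, (f n x - c) * partialDeriv i ψ x := by
    simp_rw [sub_mul]
    rw [integral_sub (hn.integrable_mul_two hm) ((hm.integrable (by norm_num)).const_mul _),
      integral_const_mul, integral_partialDeriv_eq_zero hψ i, mul_zero, sub_zero]
  rw [e, Real.norm_eq_abs]
  exact abs_integral_mul_le (hn.sub_two (memLp_const c)) hm

variable [NeZero d]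

theorem ae_coe_ne (s : EReal) : ∀ᵐ x ∂(volume : Measure (Space d)), ((x 0 : ℝ) : EReal) ≠ s := by
  induction s with
  | bot => exact Eventually.of_forall fun x => EReal.coe_ne_bot _
  | top => exact Eventually.of_forall fun x => EReal.coe_ne_top _
  | coe c =>
    filter_upwards [(measurePreserving_sub_right (volume : Measure (Space d))
      (c • basisVec 0)).quasiMeasurePreserving.ae (ae_ne_zero d)] with x hx h
    refine hx ?_
    simp [basisVec, EReal.coe_eq_coe_iff.1 h]

/-- For almost every `x` the phase at `x` is eventually constant as the interface height tends to
`s₀`, because the hyperplane at height `s₀` is null. Heights `±∞` are included: the interface then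
leaves every bounded set. -/
theorem tendsto_integral_interface {l : Filter ι} {s : ι → EReal} {s₀ : EReal}
    (hs : Tendsto s l (𝓝 s₀)) {c e : ι → ℝ} {c₀ e₀ : ℝ} (hc : Tendsto c l (𝓝 c₀))
    (he : Tendsto e l (𝓝 e₀)) {S : Set (Space d)} {g : Space d → ℝ}
    (hg : Integrable g (volume.restrict S)) :
    Tendsto (fun n => ∫ x in S, (if s n < (x 0 : ℝ) then e n else c n) * g x) l
      (𝓝 (∫ x in S, (if s₀ < (x 0 : ℝ) then e₀ else c₀) * g x)) := by
  have hi : ∀ s : EReal, Integrable (fun x => if s < (x 0 : ℝ) then g x else 0)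
      (volume.restrict S) := fun s => by
    have e : (fun x : Space d => if s < (x 0 : ℝ) then g x else 0)
        = {x : Space d | s < (x 0 : ℝ)}.indicator g := by
      ext x
      by_cases hx : s < (x 0 : ℝ) <;> simp [Set.indicator, hx]
    rw [e]
    exact hg.indicator (measurableSet_interface s)
  have h1 : Tendsto (fun s : EReal => ∫ x in S, if s < (x 0 : ℝ) then g x else 0) (𝓝 s₀)
      (𝓝 (∫ x in S, if s₀ < (x 0 : ℝ) then g x else 0)) := by
    refine tendsto_integral_filter_of_dominated_convergence (fun x => ‖g x‖)
      (Eventually.of_forall fun s => (hi s).aestronglyMeasurable)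
      (Eventually.of_forall fun s => Eventually.of_forall fun x => ?_) hg.norm ?_
    · split_ifs <;> simp
    · filter_upwards [ae_restrict_of_ae (ae_coe_ne s₀)] with x hx
      refine tendsto_const_nhds.congr' ?_
      rcases lt_or_gt_of_ne hx with h | h
      · filter_upwards [eventually_gt_nhds h] with s hs
        rw [if_neg (not_lt.2 h.le), if_neg (not_lt.2 hs.le)]
      · filter_upwards [eventually_lt_nhds h] with s hs
        rw [if_pos h, if_pos hs]
  have e1 : ∀ (s : EReal) (c e : ℝ), ∫ x in S, (if s < (x 0 : ℝ) then e else c) * g x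
      = c * (∫ x in S, g x) + (e - c) * ∫ x in S, if s < (x 0 : ℝ) then g x else 0 := by
    intro s c e
    rw [← integral_const_mul, ← integral_const_mul, ← integral_add (hg.const_mul c)
      ((hi s).const_mul _)]
    congr 1; ext x
    split_ifs <;> ring
  simp_rw [e1]
  exact (hc.mul_const _).add ((he.sub hc).mul (h1.comp hs))

theorem interfaceGrad_apply_eq_ite (Am Ap : Matrix (Fin d) (Fin d) ℝ) (s : EReal) (k : Fin d)
    (x : Space d) (i : Fin d) :
    interfaceGrad Am Ap s k x i = if s < (x 0 : ℝ)
      then (basisVec k : Space d) i + kink Am Ap k * (basisVec 0 : Space d) i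
      else (basisVec k : Space d) i := by
  unfold interfaceGrad
  split_ifs <;> simp

theorem flux_interfaceGrad_eq_ite (Am Ap : Matrix (Fin d) (Fin d) ℝ) (s : EReal) (k : Fin d)
    (x : Space d) (i : Fin d) :
    flux (interfaceField Am Ap s) (interfaceGrad Am Ap s k) x i = if s < (x 0 : ℝ)
      then Ap i k + kink Am Ap k * Ap i 0 else Am i k := by
  simp only [flux, interfaceField, interfaceGrad]
  split_ifs
  · simp only [PiLp.add_apply, PiLp.smul_apply, basisVec, PiLp.single_apply,
      smul_eq_mul, mul_add, Finset.sum_add_distrib]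
    simp [mul_comm]
  · simp [basisVec]

/-- A sequence of local correctors on balls exhausting the space, whose oscillation on every fixed
ball tends to zero. -/
structure IsCorrectorSequence (l : Filter ι) (lam : ℝ) (a : ι → CoeffField d)
    (Am Ap : ι → Matrix (Fin d) (Fin d) ℝ) (s : ι → EReal) (φ : ι → Fin d → Space d → ℝ)
    (Dφ : ι → Fin d → Space d → Space d) (σ : ι → Fin d → Fin d → Fin d → Space d → ℝ) :
    Prop where
  corrector : ∀ R : ℝ, ∀ᶠ n in l, IsLocalCorrector lam R (a n) (Am n) (Ap n) (s n) (φ n) (Dφ n)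
    (σ n)
  phi : ∀ R : ℝ, 1 ≤ R → ∀ k, Tendsto (fun n => ∫ x in Metric.ball 0 R,
    (φ n k x - ⨍ y in Metric.ball 0 R, φ n k y) ^ 2) l (𝓝 0)
  sigma : ∀ R : ℝ, 1 ≤ R → ∀ i j k, Tendsto (fun n => ∫ x in Metric.ball 0 R,
    (σ n i j k x - ⨍ y in Metric.ball 0 R, σ n i j k y) ^ 2) l (𝓝 0)
  bounded : ∀ R : ℝ, 1 ≤ R → ∀ ξ : Space d, ∃ C : ℝ, ∀ᶠ n in l,
    ∫ x in Metric.ball 0 R, ‖correctedComb (Am n) (Ap n) (s n) (Dφ n) ξ x‖ ^ 2 ≤ C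

variable {U : Ultrafilter ι} {a : ι → CoeffField d} {Am Ap : ι → Matrix (Fin d) (Fin d) ℝ}
  {s : ι → EReal} {φ : ι → Fin d → Space d → ℝ} {Dφ : ι → Fin d → Space d → Space d}
  {σ : ι → Fin d → Fin d → Fin d → Space d → ℝ} {Am₀ Ap₀ : Matrix (Fin d) (Fin d) ℝ} {s₀ : EReal}

theorem correctedComb_apply (Am Ap : Matrix (Fin d) (Fin d) ℝ) (s : EReal)
    (Dφ : Fin d → Space d → Space d) (ξ x : Space d) (i : Fin d) :
    correctedComb Am Ap s Dφ ξ x i = ∑ k, ξ k * (interfaceGrad Am Ap s k x + Dφ k x) i := by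
  simp [correctedComb, Finset.sum_apply, mul_add]

theorem correctedComb_basisVec (Am Ap : Matrix (Fin d) (Fin d) ℝ) (s : EReal)
    (Dφ : Fin d → Space d → Space d) (k : Fin d) (x : Space d) :
    correctedComb Am Ap s Dφ (basisVec k) x = interfaceGrad Am Ap s k x + Dφ k x := by
  simp [correctedComb, basisVec, Finset.sum_add_distrib]

/-- Corrected gradients converge weakly to the gradients of the harmonic coordinates. -/
theorem IsCorrectorSequence.tendstoWeakly_grad
    (h : IsCorrectorSequence (U : Filter ι) lam a Am Ap s φ Dφ σ) (hlam : 0 < lam)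
    (hm : IsBoundedElliptic lam Am₀) (hp : IsBoundedElliptic lam Ap₀)
    (hAm : ∀ i j, Tendsto (fun n => Am n i j) U (𝓝 (Am₀ i j)))
    (hAp : ∀ i j, Tendsto (fun n => Ap n i j) U (𝓝 (Ap₀ i j)))
    (hs : Tendsto s U (𝓝 s₀)) {R : ℝ} (hR : 1 ≤ R) (k i : Fin d) :
    TendstoWeakly U (volume.restrict (Metric.ball 0 R))
      (fun n x => (interfaceGrad (Am n) (Ap n) (s n) k x + Dφ n k x) i)
      (fun x => interfaceGrad Am₀ Ap₀ s₀ k x i) := by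
  have hk : Tendsto (fun n => kink (Am n) (Ap n) k) U (𝓝 (kink Am₀ Ap₀ k)) :=
    ((hAm 0 k).sub (hAp 0 k)).div (hAp 0 0) (hlam.trans_le (hp.le_diag 0)).ne'
  obtain ⟨C, hC⟩ := h.bounded R hR (basisVec k)
  simp only [correctedComb_basisVec] at hC
  have hF : ∀ᶠ n in (U : Filter ι), MemLp (fun x => interfaceGrad (Am n) (Ap n) (s n) k x
      + Dφ n k x) 2 (volume.restrict (Metric.ball 0 R)) :=
    (h.corrector R).mono fun n hn => by
      simpa only [← correctedComb_basisVec] using hn.memLp_correctedComb (basisVec k)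
  -- The uniform energy bound reduces weak convergence to smooth test functions, against which `∇φ`
  -- can be integrated by parts.
  refine tendstoWeakly_of_test U Metric.isOpen_ball (C := C)
    (hF.mono fun n hn => memLp_apply hn i) ?_
    (memLp_apply (memLp_interfaceGrad hlam hm hp s₀ k R) i) fun ψ hψ => ?_
  · filter_upwards [hF, hC] with n hn hn'
    exact (integral_apply_sq_le hn i).trans hn'
  · have hψm := hψ.memLp (volume.restrict (Metric.ball (0 : Space d) R)) 2
    have h1 := tendsto_integral_interface (d := d) (S := Metric.ball 0 R) hs
      (tendsto_const_nhds (x := (basisVec k : Space d) i))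
      ((hk.mul_const ((basisVec 0 : Space d) i)).const_add ((basisVec k : Space d) i))
      (hψm.integrable (by norm_num))
    have h2 := tendsto_integral_mul_partialDeriv
      ((h.corrector R).mono fun n hn => (hn.phi k).memLp_fun) (h.phi R hR k) hψ i
    have h3 := h1.sub h2
    rw [sub_zero] at h3
    simp only [interfaceGrad_apply_eq_ite]
    refine h3.congr' ?_
    filter_upwards [h.corrector R] with n hn
    rw [(hn.phi k).weak_grad ψ hψ i, sub_neg_eq_add]
    simp only [← interfaceGrad_apply_eq_ite, PiLp.add_apply, add_mul]
    rw [integral_add ((memLp_apply (memLp_interfaceGrad hlam hn.minus hn.plus (s n) k R)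
      i).integrable_mul_two hψm) ((memLp_apply (hn.phi k).memLp_grad i).integrable_mul_two hψm)]

/-- The fluxes of corrected gradients converge weakly to the homogenized fluxes. -/
theorem IsCorrectorSequence.tendstoWeakly_flux
    (h : IsCorrectorSequence (U : Filter ι) lam a Am Ap s φ Dφ σ) (hlam : 0 < lam)
    (hm : IsBoundedElliptic lam Am₀) (hp : IsBoundedElliptic lam Ap₀)
    (hAm : ∀ i j, Tendsto (fun n => Am n i j) U (𝓝 (Am₀ i j)))
    (hAp : ∀ i j, Tendsto (fun n => Ap n i j) U (𝓝 (Ap₀ i j)))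
    (hs : Tendsto s U (𝓝 s₀)) {R : ℝ} (hR : 1 ≤ R) (k j : Fin d) :
    TendstoWeakly U (volume.restrict (Metric.ball 0 R))
      (fun n x => flux (a n) (fun y => interfaceGrad (Am n) (Ap n) (s n) k y + Dφ n k y) x j)
      (fun x => flux (interfaceField Am₀ Ap₀ s₀) (interfaceGrad Am₀ Ap₀ s₀ k) x j) := by
  have hk : Tendsto (fun n => kink (Am n) (Ap n) k) U (𝓝 (kink Am₀ Ap₀ k)) :=
    ((hAm 0 k).sub (hAp 0 k)).div (hAp 0 0) (hlam.trans_le (hp.le_diag 0)).ne'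
  obtain ⟨C, hC⟩ := h.bounded R hR (basisVec k)
  simp only [correctedComb_basisVec] at hC
  have hF : ∀ᶠ n in (U : Filter ι), MemLp (fun x => interfaceGrad (Am n) (Ap n) (s n) k x
      + Dφ n k x) 2 (volume.restrict (Metric.ball 0 R)) :=
    (h.corrector R).mono fun n hn => by
      simpa only [← correctedComb_basisVec] using hn.memLp_correctedComb (basisVec k)
  have hint := fun {Am Ap : Matrix (Fin d) (Fin d) ℝ} (hm : IsBoundedElliptic lam Am)
    (hp : IsBoundedElliptic lam Ap) (s : EReal) =>
    (isBoundedEllipticField_interfaceField hm hp s).memLp_flux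
      (memLp_interfaceGrad hlam hm hp s k R) j
  -- Against test functions the equation for `σ` exchanges the heterogeneous flux for the
  -- homogenized one, up to a term controlled by the oscillation of `σ`.
  refine tendstoWeakly_of_test U Metric.isOpen_ball (C := lam⁻¹ ^ 2 * C) ?_ ?_
    (hint hm hp s₀) fun ψ hψ => ?_
  · filter_upwards [hF, h.corrector R] with n hn hn'
    exact hn'.field.memLp_flux hn j
  · filter_upwards [hF, hC, h.corrector R] with n hn hn' hn''
    exact (hn''.field.integral_flux_sq_le hn j).trans (by gcongr)
  · have hψm := hψ.memLp (volume.restrict (Metric.ball (0 : Space d) R)) 2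
    have h1 := tendsto_integral_interface (d := d) (S := Metric.ball 0 R) hs (hAm j k)
      ((hAp j k).add (hk.mul (hAp j 0))) (hψm.integrable (by norm_num))
    have h2 := tendsto_finsetSum Finset.univ fun i _ => tendsto_integral_mul_partialDeriv
      ((h.corrector R).mono fun n hn => hn.sigma i j k) (h.sigma R hR i j k) hψ i
    have h3 := h1.add h2
    simp only [Finset.sum_const_zero, add_zero] at h3
    simp only [flux_interfaceGrad_eq_ite]
    refine h3.congr' ?_
    filter_upwards [h.corrector R, hF] with n hn hFn
    have h4 := hn.sigma_eqn j k ψ hψ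
    rw [integral_finsetSum _ fun i _ => (hn.sigma i j k).integrable_mul_two
      ((hψ.partialDeriv i).memLp _ 2)] at h4
    rw [h4]
    simp only [sub_mul]
    rw [integral_sub ((hint hn.minus hn.plus (s n)).integrable_mul_two hψm)
      ((hn.field.memLp_flux hFn j).integrable_mul_two hψm)]
    simp only [flux_interfaceGrad_eq_ite]
    ring

theorem IsCorrectorSequence.tendstoWeakly_comb
    (h : IsCorrectorSequence (U : Filter ι) lam a Am Ap s φ Dφ σ) (hlam : 0 < lam)
    (hm : IsBoundedElliptic lam Am₀) (hp : IsBoundedElliptic lam Ap₀)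
    (hAm : ∀ i j, Tendsto (fun n => Am n i j) U (𝓝 (Am₀ i j)))
    (hAp : ∀ i j, Tendsto (fun n => Ap n i j) U (𝓝 (Ap₀ i j)))
    (hs : Tendsto s U (𝓝 s₀)) {R : ℝ} (hR : 1 ≤ R) (ξ : Space d) (i : Fin d) :
    TendstoWeakly U (volume.restrict (Metric.ball 0 R))
      (fun n x => correctedComb (Am n) (Ap n) (s n) (Dφ n) ξ x i)
      (fun x => interfaceComb Am₀ Ap₀ s₀ ξ x i) := by
  have h1 := TendstoWeakly.sum (l := (U : Filter ι)) Finset.univ (fun k _ =>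
    (h.tendstoWeakly_grad hlam hm hp hAm hAp hs hR k i).mul_const
      (tendsto_const_nhds (x := ξ k)))
    (fun k _ => (h.corrector R).mono fun n hn => (memLp_apply (by
      simpa only [← correctedComb_basisVec] using hn.memLp_correctedComb (basisVec k)) i).const_mul _)
    (fun k _ => (memLp_apply (memLp_interfaceGrad hlam hm hp s₀ k R) i).const_mul _)
  simp only [correctedComb_apply]
  have e : ∀ x, interfaceComb Am₀ Ap₀ s₀ ξ x i = ∑ k, ξ k * interfaceGrad Am₀ Ap₀ s₀ k x i :=
    fun x => by simp [interfaceComb, Finset.sum_apply]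
  simp only [e]
  exact h1

theorem flux_correctedComb (a : CoeffField d) (Am Ap : Matrix (Fin d) (Fin d) ℝ) (s : EReal)
    (Dφ : Fin d → Space d → Space d) (ξ x : Space d) (i : Fin d) :
    flux a (correctedComb Am Ap s Dφ ξ) x i
      = ∑ k, ξ k * flux a (fun y => interfaceGrad Am Ap s k y + Dφ k y) x i :=
  flux_sum a Finset.univ (fun k y => interfaceGrad Am Ap s k y + Dφ k y) ξ.ofLp x i

theorem IsCorrectorSequence.tendstoWeakly_flux_comb
    (h : IsCorrectorSequence (U : Filter ι) lam a Am Ap s φ Dφ σ) (hlam : 0 < lam)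
    (hm : IsBoundedElliptic lam Am₀) (hp : IsBoundedElliptic lam Ap₀)
    (hAm : ∀ i j, Tendsto (fun n => Am n i j) U (𝓝 (Am₀ i j)))
    (hAp : ∀ i j, Tendsto (fun n => Ap n i j) U (𝓝 (Ap₀ i j)))
    (hs : Tendsto s U (𝓝 s₀)) {R : ℝ} (hR : 1 ≤ R) (ξ : Space d) (i : Fin d) :
    TendstoWeakly U (volume.restrict (Metric.ball 0 R))
      (fun n x => flux (a n) (correctedComb (Am n) (Ap n) (s n) (Dφ n) ξ) x i)
      (fun x => flux (interfaceField Am₀ Ap₀ s₀) (interfaceComb Am₀ Ap₀ s₀ ξ) x i) := by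
  have h1 := TendstoWeakly.sum (l := (U : Filter ι)) Finset.univ (fun k _ =>
    (h.tendstoWeakly_flux hlam hm hp hAm hAp hs hR k i).mul_const
      (tendsto_const_nhds (x := ξ k)))
    (fun k _ => (h.corrector R).mono fun n hn => (hn.field.memLp_flux (by
      simpa only [← correctedComb_basisVec] using hn.memLp_correctedComb (basisVec k)) i).const_mul _)
    (fun k _ => ((isBoundedEllipticField_interfaceField hm hp s₀).memLp_flux
      (memLp_interfaceGrad hlam hm hp s₀ k R) i).const_mul _)
  simp only [flux_correctedComb]
  have e : ∀ x, flux (interfaceField Am₀ Ap₀ s₀) (interfaceComb Am₀ Ap₀ s₀ ξ) x i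
      = ∑ k, ξ k * flux (interfaceField Am₀ Ap₀ s₀) (interfaceGrad Am₀ Ap₀ s₀ k) x i :=
    fun x => flux_sum _ Finset.univ (interfaceGrad Am₀ Ap₀ s₀) ξ.ofLp x i
  simp only [e]
  exact h1

end CorrectorLimits


/-! ### Weak limits on exhausting balls -/

section Exhaustion

variable {d : ℕ} {ι : Type*}

theorem TendstoWeakly.mono_set {l : Filter ι} {S T : Set (Space d)} (hST : S ⊆ T)
    (hS : MeasurableSet S) {F : ι → Space d → ℝ} {f : Space d → ℝ}
    (h : TendstoWeakly l (volume.restrict T) F f) : TendstoWeakly l (volume.restrict S) F f := by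
  intro g hg
  have hrr : (volume.restrict T).restrict S = (volume : Measure (Space d)).restrict S :=
    Measure.restrict_restrict_of_subset hST
  have h1 := h (S.indicator g) (by rwa [memLp_indicator_iff_restrict hS, hrr])
  have e : ∀ f : Space d → ℝ, ∫ x in T, f x * S.indicator g x = ∫ x in S, f x * g x := fun f => by
    rw [← hrr, ← integral_indicator hS]
    congr 1; ext x
    by_cases hx : x ∈ S <;> simp [hx]
  simpa only [e] using h1

theorem TendstoWeakly.integral_sq_le {X : Type*} [MeasurableSpace X] {μ : Measure X}
    {U : Ultrafilter ι} {F : ι → X → ℝ} {f : X → ℝ} (h : TendstoWeakly U μ F f)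
    (hf : MemLp f 2 μ) (hF : ∀ᶠ n in (U : Filter ι), MemLp (F n) 2 μ) {C : ℝ}
    (hC : ∀ᶠ n in (U : Filter ι), ∫ x, F n x ^ 2 ∂μ ≤ C) : ∫ x, f x ^ 2 ∂μ ≤ C := by
  obtain ⟨f', hf', hf'C, hw⟩ := exists_tendstoWeakly U hF hC
  rw [integral_congr_ae ((h.ae_eq hw hf hf').mono fun x hx => by rw [hx])]
  exact hf'C

/-- Weak limits on nested balls agree almost everywhere by uniqueness, so they glue; at `x` the
limit on the ball of radius `⌊‖x‖⌋ + 1` is used. -/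
theorem exists_tendstoWeakly_ball (U : Ultrafilter ι) {F : ι → Space d → ℝ}
    (hF : ∀ R : ℝ, ∀ᶠ n in (U : Filter ι), MemLp (F n) 2 (volume.restrict (Metric.ball 0 R)))
    (hC : ∀ R : ℝ, ∃ C : ℝ, ∀ᶠ n in (U : Filter ι), ∫ x in Metric.ball 0 R, F n x ^ 2 ≤ C) :
    ∃ f : Space d → ℝ, ∀ R : ℝ, MemLp f 2 (volume.restrict (Metric.ball 0 R)) ∧
      TendstoWeakly U (volume.restrict (Metric.ball 0 R)) F f := by
  have h1 : ∀ m : ℕ, ∃ f, MemLp f 2 (volume.restrict (Metric.ball (0 : Space d) (m + 1))) ∧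
      TendstoWeakly U (volume.restrict (Metric.ball (0 : Space d) (m + 1))) F f := fun m => by
    obtain ⟨C, hC⟩ := hC (m + 1)
    obtain ⟨f, hf, -, hw⟩ := exists_tendstoWeakly U (hF (m + 1)) hC
    exact ⟨f, hf, hw⟩
  choose g hg hgw using h1
  have hsub : ∀ {j m : ℕ}, j ≤ m →
      Metric.ball (0 : Space d) (j + 1) ⊆ Metric.ball (0 : Space d) (m + 1) := fun h =>
    Metric.ball_subset_ball (by exact_mod_cast Nat.succ_le_succ h)
  have h2 : ∀ j m : ℕ, j ≤ m →
      ∀ᵐ x ∂(volume.restrict (Metric.ball (0 : Space d) (m + 1))),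
        x ∈ Metric.ball (0 : Space d) (j + 1) → g j x = g m x := by
    intro j m hjm
    have h3 := (hgw j).ae_eq ((hgw m).mono_set (hsub hjm) Metric.isOpen_ball.measurableSet) (hg j)
      ((hg m).mono_measure (Measure.restrict_mono (hsub hjm) le_rfl))
    exact ae_restrict_of_ae ((ae_restrict_iff' Metric.isOpen_ball.measurableSet).1 h3)
  set f : Space d → ℝ := fun x => g ⌊‖x‖⌋₊ x
  have h3 : ∀ m : ℕ, g m =ᵐ[volume.restrict (Metric.ball (0 : Space d) (m + 1))] f := by
    intro m
    have h4 : ∀ᵐ x ∂(volume.restrict (Metric.ball (0 : Space d) (m + 1))), ∀ j, j ≤ m →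
        x ∈ Metric.ball (0 : Space d) (j + 1) → g j x = g m x :=
      ae_all_iff.2 fun j => by
        by_cases hj : j ≤ m
        · filter_upwards [h2 j m hj] with x hx _ using hx
        · exact Eventually.of_forall fun x h => absurd h hj
    filter_upwards [h4, ae_restrict_mem Metric.isOpen_ball.measurableSet] with x hx hxm
    rw [mem_ball_zero_iff] at hxm
    refine (hx ⌊‖x‖⌋₊ ?_ ?_).symm
    · exact Nat.lt_succ_iff.1 ((Nat.floor_lt (norm_nonneg x)).2 (by exact_mod_cast hxm))
    · rw [mem_ball_zero_iff]; exact Nat.lt_floor_add_one _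
  refine ⟨f, fun R => ?_⟩
  obtain ⟨m, hm⟩ := exists_nat_gt R
  have hs : Metric.ball (0 : Space d) R ⊆ Metric.ball (0 : Space d) (m + 1) :=
    Metric.ball_subset_ball (by linarith)
  exact ⟨((memLp_congr_ae (h3 m)).1 (hg m)).mono_measure (Measure.restrict_mono hs le_rfl),
    ((hgw m).congr_limit (h3 m)).mono_set hs Metric.isOpen_ball.measurableSet⟩

end Exhaustion

/-! ### Identification of the flux -/

section Minty

variable {d : ℕ} [NeZero d] {lam : ℝ} {Am Ap : Matrix (Fin d) (Fin d) ℝ} {s : EReal}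

/-- At a fixed point `ξ ↦ ξ_k ∇P_k` is linear and injective, hence onto. Minty's trick needs
comparison gradients taking every value there. -/
theorem exists_interfaceComb_eq (hlam : 0 < lam) (hm : IsBoundedElliptic lam Am)
    (hp : IsBoundedElliptic lam Ap) (s : EReal) (x v : Space d) :
    ∃ ξ, interfaceComb Am Ap s ξ x = v := by
  let L : Space d →ₗ[ℝ] Space d :=
    { toFun := fun ξ => interfaceComb Am Ap s ξ x
      map_add' := fun ξ η => by
        simp [interfaceComb, add_smul, Finset.sum_add_distrib]
      map_smul' := fun c ξ => by
        simp [interfaceComb, Finset.smul_sum, mul_smul] }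
  have hL : Function.Injective L := by
    rw [← LinearMap.ker_eq_bot, LinearMap.ker_eq_bot']
    intro ξ hξ
    have h1 := norm_le_norm_interfaceComb hlam hm hp s ξ x
    have h2 : interfaceComb Am Ap s ξ x = 0 := hξ
    rw [h2] at h1
    simpa using h1
  exact LinearMap.injective_iff_surjective.1 hL v

theorem continuous_interfaceComb (Am Ap : Matrix (Fin d) (Fin d) ℝ) (s : EReal) (x : Space d) :
    Continuous fun ξ => interfaceComb Am Ap s ξ x := by
  unfold interfaceComb
  fun_prop

theorem memLp_interfaceComb (hlam : 0 < lam) (hm : IsBoundedElliptic lam Am)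
    (hp : IsBoundedElliptic lam Ap) (s : EReal) (ξ : Space d) (R : ℝ) :
    MemLp (interfaceComb Am Ap s ξ) 2 (volume.restrict (Metric.ball 0 R)) :=
  memLp_finsetSum _ fun k _ => (memLp_interfaceGrad hlam hm hp s k R).const_smul (ξ k)

/-- Minty's trick: monotonicity against all combinations of harmonic coordinates identifies the
flux. -/
theorem eq_flux_of_monotone (hlam : 0 < lam) (hm : IsBoundedElliptic lam Am)
    (hp : IsBoundedElliptic lam Ap) {G q : Space d → Space d} {x : Space d}
    (h : ∀ n, 0 ≤ ∑ i, (q x i - flux (interfaceField Am Ap s)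
        (interfaceComb Am Ap s (TopologicalSpace.denseSeq (Space d) n)) x i)
      * (G x i - interfaceComb Am Ap s (TopologicalSpace.denseSeq (Space d) n) x i)) (i : Fin d) :
    q x i = flux (interfaceField Am Ap s) G x i := by
  have hcont : ∀ i, Continuous fun ξ => interfaceComb Am Ap s ξ x i := fun i =>
    (by fun_prop : Continuous fun y : Space d => y i).comp (continuous_interfaceComb Am Ap s x)
  -- Only countably many `ξ` are assumed, so that the exceptional sets stay null in the application;
  -- continuity in `ξ` supplies the rest.
  have h1 : ∀ ξ, 0 ≤ ∑ i, (q x i - flux (interfaceField Am Ap s) (interfaceComb Am Ap s ξ) x i)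
      * (G x i - interfaceComb Am Ap s ξ x i) := by
    intro ξ
    refine (TopologicalSpace.denseRange_denseSeq (Space d)).induction_on ξ ?_ h
    refine isClosed_le continuous_const (continuous_finsetSum _ fun i _ => ?_)
    refine Continuous.mul (continuous_const.sub ?_) (continuous_const.sub (hcont i))
    exact continuous_finsetSum _ fun j _ => continuous_const.mul (hcont j)
  set A := interfaceField Am Ap s x with hA
  -- The comparison gradient is taken equal to `G x - t v` at the point. After division by `t`,
  -- letting `t → 0` and using `±v` leaves a linear condition that forces equality.
  have h2 : ∀ (v : Space d) (t : ℝ), 0 < t →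
      0 ≤ ∑ i, (q x i - flux (interfaceField Am Ap s) G x i) * v i
        + t * ∑ i, (∑ j, A i j * v j) * v i := by
    intro v t ht
    obtain ⟨ξ, hξ⟩ := exists_interfaceComb_eq hlam hm hp s x (G x - t • v)
    have h3 := h1 ξ
    have e : ∑ i, (q x i - flux (interfaceField Am Ap s) (interfaceComb Am Ap s ξ) x i)
        * (G x i - interfaceComb Am Ap s ξ x i)
        = t * (∑ i, (q x i - flux (interfaceField Am Ap s) G x i) * v i
          + t * ∑ i, (∑ j, A i j * v j) * v i) := by
      rw [mul_add, Finset.mul_sum, ← mul_assoc, Finset.mul_sum, ← Finset.sum_add_distrib]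
      refine Finset.sum_congr rfl fun i _ => ?_
      have e1 : ∑ j, A i j * (G x j - t * v j) = ∑ j, A i j * G x j - t * ∑ j, A i j * v j := by
        rw [Finset.mul_sum, ← Finset.sum_sub_distrib]
        exact Finset.sum_congr rfl fun j _ => by ring
      simp only [flux, hξ, ← hA, PiLp.sub_apply, PiLp.smul_apply, smul_eq_mul, e1]
      ring
    rw [e] at h3
    exact nonneg_of_mul_nonneg_right h3 ht
  have h4 : ∀ v : Space d, 0 ≤ ∑ i, (q x i - flux (interfaceField Am Ap s) G x i) * v i := by
    intro v
    have hlim : Tendsto (fun t : ℝ => ∑ i, (q x i - flux (interfaceField Am Ap s) G x i) * v i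
        + t * ∑ i, (∑ j, A i j * v j) * v i) (𝓝[>] 0)
        (𝓝 (∑ i, (q x i - flux (interfaceField Am Ap s) G x i) * v i
          + 0 * ∑ i, (∑ j, A i j * v j) * v i)) :=
      ((tendsto_id.mono_left nhdsWithin_le_nhds).mul_const _).const_add _
    rw [zero_mul, add_zero] at hlim
    exact ge_of_tendsto hlim (by filter_upwards [self_mem_nhdsWithin] with t ht using h2 v t ht)
  have h5 := h4 (basisVec i)
  have h6 := h4 (-basisVec i)
  simp [basisVec] at h5 h6
  linarith

end Minty

/-! ### Compactness -/

section Compactness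

variable {d : ℕ} [NeZero d] {lam : ℝ}

/-- This is the homogenization step. Weak limits of gradients and fluxes of `w` are linked by
Minty's trick through comparison with corrected coordinates, the limit is classified by the
Liouville theorem, and convergence becomes strong because the difference from the matching corrected
coordinate is itself harmonic. -/
theorem IsCorrectorSequence.tendsto_integral_sub_comb {ι : Type*} {U : Ultrafilter ι}
    {a : ι → CoeffField d} {Am Ap : ι → Matrix (Fin d) (Fin d) ℝ}
    {s : ι → EReal} {φ : ι → Fin d → Space d → ℝ} {Dφ : ι → Fin d → Space d → Space d}
    {σ : ι → Fin d → Fin d → Fin d → Space d → ℝ}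
    (h : IsCorrectorSequence (U : Filter ι) lam a Am Ap s φ Dφ σ) (hlam : 0 < lam)
    {w : ι → Space d → ℝ} {Dw : ι → Space d → Space d}
    (hw : ∀ R : ℝ, ∀ᶠ n in (U : Filter ι), IsHarmonicOn (a n) (Metric.ball 0 R) (w n) (Dw n))
    {C γ : ℝ} (hγ : γ < d + 2)
    (hgrow : ∀ r : ℝ, 1 ≤ r → ∀ᶠ n in (U : Filter ι),
      ∫ x in Metric.ball 0 r, ‖Dw n x‖ ^ 2 ≤ C * r ^ γ) :
    ∃ ξ : Space d, Tendsto (fun n => ∫ x in Metric.ball 0 1,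
      ‖Dw n x - correctedComb (Am n) (Ap n) (s n) (Dφ n) ξ x‖ ^ 2) U (𝓝 0) := by
  obtain ⟨Am₀, hm, hAm⟩ := exists_tendsto_isBoundedElliptic U hlam
    ((h.corrector 1).mono fun n hn => hn.minus)
  obtain ⟨Ap₀, hp, hAp⟩ := exists_tendsto_isBoundedElliptic U hlam
    ((h.corrector 1).mono fun n hn => hn.plus)
  obtain ⟨s₀, -, hs⟩ := exists_tendsto_of_isCompact U isCompact_univ (x := s) (by simp)
  have hwm : ∀ R : ℝ, ∀ᶠ n in (U : Filter ι), MemLp (Dw n) 2 (volume.restrict (Metric.ball 0 R)) :=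
    fun R => (hw R).mono fun n hn => hn.h1.memLp_grad
  have hbd : ∀ R : ℝ, ∃ K : ℝ, ∀ᶠ n in (U : Filter ι),
      ∫ x in Metric.ball 0 R, ‖Dw n x‖ ^ 2 ≤ K := by
    intro R
    refine ⟨C * (max R 1) ^ γ, ?_⟩
    filter_upwards [hgrow (max R 1) (le_max_right _ _), hwm (max R 1)] with n hn hn'
    exact (setIntegral_mono_set (integrable_norm_sq hn') (Eventually.of_forall fun x => sq_nonneg _)
      (Metric.ball_subset_ball (le_max_left _ _)).eventuallyLE).trans hn
  have hG : ∀ i, ∃ f : Space d → ℝ, ∀ R : ℝ, MemLp f 2 (volume.restrict (Metric.ball 0 R)) ∧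
      TendstoWeakly U (volume.restrict (Metric.ball 0 R)) (fun n x => Dw n x i) f := fun i =>
    exists_tendstoWeakly_ball U (fun R => (hwm R).mono fun n hn => memLp_apply hn i) fun R => by
      obtain ⟨K, hK⟩ := hbd R
      refine ⟨K, ?_⟩
      filter_upwards [hK, hwm R] with n hn hn'
      exact (integral_apply_sq_le hn' i).trans hn
  have hq : ∀ i, ∃ f : Space d → ℝ, ∀ R : ℝ, MemLp f 2 (volume.restrict (Metric.ball 0 R)) ∧
      TendstoWeakly U (volume.restrict (Metric.ball 0 R)) (fun n x => flux (a n) (Dw n) x i) f :=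
    fun i => exists_tendstoWeakly_ball U (fun R => by
      filter_upwards [hwm R, h.corrector R] with n hn hn'
      exact hn'.field.memLp_flux hn i) fun R => by
      obtain ⟨K, hK⟩ := hbd R
      refine ⟨lam⁻¹ ^ 2 * K, ?_⟩
      filter_upwards [hK, hwm R, h.corrector R] with n hn hn' hn''
      exact (hn''.field.integral_flux_sq_le hn' i).trans (by gcongr)
  choose G' hG' using hG
  choose q' hq' using hq
  set G : Space d → Space d := fun x => WithLp.toLp 2 fun i => G' i x
  set q : Space d → Space d := fun x => WithLp.toLp 2 fun i => q' i x
  have hGm : ∀ R : ℝ, MemLp G 2 (volume.restrict (Metric.ball 0 R)) := fun R =>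
    memLp_of_apply fun i => (hG' i R).1
  have hqm : ∀ R : ℝ, MemLp q 2 (volume.restrict (Metric.ball 0 R)) := fun R =>
    memLp_of_apply fun i => (hq' i R).1
  have hGw : ∀ (R : ℝ) i, TendstoWeakly U (volume.restrict (Metric.ball 0 R))
      (fun n x => Dw n x i) fun x => G x i := fun R i => (hG' i R).2
  have hqw : ∀ (R : ℝ) i, TendstoWeakly U (volume.restrict (Metric.ball 0 R))
      (fun n x => flux (a n) (Dw n) x i) fun x => q x i := fun R i => (hq' i R).2
  -- the difference of `w` and a corrected coordinate
  have hz : ∀ (ξ : Space d) (R : ℝ), ∀ᶠ n in (U : Filter ι), ∃ z,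
      IsHarmonicOn (a n) (Metric.ball 0 R) z
        (fun x => Dw n x - correctedComb (Am n) (Ap n) (s n) (Dφ n) ξ x) := by
    intro ξ R
    filter_upwards [hw R, h.corrector R] with n hn hn'
    obtain ⟨p, -, hp⟩ := hn'.exists_harmonic ξ
    have := hn.linear hn'.field hp 1 (-1)
    simp only [one_smul, neg_smul, ← sub_eq_add_neg] at this
    exact ⟨_, this⟩
  have hzC : ∀ (ξ : Space d) (R : ℝ), 1 ≤ R → ∃ K : ℝ, ∀ᶠ n in (U : Filter ι),
      ∫ x in Metric.ball 0 R,
        ‖Dw n x - correctedComb (Am n) (Ap n) (s n) (Dφ n) ξ x‖ ^ 2 ≤ K := by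
    intro ξ R hR
    obtain ⟨K, hK⟩ := hbd R
    obtain ⟨K', hK'⟩ := h.bounded R hR ξ
    refine ⟨2 * K + 2 * K', ?_⟩
    filter_upwards [hK, hK', hwm R, h.corrector R] with n h1 h2 h3 h4
    have h5 := h4.memLp_correctedComb ξ
    calc _ ≤ ∫ x in Metric.ball 0 R, (2 * ‖Dw n x‖ ^ 2
          + 2 * ‖correctedComb (Am n) (Ap n) (s n) (Dφ n) ξ x‖ ^ 2) := by
          refine integral_mono (integrable_norm_sq (h3.sub h5))
            (((integrable_norm_sq h3).const_mul 2).fun_add ((integrable_norm_sq h5).const_mul 2))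
            fun x => ?_
          have := norm_sub_le (Dw n x) (correctedComb (Am n) (Ap n) (s n) (Dφ n) ξ x)
          have h0 := norm_nonneg (Dw n x - correctedComb (Am n) (Ap n) (s n) (Dφ n) ξ x)
          dsimp only [Pi.sub_apply]
          nlinarith [sq_nonneg (‖Dw n x‖ - ‖correctedComb (Am n) (Ap n) (s n) (Dφ n) ξ x‖)]
      _ ≤ _ := by
          rw [integral_add ((integrable_norm_sq h3).const_mul 2)
            ((integrable_norm_sq h5).const_mul 2), integral_const_mul, integral_const_mul]
          linarith
  have hzw : ∀ (ξ : Space d) (R : ℝ), 1 ≤ R → ∀ i,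
      TendstoWeakly U (volume.restrict (Metric.ball 0 R))
        (fun n x => (Dw n x - correctedComb (Am n) (Ap n) (s n) (Dφ n) ξ x) i)
        fun x => (G x - interfaceComb Am₀ Ap₀ s₀ ξ x) i := by
    intro ξ R hR i
    have h1 := ((h.tendstoWeakly_comb hlam hm hp hAm hAp hs hR ξ i).mul_const
      (tendsto_const_nhds (x := (-1 : ℝ))))
    have h2 := (hGw R i).add h1 ((hwm R).mono fun n hn => memLp_apply hn i)
      ((h.corrector R).mono fun n hn => (memLp_apply (hn.memLp_correctedComb ξ) i).const_mul _)
      (memLp_apply (hGm R) i) ?_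
    · simpa only [neg_one_mul, ← sub_eq_add_neg, PiLp.sub_apply] using h2
    · exact (memLp_apply (memLp_interfaceComb hlam hm hp s₀ ξ R) i).const_mul _
  have hE₀ := isBoundedEllipticField_interfaceField hm hp s₀
  have hzq : ∀ (ξ : Space d) (R : ℝ), 1 ≤ R → ∀ i,
      TendstoWeakly U (volume.restrict (Metric.ball 0 R))
        (fun n x => flux (a n)
          (fun y => Dw n y - correctedComb (Am n) (Ap n) (s n) (Dφ n) ξ y) x i)
        fun x => q x i - flux (interfaceField Am₀ Ap₀ s₀) (interfaceComb Am₀ Ap₀ s₀ ξ) x i := by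
    intro ξ R hR i
    have h1 := ((h.tendstoWeakly_flux_comb hlam hm hp hAm hAp hs hR ξ i).mul_const
      (tendsto_const_nhds (x := (-1 : ℝ))))
    have h2 := (hqw R i).add h1
      (by filter_upwards [hwm R, h.corrector R] with n hn hn' using hn'.field.memLp_flux hn i)
      ((h.corrector R).mono fun n hn =>
        (hn.field.memLp_flux (hn.memLp_correctedComb ξ) i).const_mul _)
      (memLp_apply (hqm R) i)
      ((hE₀.memLp_flux (memLp_interfaceComb hlam hm hp s₀ ξ R) i).const_mul _)
    have e : ∀ n x, flux (a n)
        (fun y => Dw n y - correctedComb (Am n) (Ap n) (s n) (Dφ n) ξ y) x i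
        = flux (a n) (Dw n) x i
          + -1 * flux (a n) (correctedComb (Am n) (Ap n) (s n) (Dφ n) ξ) x i := fun n x => by
      have := flux_linear (a n) (Dw n) (correctedComb (Am n) (Ap n) (s n) (Dφ n) ξ) 1 (-1) x i
      simpa only [one_smul, neg_smul, ← sub_eq_add_neg, one_mul] using this
    have e' : ∀ x, q x i - flux (interfaceField Am₀ Ap₀ s₀) (interfaceComb Am₀ Ap₀ s₀ ξ) x i
        = q x i + -1 * flux (interfaceField Am₀ Ap₀ s₀) (interfaceComb Am₀ Ap₀ s₀ ξ) x i :=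
      fun x => by ring
    simp only [e, e']
    exact h2
  -- The div-curl inequality holds for each `ξ` outside a null set; restricting to a dense sequence
  -- leaves a single null set off which Minty's trick applies.
  have hflux : ∀ᵐ x ∂(volume : Measure (Space d)), ∀ i,
      q x i = flux (interfaceField Am₀ Ap₀ s₀) G x i := by
    have h1 : ∀ᵐ x ∂(volume : Measure (Space d)), ∀ n, 0 ≤ ∑ i,
        (q x i - flux (interfaceField Am₀ Ap₀ s₀)
          (interfaceComb Am₀ Ap₀ s₀ (TopologicalSpace.denseSeq (Space d) n)) x i)
        * (G x i - interfaceComb Am₀ Ap₀ s₀ (TopologicalSpace.denseSeq (Space d) n) x i) := by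
      rw [ae_all_iff]
      intro n
      generalize TopologicalSpace.denseSeq (Space d) n = ξ
      refine ae_of_forall_ball fun m => ?_
      have hR : (1 : ℝ) ≤ m + 1 := by simp
      obtain ⟨K, hK⟩ := hzC ξ (m + 1) hR
      obtain ⟨z, hz'⟩ : ∃ z : ι → Space d → ℝ, ∀ᶠ n in (U : Filter ι),
          IsHarmonicOn (a n) (Metric.ball 0 (m + 1)) (z n)
            (fun x => Dw n x - correctedComb (Am n) (Ap n) (s n) (Dφ n) ξ x) :=
        (hz ξ (m + 1)).choice
      have hcm := memLp_interfaceComb hlam hm hp s₀ ξ (m + 1)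
      have h2 := ae_nonneg_of_tendstoWeakly (lam := lam) U (by positivity)
        (Z := fun x => G x - interfaceComb Am₀ Ap₀ s₀ ξ x)
        (Q := fun x => WithLp.toLp 2 fun i => q x i
          - flux (interfaceField Am₀ Ap₀ s₀) (interfaceComb Am₀ Ap₀ s₀ ξ) x i)
        ((h.corrector 1).mono fun n hn => hn.field) hlam.le hz' hK ((hGm _).sub hcm)
        (memLp_of_apply fun i => (memLp_apply (hqm _) i).sub (hE₀.memLp_flux hcm i))
        (hzw ξ _ hR) (hzq ξ _ hR)
      simpa only [PiLp.sub_apply] using h2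
    filter_upwards [h1] with x hx i
    exact eq_flux_of_monotone hlam hm hp hx i
  have hentire : IsEntireHarmonicGrad (interfaceField Am₀ Ap₀ s₀) G := by
    intro R hR
    obtain ⟨K, hK⟩ := hbd R
    obtain ⟨v, hv, -⟩ := exists_strong_limit U hR ((hw R).mono fun n hn => hn.h1) hK (hGm R) (hGw R)
    refine ⟨v, hv, fun ψ hψ => ?_⟩
    have hψm := fun i => (hψ.partialDeriv i).memLp (volume.restrict (Metric.ball (0 : Space d) R)) 2
    have h1 := tendsto_finsetSum Finset.univ fun i _ => hqw R i _ (hψm i)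
    have h2 : ∑ i, ∫ x in Metric.ball 0 R, q x i * partialDeriv i ψ x = 0 := by
      refine tendsto_nhds_unique (h1.congr' ?_) tendsto_const_nhds
      filter_upwards [hw R, h.corrector R] with n hn hn'
      rw [← integral_finsetSum _ fun i _ =>
        (hn'.field.memLp_flux hn.h1.memLp_grad i).integrable_mul_two (hψm i), hn.eqn ψ hψ]
      simp
    rw [← integral_finsetSum _ fun i _ => (memLp_apply (hqm R) i).integrable_mul_two (hψm i)] at h2
    have h3 : ∫ x in Metric.ball 0 R,
        ∑ i, flux (interfaceField Am₀ Ap₀ s₀) G x i * partialDeriv i ψ x = 0 := by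
      rw [← h2]
      refine integral_congr_ae ?_
      filter_upwards [ae_restrict_of_ae hflux] with x hx
      simp only [hx]
    rw [h3]
    simp
  have hgrowth : HasGrowth γ G := by
    -- Weak lower semicontinuity is applied to each component separately, which costs the factor
    -- `d`.
    refine ⟨d * C, fun r hr => ?_⟩
    rw [integral_norm_sq_eq (hGm r)]
    calc ∑ i, ∫ x in Metric.ball 0 r, G x i ^ 2 ≤ ∑ _i : Fin d, C * r ^ γ := by
          refine Finset.sum_le_sum fun i _ => ?_
          refine (hGw r i).integral_sq_le (memLp_apply (hGm r) i)
            ((hwm r).mono fun n hn => memLp_apply hn i) ?_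
          filter_upwards [hgrow r hr, hwm r] with n hn hn'
          exact (integral_apply_sq_le hn' i).trans hn
      _ = d * C * r ^ γ := by simp; ring
  obtain ⟨ξ, hξ⟩ := hentire.liouville hlam hm hp hγ hgrowth
  refine ⟨ξ, ?_⟩
  -- With the Liouville vector `ξ` the difference has weakly null gradient on the ball of radius
  -- two, hence strongly null gradient on the unit ball.
  obtain ⟨K, hK⟩ := hzC ξ (2 * 1) (by norm_num)
  obtain ⟨z, hz'⟩ := (hz ξ (2 * 1)).choice
  refine tendsto_integral_grad_sq_of_weakly_zero U one_pos hlam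
    ((h.corrector 1).mono fun n hn => hn.field) hz' hK fun i => ?_
  refine (hzw ξ (2 * 1) (by norm_num) i).congr_limit ?_
  filter_upwards [ae_restrict_of_ae hξ] with x hx
  rw [hx, sub_self]
  rfl

/-- A harmonic function of subquadratic growth on a large ball is close to a corrected coordinate
on the unit ball, provided the correctors oscillate little. -/
theorem exists_close_correctedComb (d : ℕ) [NeZero d] (hlam : 0 < lam) {ε γ : ℝ} (hε : 0 < ε)
    (C : ℝ) (hγ : γ < d + 2) : ∃ N δ : ℝ, 1 ≤ N ∧ 0 < δ ∧
    ∀ (a : CoeffField d) (Am Ap : Matrix (Fin d) (Fin d) ℝ) (s : EReal)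
      (φ : Fin d → Space d → ℝ) (Dφ : Fin d → Space d → Space d)
      (σ : Fin d → Fin d → Fin d → Space d → ℝ) (w : Space d → ℝ) (Dw : Space d → Space d),
      IsLocalCorrector lam N a Am Ap s φ Dφ σ → (∀ r ∈ Icc 1 N, HasOscLe φ σ r δ) →
      IsHarmonicOn a (Metric.ball 0 N) w Dw →
      (∀ r ∈ Icc 1 N, ∫ x in Metric.ball 0 r, ‖Dw x‖ ^ 2 ≤ C * r ^ γ) →
      ∃ ξ : Space d, ∫ x in Metric.ball 0 1, ‖Dw x - correctedComb Am Ap s Dφ ξ x‖ ^ 2 ≤ ε := by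
  by_contra! h
  -- Counterexamples are chosen with `N = n + 1` and `δ = 1 / (n + 1)`. Along a nonprincipal
  -- ultrafilter every fixed ball is eventually admissible and its oscillation tends to zero.
  have h1 := fun n : ℕ => h (n + 1) (1 / (n + 1)) (by simp) (by positivity)
  choose a Am Ap s φ Dφ σ w Dw hcor hosc hw hgrow hbig using h1
  let U : Ultrafilter ℕ := Filter.hyperfilter ℕ
  have hU : (U : Filter ℕ) ≤ atTop := Nat.hyperfilter_le_atTop
  have hlarge : ∀ R : ℝ, ∀ᶠ n : ℕ in (U : Filter ℕ), R ≤ n + 1 := fun R => hU (by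
    filter_upwards [eventually_ge_atTop ⌈R⌉₊] with n hn
    have := (Nat.le_ceil R).trans (Nat.cast_le.2 hn)
    linarith)
  have hsmall : ∀ R : ℝ, Tendsto (fun n : ℕ => (1 / ((n : ℝ) + 1) * R) ^ 2
      * volume.real (Metric.ball (0 : Space d) R)) U (𝓝 0) := fun R => by
    have := (((tendsto_one_div_add_atTop_nhds_zero_nat (𝕜 := ℝ)).mono_left hU).mul_const R).pow 2
      |>.mul_const (volume.real (Metric.ball (0 : Space d) R))
    simpa using this
  obtain ⟨K, hK, hupper⟩ := exists_correctedComb_upper d hlam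
  have hseq : IsCorrectorSequence (U : Filter ℕ) lam a Am Ap s φ Dφ σ := by
    refine ⟨fun R => ?_, fun R hR k => ?_, fun R hR i j k => ?_, fun R hR ξ => ?_⟩
    · filter_upwards [hlarge R] with n hn using (hcor n).mono hn
    · refine squeeze_zero' (Eventually.of_forall fun n => integral_nonneg fun _ => sq_nonneg _) ?_
        (hsmall R)
      filter_upwards [hlarge R] with n hn using (hosc n R ⟨hR, hn⟩).phi k
    · refine squeeze_zero' (Eventually.of_forall fun n => integral_nonneg fun _ => sq_nonneg _) ?_
        (hsmall R)
      filter_upwards [hlarge R] with n hn using (hosc n R ⟨hR, hn⟩).sigma i j k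
    · refine ⟨K * volume.real (Metric.ball (0 : Space d) (2 * R)) * ‖ξ‖ ^ 2, ?_⟩
      filter_upwards [hlarge (2 * R)] with n hn
      refine hupper (a n) _ _ _ (φ n) (Dφ n) (σ n) R (by linarith) ((hcor n).mono hn) ?_ ξ
      refine (hosc n (2 * R) ⟨by linarith, hn⟩).mono (by positivity) (by linarith) ?_
      rw [div_le_one (by positivity)]
      simp
  obtain ⟨ξ, hξ⟩ := hseq.tendsto_integral_sub_comb hlam
    (fun R => by filter_upwards [hlarge R] with n hn using
      (hw n).mono (Metric.ball_subset_ball hn)) hγ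
    (C := C) (fun r hr => by filter_upwards [hlarge r] with n hn using hgrow n r ⟨hr, hn⟩)
  obtain ⟨n, hn⟩ := (hξ.eventually (gt_mem_nhds hε)).exists
  exact absurd hn (not_lt.2 (hbig n ξ).le)

end Compactness


/-! ### Mean squares on balls -/

section MeanSq

variable {d : ℕ} {x₀ : Space d} {r R : ℝ} {G H : Space d → Space d}

/-- The mean square `⨍_{B(x₀,r)} |G|²`. -/
def meanSq (x₀ : Space d) (r : ℝ) (G : Space d → Space d) : ℝ :=
  ⨍ x in Metric.ball x₀ r, ‖G x‖ ^ 2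

theorem meanSq_eq (x₀ : Space d) (r : ℝ) (G : Space d → Space d) :
    meanSq x₀ r G
      = (volume.real (Metric.ball x₀ r))⁻¹ * ∫ x in Metric.ball x₀ r, ‖G x‖ ^ 2 := by
  rw [meanSq, setAverage_eq, smul_eq_mul]

theorem meanSq_nonneg (x₀ : Space d) (r : ℝ) (G : Space d → Space d) : 0 ≤ meanSq x₀ r G := by
  rw [meanSq_eq]
  exact mul_nonneg (by positivity) (integral_nonneg fun _ => sq_nonneg _)

theorem meanSq_scale (x₀ : Space d) (hr : 0 < r) (R : ℝ) (G : Space d → Space d) :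
    meanSq x₀ (r * R) G = meanSq 0 R fun y => G (x₀ + r • y) :=
  average_scale x₀ hr R fun x => ‖G x‖ ^ 2

theorem memLp_ball_mono (hG : MemLp G 2 (volume.restrict (Metric.ball x₀ R))) (h : r ≤ R) :
    MemLp G 2 (volume.restrict (Metric.ball x₀ r)) :=
  hG.mono_measure (Measure.restrict_mono (Metric.ball_subset_ball h) le_rfl)

/-- Integrals increase with the ball, so the averages lose only the ratio of volumes. This settles
comparisons between comparable radii. -/
theorem meanSq_le (hr : 0 < r) (hrR : r ≤ R)
    (hG : MemLp G 2 (volume.restrict (Metric.ball x₀ R))) :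
    meanSq x₀ r G ≤ (R / r) ^ d * meanSq x₀ R G := by
  have hR : 0 < R := hr.trans_le hrR
  have hV := volume_real_ball_pos (0 : Space d) one_pos
  rw [meanSq_eq, meanSq_eq, volume_real_ball_eq x₀ hr, volume_real_ball_eq x₀ hR]
  have h1 : ∫ x in Metric.ball x₀ r, ‖G x‖ ^ 2 ≤ ∫ x in Metric.ball x₀ R, ‖G x‖ ^ 2 :=
    setIntegral_mono_set (integrable_norm_sq hG) (Eventually.of_forall fun x => sq_nonneg _)
      (Metric.ball_subset_ball hrR).eventuallyLE
  calc _ ≤ (r ^ d * volume.real (Metric.ball (0 : Space d) 1))⁻¹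
        * ∫ x in Metric.ball x₀ R, ‖G x‖ ^ 2 := by gcongr
    _ = _ := by rw [div_pow]; field_simp

theorem meanSq_sub_le (hG : MemLp G 2 (volume.restrict (Metric.ball x₀ r)))
    (hH : MemLp H 2 (volume.restrict (Metric.ball x₀ r))) :
    meanSq x₀ r (fun x => G x - H x) ≤ 2 * meanSq x₀ r G + 2 * meanSq x₀ r H := by
  have h1 : ∫ x in Metric.ball x₀ r, ‖G x - H x‖ ^ 2
      ≤ ∫ x in Metric.ball x₀ r, (2 * ‖G x‖ ^ 2 + 2 * ‖H x‖ ^ 2) := by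
    refine integral_mono (integrable_norm_sq (hG.sub hH))
      (((integrable_norm_sq hG).const_mul 2).fun_add ((integrable_norm_sq hH).const_mul 2))
      fun x => ?_
    have := norm_sub_le (G x) (H x)
    have h0 := norm_nonneg (G x - H x)
    dsimp only [Pi.sub_apply]
    nlinarith [sq_nonneg (‖G x‖ - ‖H x‖)]
  rw [integral_add ((integrable_norm_sq hG).const_mul 2) ((integrable_norm_sq hH).const_mul 2),
    integral_const_mul, integral_const_mul] at h1
  rw [meanSq_eq, meanSq_eq, meanSq_eq]
  have h2 := mul_le_mul_of_nonneg_left h1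
    (inv_nonneg.2 (measureReal_nonneg : 0 ≤ volume.real (Metric.ball x₀ r)))
  linarith

theorem rpow_two_mul_le {α t : ℝ} (hα : α < 1) (ht : 0 ≤ t) :
    (2 * t) ^ (2 * α) ≤ 4 * t ^ (2 * α) := by
  rw [Real.mul_rpow (by norm_num) ht]
  gcongr
  calc (2 : ℝ) ^ (2 * α) ≤ 2 ^ (2 : ℝ) :=
        Real.rpow_le_rpow_of_exponent_le (by norm_num) (by linarith)
    _ = 4 := by norm_num

theorem sq_rpow {t : ℝ} (ht : 0 ≤ t) (α : ℝ) : (t ^ α) ^ 2 = t ^ (2 * α) := by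
  rw [← Real.rpow_natCast, ← Real.rpow_mul ht]; congr 1; push_cast; ring

/-- Approximations of `Du` at dyadic scales by a nondegenerate linear family `F` do not drift. -/
theorem norm_sub_le_of_dyadic {F : Space d → Space d → Space d} {Du : Space d → Space d}
    {α C K ρ T : ℝ} (hα : 0 < α) (hα1 : α < 1) (hρ : 0 < ρ) (hC : 0 ≤ C)
    (hF : ∀ ξ η x, F (ξ - η) x = F ξ x - F η x)
    (hFm : ∀ ξ, MemLp (F ξ) 2 (volume.restrict (Metric.ball x₀ T)))
    (hlow : ∀ t ∈ Icc ρ T, ∀ ξ, ‖ξ‖ ^ 2 ≤ C * meanSq x₀ t (F ξ))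
    (hDu : MemLp Du 2 (volume.restrict (Metric.ball x₀ T))) {ξ : ℝ → Space d}
    (hξ : ∀ t ∈ Icc ρ T, meanSq x₀ t (fun x => Du x - F (ξ t) x) ≤ K * t ^ (2 * α)) (j : ℕ)
    (hj : 2 ^ j * ρ ≤ T) :
    ‖ξ (2 ^ j * ρ) - ξ ρ‖
      ≤ √(C * (2 + 8 * 2 ^ d)) / (2 ^ α - 1) * √K * (2 ^ j * ρ) ^ α := by
  have h2α : (1 : ℝ) < 2 ^ α := Real.one_lt_rpow (by norm_num) hα
  set A := √(C * (2 + 8 * 2 ^ d)) with hA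
  set B := A / (2 ^ α - 1) * √K with hB
  have hB0 : 0 ≤ B := mul_nonneg (div_nonneg (Real.sqrt_nonneg _) (by linarith)) (Real.sqrt_nonneg _)
  -- `B` sums the geometric series of ratio `2 ^ α` formed by the dyadic increments; this identity
  -- closes the induction.
  have hAB : B + A * √K = B * 2 ^ α := by
    have : (2 : ℝ) ^ α - 1 ≠ 0 := by linarith
    rw [hB]; field_simp; ring
  -- Both vectors approximate `Du` on the ball of radius `t`, so non-degeneracy bounds their
  -- difference. In `2 + 8 * 2 ^ d` the factor `2 ^ d` comes from halving the ball and `8 = 2 * 4`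
  -- from `(2t)^(2α) ≤ 4 t^(2α)`.
  have step : ∀ t, ρ ≤ t → 2 * t ≤ T → ‖ξ (2 * t) - ξ t‖ ≤ A * √K * t ^ α := by
    intro t ht htT
    have ht0 : 0 < t := hρ.trans_le ht
    have m1 : t ∈ Icc ρ T := ⟨ht, by linarith⟩
    have m2 : 2 * t ∈ Icc ρ T := ⟨by linarith, htT⟩
    have hd1 := hDu.sub (hFm (ξ t))
    have hd2 := hDu.sub (hFm (ξ (2 * t)))
    have hK0 : 0 ≤ K := by
      have := (meanSq_nonneg x₀ t _).trans (hξ t m1)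
      exact nonneg_of_mul_nonneg_left this (by positivity)
    have e : F (ξ (2 * t) - ξ t)
        = fun x => (Du x - F (ξ t) x) - (Du x - F (ξ (2 * t)) x) := by
      ext1 x; rw [hF]; abel
    have h1 := meanSq_sub_le (memLp_ball_mono hd1 m1.2) (memLp_ball_mono hd2 m1.2)
    have h2 := meanSq_le ht0 (by linarith : t ≤ 2 * t) (memLp_ball_mono hd2 m2.2)
    rw [mul_div_cancel_right₀ _ ht0.ne'] at h2
    have h3 := hξ t m1
    have h4 := hξ (2 * t) m2
    have h5 := rpow_two_mul_le hα1 ht0.le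
    have h6 : meanSq x₀ t (F (ξ (2 * t) - ξ t)) ≤ (2 + 8 * 2 ^ d) * (K * t ^ (2 * α)) := by
      rw [e]
      have h7 : (2 : ℝ) ^ d * meanSq x₀ (2 * t) (fun x => Du x - F (ξ (2 * t)) x)
          ≤ 2 ^ d * (K * (4 * t ^ (2 * α))) := by
        gcongr
        exact h4.trans (by gcongr)
      simp only [Pi.sub_def] at h1 h2
      linarith
    have h8 : ‖ξ (2 * t) - ξ t‖ ^ 2 ≤ (A * √K * t ^ α) ^ 2 := by
      refine (hlow t m1 _).trans ?_
      rw [mul_pow, mul_pow, sq_rpow ht0.le, hA, Real.sq_sqrt (by positivity), Real.sq_sqrt hK0]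
      calc _ ≤ C * ((2 + 8 * 2 ^ d) * (K * t ^ (2 * α))) := by gcongr
        _ = _ := by ring
    exact le_of_sq_le_sq h8 (by positivity)
  induction j with
  | zero => simp; positivity
  | succ j ih =>
    have e : (2 : ℝ) ^ (j + 1) * ρ = 2 * (2 ^ j * ρ) := by ring
    rw [e] at hj ⊢
    have ht0 : 0 < 2 ^ j * ρ := by positivity
    have h1 := ih (by linarith)
    have h2 := step (2 ^ j * ρ) (by nlinarith [one_le_pow₀ (M₀ := ℝ) one_le_two (n := j)]) hj
    calc ‖ξ (2 * (2 ^ j * ρ)) - ξ ρ‖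
        ≤ ‖ξ (2 * (2 ^ j * ρ)) - ξ (2 ^ j * ρ)‖ + ‖ξ (2 ^ j * ρ) - ξ ρ‖ :=
          norm_sub_le_norm_sub_add_norm_sub _ _ _
      _ ≤ A * √K * (2 ^ j * ρ) ^ α + B * (2 ^ j * ρ) ^ α := add_le_add h2 h1
      _ = (B + A * √K) * (2 ^ j * ρ) ^ α := by ring
      _ = B * (2 * (2 ^ j * ρ)) ^ α := by
        rw [hAB, Real.mul_rpow (by norm_num) ht0.le]; ring

end MeanSq

/-! ### Correctors at all scales between two radii -/

section SmallCorrector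

variable {d : ℕ} [NeZero d] {lam : ℝ}

/-- A corrector with relative oscillation at most `δ` on the balls `B(x₀, r)`, `r₁ ≤ r ≤ r₂`. -/
structure HasSmallCorrector (lam : ℝ) (a : CoeffField d) (Am Ap : Matrix (Fin d) (Fin d) ℝ)
    (φ : Fin d → Space d → ℝ) (Dφ : Fin d → Space d → Space d)
    (σ : Fin d → Fin d → Fin d → Space d → ℝ) (x₀ : Space d) (r₁ r₂ δ : ℝ) : Prop where
  field : IsEllipticField lam a
  minus : IsEllipticMatrix lam Am
  plus : IsEllipticMatrix lam Ap
  corrector : IsUngaugedCorrector a Am Ap φ Dφ σ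
  pos : 0 < r₁
  osc : ∀ r ∈ Icc r₁ r₂, correctorOsc φ σ x₀ r ≤ δ

variable {a : CoeffField d} {Am Ap : Matrix (Fin d) (Fin d) ℝ} {φ : Fin d → Space d → ℝ}
  {Dφ : Fin d → Space d → Space d} {σ : Fin d → Fin d → Fin d → Space d → ℝ} {x₀ : Space d}
  {r₁ r₂ δ : ℝ}

theorem HasSmallCorrector.mono (h : HasSmallCorrector lam a Am Ap φ Dφ σ x₀ r₁ r₂ δ) {δ' : ℝ}
    (hδ : δ ≤ δ') : HasSmallCorrector lam a Am Ap φ Dφ σ x₀ r₁ r₂ δ' :=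
  { h with osc := fun r hr => (h.osc r hr).trans hδ }

theorem HasSmallCorrector.hasOscLe (h : HasSmallCorrector lam a Am Ap φ Dφ σ x₀ r₁ r₂ δ)
    {ρ r : ℝ} (hρ : 0 < ρ) (hr : ρ * r ∈ Icc r₁ r₂) :
    HasOscLe (fun k y => ρ⁻¹ * φ k (x₀ + ρ • y)) (fun i j k y => ρ⁻¹ * σ i j k (x₀ + ρ • y))
      r δ :=
  hasOscLe_of_correctorOsc_le hρ h.corrector.phi_h1 h.corrector.sigma_l2
    (pos_of_mul_pos_right (h.pos.trans_le hr.1) hρ.le) (h.osc _ hr)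

theorem HasSmallCorrector.isLocalCorrector (h : HasSmallCorrector lam a Am Ap φ Dφ σ x₀ r₁ r₂ δ)
    (hlam : 0 < lam) {ρ : ℝ} (hρ : 0 < ρ) (N : ℝ) :
    IsLocalCorrector lam N (fun y => a (x₀ + ρ • y)) Am Ap ((-(x₀ 0) / ρ : ℝ) : EReal)
      (fun k y => ρ⁻¹ * φ k (x₀ + ρ • y)) (fun k y => Dφ k (x₀ + ρ • y))
      (fun i j k y => ρ⁻¹ * σ i j k (x₀ + ρ • y)) :=
  h.corrector.isLocalCorrector hlam hρ h.field h.minus h.plus x₀ N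

theorem correctedGrad_sub (Am Ap : Matrix (Fin d) (Fin d) ℝ) (Dφ : Fin d → Space d → Space d)
    (ξ η x : Space d) :
    correctedGrad Am Ap Dφ (ξ - η) x
      = correctedGrad Am Ap Dφ ξ x - correctedGrad Am Ap Dφ η x := by
  simp only [correctedGrad, PiLp.sub_apply, sub_smul, Finset.sum_sub_distrib]

theorem correctedGrad_add_smul (Am Ap : Matrix (Fin d) (Fin d) ℝ)
    (Dφ : Fin d → Space d → Space d) (ξ η : Space d) (c : ℝ) (x : Space d) :
    correctedGrad Am Ap Dφ (ξ + c • η) x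
      = correctedGrad Am Ap Dφ ξ x + c • correctedGrad Am Ap Dφ η x := by
  simp only [correctedGrad, PiLp.add_apply, PiLp.smul_apply, smul_eq_mul, add_smul, mul_smul,
    Finset.sum_add_distrib, Finset.smul_sum]

theorem HasSmallCorrector.memLp_correctedGrad
    (h : HasSmallCorrector lam a Am Ap φ Dφ σ x₀ r₁ r₂ δ) (hlam : 0 < lam) (ξ : Space d) (r : ℝ) :
    MemLp (correctedGrad Am Ap Dφ ξ) 2 (volume.restrict (Metric.ball x₀ r)) := by
  have hk : ∀ k, MemLp (fun x => gradHarmonicCoord Am Ap k x + Dφ k x) 2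
      (volume.restrict (Metric.ball x₀ r)) := fun k =>
    ((isH1On_harmonicCoord hlam (h.minus.isBoundedElliptic hlam)
      (h.plus.isBoundedElliptic hlam) k _).mono (ball_subset_ball_zero x₀ r)).memLp_grad.add
      ((h.corrector.phi_h1 k).isH1On_ball x₀ r).memLp_grad
  exact memLp_finsetSum _ fun k _ => (hk k).const_smul (ξ k)

/-- The unit-scale Caccioppoli bound, rescaled. It uses the corrector on the doubled ball, which
explains the restriction `2 * r ≤ r₂`; the factor `2 ^ d` is the ratio of the two volumes. -/
theorem exists_meanSq_correctedGrad_le (d : ℕ) [NeZero d] (hlam : 0 < lam) : ∃ C : ℝ, 0 < C ∧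
    ∀ (a : CoeffField d) (Am Ap : Matrix (Fin d) (Fin d) ℝ) (φ : Fin d → Space d → ℝ)
      (Dφ : Fin d → Space d → Space d) (σ : Fin d → Fin d → Fin d → Space d → ℝ) (x₀ : Space d)
      (r₁ r₂ : ℝ), HasSmallCorrector lam a Am Ap φ Dφ σ x₀ r₁ r₂ 1 →
      ∀ r, r₁ ≤ r → 2 * r ≤ r₂ → ∀ ξ,
        meanSq x₀ r (correctedGrad Am Ap Dφ ξ) ≤ C * ‖ξ‖ ^ 2 := by
  obtain ⟨C, hC, h⟩ := exists_correctedComb_upper d hlam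
  refine ⟨C * 2 ^ d, by positivity, fun a Am Ap φ Dφ σ x₀ r₁ r₂ hc r hr hr' ξ => ?_⟩
  have hr0 : 0 < r := hc.pos.trans_le hr
  have hV := volume_real_ball_pos (0 : Space d) one_pos
  have h1 := h _ Am Ap _ _ _ _ 1 one_pos (hc.isLocalCorrector hlam hr0 (2 * 1))
    (hc.hasOscLe hr0 ⟨by linarith, by linarith⟩) ξ
  rw [← mul_one r, meanSq_scale x₀ hr0, meanSq_eq, inv_mul_le_iff₀ hV]
  simp only [correctedGrad_scale hr0]
  refine h1.trans_eq ?_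
  rw [mul_one, volume_real_ball_eq 0 two_pos]
  ring

theorem exists_le_meanSq_correctedGrad (d : ℕ) [NeZero d] (hlam : 0 < lam) : ∃ C δ : ℝ, 0 < C ∧
    0 < δ ∧ ∀ (a : CoeffField d) (Am Ap : Matrix (Fin d) (Fin d) ℝ) (φ : Fin d → Space d → ℝ)
      (Dφ : Fin d → Space d → Space d) (σ : Fin d → Fin d → Fin d → Space d → ℝ) (x₀ : Space d)
      (r₁ r₂ : ℝ), HasSmallCorrector lam a Am Ap φ Dφ σ x₀ r₁ r₂ δ →
      ∀ r ∈ Icc r₁ r₂, ∀ ξ, ‖ξ‖ ^ 2 ≤ C * meanSq x₀ r (correctedGrad Am Ap Dφ ξ) := by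
  obtain ⟨C, δ, hC, hδ, h⟩ := exists_correctedComb_lower d hlam
  have hV := volume_real_ball_pos (0 : Space d) one_pos
  refine ⟨C * volume.real (Metric.ball (0 : Space d) 1), δ, by positivity, hδ,
    fun a Am Ap φ Dφ σ x₀ r₁ r₂ hc r hr ξ => ?_⟩
  have hr0 : 0 < r := hc.pos.trans_le hr.1
  have h1 := h _ Am Ap _ _ _ _ (hc.isLocalCorrector hlam hr0 1)
    (hc.hasOscLe hr0 (by rwa [mul_one])) ξ
  rw [← mul_one r, meanSq_scale x₀ hr0, meanSq_eq]
  simp only [correctedGrad_scale hr0]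
  refine h1.trans_eq ?_
  field_simp

/-- One-step improvement: a solution close to a corrected affine function, with subquadratic
growth of the error up to scale `Nρ`, is much closer to another one at scale `ρ`. -/
theorem exists_meanSq_sub_le (d : ℕ) [NeZero d] (hlam : 0 < lam) {α : ℝ} (hα : α < 1) (C : ℝ) :
    ∃ N δ : ℝ, 1 ≤ N ∧ 0 < δ ∧
    ∀ (a : CoeffField d) (Am Ap : Matrix (Fin d) (Fin d) ℝ) (φ : Fin d → Space d → ℝ)
      (Dφ : Fin d → Space d → Space d) (σ : Fin d → Fin d → Fin d → Space d → ℝ) (x₀ : Space d)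
      (r₁ r₂ : ℝ), HasSmallCorrector lam a Am Ap φ Dφ σ x₀ r₁ r₂ δ →
      ∀ (ρ M : ℝ), r₁ ≤ ρ → ρ * N ≤ r₂ → 0 < M → ∀ (u : Space d → ℝ) (Du : Space d → Space d),
      IsHarmonicOn a (Metric.ball x₀ (ρ * N)) u Du → ∀ ξ₀ : Space d,
      (∀ r ∈ Icc ρ (ρ * N), meanSq x₀ r (fun x => Du x - correctedGrad Am Ap Dφ ξ₀ x)
        ≤ C * M * (r / ρ) ^ (2 * α)) →
      ∃ ξ, meanSq x₀ ρ (fun x => Du x - correctedGrad Am Ap Dφ ξ x) ≤ M / 4 := by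
  have hV := volume_real_ball_pos (0 : Space d) one_pos
  set V := volume.real (Metric.ball (0 : Space d) 1) with hVdef
  -- The error is rescaled to the unit ball and divided by `√M`, so `ε = V / 4` becomes a mean
  -- square `M / 4`. The exponent is `d + 2α` because integrals replace averages, and it is below `d
  -- + 2` since `α < 1`.
  obtain ⟨N, δ, hN, hδ, h⟩ := exists_close_correctedComb d hlam (ε := V / 4) (γ := d + 2 * α)
    (by positivity) (V * C) (by linarith)
  refine ⟨N, δ, hN, hδ, fun a Am Ap φ Dφ σ x₀ r₁ r₂ hc ρ M hρ hρN hM u Du hu ξ₀ hgrow => ?_⟩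
  have hρ0 : 0 < ρ := hc.pos.trans_le hρ
  have hloc := hc.isLocalCorrector hlam hρ0 N
  obtain ⟨p, -, hp⟩ := hloc.exists_harmonic ξ₀
  set c : ℝ := (√M)⁻¹ with hcdef
  have hsM : 0 < √M := Real.sqrt_pos.2 hM
  have hc2 : c ^ 2 * M = 1 := by
    rw [hcdef, inv_pow, Real.sq_sqrt hM.le, inv_mul_cancel₀ hM.ne']
  have hw := (hu.scale hρ0).linear hloc.field hp c (-c)
  have e0 : ∀ y, c • Du (x₀ + ρ • y) + -c • correctedComb Am Ap ((-(x₀ 0) / ρ : ℝ) : EReal)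
      (fun k y => Dφ k (x₀ + ρ • y)) ξ₀ y
      = c • (Du (x₀ + ρ • y) - correctedGrad Am Ap Dφ ξ₀ (x₀ + ρ • y)) := fun y => by
    rw [correctedGrad_scale hρ0, smul_sub, neg_smul, sub_eq_add_neg]
  simp only [e0] at hw
  obtain ⟨ξ, hξ⟩ := h _ Am Ap _ _ _ _ _ _ hloc (fun r hr => hc.hasOscLe hρ0
    ⟨by nlinarith [hr.1], (mul_le_mul_of_nonneg_left hr.2 hρ0.le).trans hρN⟩) hw
    (fun r hr => by
      have hr0 : 0 < r := by linarith [hr.1]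
      have h1 := hgrow (ρ * r) ⟨by nlinarith [hr.1], mul_le_mul_of_nonneg_left hr.2 hρ0.le⟩
      rw [meanSq_scale x₀ hρ0, meanSq_eq, volume_real_ball_eq 0 hr0,
        inv_mul_le_iff₀ (by positivity), mul_div_cancel_left₀ _ hρ0.ne'] at h1
      simp only [norm_smul, mul_pow, Real.norm_eq_abs, sq_abs, integral_const_mul]
      calc _ ≤ c ^ 2 * (r ^ d * V * (C * M * r ^ (2 * α))) := by gcongr
        _ = (c ^ 2 * M) * (V * C * (r ^ d * r ^ (2 * α))) := by ring
        _ = V * C * r ^ (d + 2 * α) := by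
          rw [hc2, one_mul, Real.rpow_add hr0, Real.rpow_natCast])
  refine ⟨ξ₀ + √M • ξ, ?_⟩
  rw [← mul_one ρ, meanSq_scale x₀ hρ0, meanSq_eq, inv_mul_le_iff₀ hV]
  have e1 : ∀ y, ‖Du (x₀ + ρ • y) - correctedGrad Am Ap Dφ (ξ₀ + √M • ξ) (x₀ + ρ • y)‖ ^ 2
      = M * ‖c • (Du (x₀ + ρ • y) - correctedGrad Am Ap Dφ ξ₀ (x₀ + ρ • y))
        - correctedComb Am Ap ((-(x₀ 0) / ρ : ℝ) : EReal) (fun k y => Dφ k (x₀ + ρ • y)) ξ y‖ ^ 2 := by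
    intro y
    rw [correctedGrad_add_smul, ← correctedGrad_scale hρ0]
    have e2 : Du (x₀ + ρ • y) - (correctedGrad Am Ap Dφ ξ₀ (x₀ + ρ • y)
        + √M • correctedGrad Am Ap Dφ ξ (x₀ + ρ • y))
        = √M • (c • (Du (x₀ + ρ • y) - correctedGrad Am Ap Dφ ξ₀ (x₀ + ρ • y))
          - correctedGrad Am Ap Dφ ξ (x₀ + ρ • y)) := by
      rw [smul_sub, smul_smul, hcdef, mul_inv_cancel₀ hsM.ne', one_smul]
      abel
    rw [e2, norm_smul, mul_pow, Real.norm_eq_abs, sq_abs, Real.sq_sqrt hM.le]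
  simp only [e1]
  rw [integral_const_mul]
  calc _ ≤ M * (V / 4) := by gcongr
    _ = _ := by ring

end SmallCorrector


/-! ### Excess decay and large-scale Lipschitz estimate -/

section Regularity

variable {d : ℕ} [NeZero d] {lam : ℝ}
  {a : CoeffField d} {Am Ap : Matrix (Fin d) (Fin d) ℝ} {φ : Fin d → Space d → ℝ}
  {Dφ : Fin d → Space d → Space d} {σ : Fin d → Fin d → Fin d → Space d → ℝ} {x₀ : Space d}
  {r₁ r₂ δ : ℝ}

theorem bddBelow_meanSq (Am Ap : Matrix (Fin d) (Fin d) ℝ) (Dφ : Fin d → Space d → Space d)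
    (Du : Space d → Space d) (x₀ : Space d) (r : ℝ) :
    BddBelow (range fun ξ => meanSq x₀ r fun x => Du x - correctedGrad Am Ap Dφ ξ x) :=
  ⟨0, by rintro _ ⟨ξ, rfl⟩; exact meanSq_nonneg _ _ _⟩

theorem excess_le (Am Ap : Matrix (Fin d) (Fin d) ℝ) (Dφ : Fin d → Space d → Space d)
    (Du : Space d → Space d) (x₀ : Space d) (r : ℝ) (ξ : Space d) :
    excess Am Ap Dφ Du x₀ r ≤ meanSq x₀ r fun x => Du x - correctedGrad Am Ap Dφ ξ x :=
  ciInf_le (bddBelow_meanSq Am Ap Dφ Du x₀ r) ξ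

theorem excess_nonneg (Am Ap : Matrix (Fin d) (Fin d) ℝ) (Dφ : Fin d → Space d → Space d)
    (Du : Space d → Space d) (x₀ : Space d) (r : ℝ) : 0 ≤ excess Am Ap Dφ Du x₀ r :=
  le_ciInf fun _ => meanSq_nonneg _ _ _

theorem exists_meanSq_lt_of_excess_lt {Du : Space d → Space d} {r c : ℝ}
    (h : excess Am Ap Dφ Du x₀ r < c) :
    ∃ ξ, meanSq x₀ r (fun x => Du x - correctedGrad Am Ap Dφ ξ x) < c :=
  exists_lt_of_ciInf_lt h

theorem excess_le_meanSq (Am Ap : Matrix (Fin d) (Fin d) ℝ) (Dφ : Fin d → Space d → Space d)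
    (Du : Space d → Space d) (x₀ : Space d) (r : ℝ) :
    excess Am Ap Dφ Du x₀ r ≤ meanSq x₀ r Du := by
  simpa [correctedGrad] using excess_le Am Ap Dφ Du x₀ r 0

/-- The volume comparison holds for each competitor `ξ` with the same constant, hence for the
infimum. -/
theorem HasSmallCorrector.excess_mono (h : HasSmallCorrector lam a Am Ap φ Dφ σ x₀ r₁ r₂ δ)
    (hlam : 0 < lam) {r R : ℝ} (hr : 0 < r) (hrR : r ≤ R) {Du : Space d → Space d}
    (hDu : MemLp Du 2 (volume.restrict (Metric.ball x₀ R))) :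
    excess Am Ap Dφ Du x₀ r ≤ (R / r) ^ d * excess Am Ap Dφ Du x₀ R := by
  have hR : 0 < R := hr.trans_le hrR
  rw [← div_le_iff₀' (by positivity)]
  refine le_ciInf fun ξ => ?_
  rw [div_le_iff₀' (by positivity)]
  exact (excess_le Am Ap Dφ Du x₀ r ξ).trans
    (meanSq_le hr hrR (hDu.sub (h.memLp_correctedGrad hlam ξ R)))

theorem exists_dyadic {r ρ : ℝ} (hρ : 0 < ρ) (h : ρ ≤ r) :
    ∃ j : ℕ, 2 ^ j * ρ ≤ r ∧ r < 2 * (2 ^ j * ρ) := by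
  obtain ⟨j, h1, h2⟩ := exists_nat_pow_near ((one_le_div hρ).2 h) one_lt_two
  rw [le_div_iff₀ hρ] at h1
  rw [div_lt_iff₀ hρ, pow_succ] at h2
  exact ⟨j, h1, by linarith⟩

/-- If the excess at scale `ρ` nearly dominates the excess at all larger scales, with respect to the
rate `r ^ (2 α)`, then `ρ` is comparable to the largest scale. -/
theorem exists_scale_bound (d : ℕ) [NeZero d] (hlam : 0 < lam) {α : ℝ} (hα : 0 < α) (hα1 : α < 1) :
    ∃ N δ : ℝ, 1 ≤ N ∧ 0 < δ ∧
    ∀ (a : CoeffField d) (Am Ap : Matrix (Fin d) (Fin d) ℝ) (φ : Fin d → Space d → ℝ)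
      (Dφ : Fin d → Space d → Space d) (σ : Fin d → Fin d → Fin d → Space d → ℝ) (x₀ : Space d)
      (r₁ r₂ : ℝ), HasSmallCorrector lam a Am Ap φ Dφ σ x₀ r₁ r₂ δ →
      ∀ (ρ R : ℝ), r₁ ≤ ρ → R ≤ r₂ → ∀ (u : Space d → ℝ) (Du : Space d → Space d),
      IsHarmonicOn a (Metric.ball x₀ R) u Du → 0 < excess Am Ap Dφ Du x₀ ρ →
      (∀ r ∈ Icc ρ R, excess Am Ap Dφ Du x₀ r
        ≤ 2 * (r / ρ) ^ (2 * α) * excess Am Ap Dφ Du x₀ ρ) → R < 4 * N * ρ := by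
  obtain ⟨C₁, hC₁, hupper⟩ := exists_meanSq_correctedGrad_le d hlam
  obtain ⟨C₂, δ₂, hC₂, hδ₂, hlower⟩ := exists_le_meanSq_correctedGrad d hlam
  set C₃ := √(C₂ * (2 + 8 * 2 ^ d)) / (2 ^ α - 1) with hC₃
  -- The constant anticipates the growth bound below: `2 ^ d` from rounding radii up to dyadic ones,
  -- `2 + 2 C₁ C₃²` from changing `ξ` from one scale to another, and `12 = 3 * 4` from
  -- near-minimality and from doubling the radius.
  obtain ⟨N, δ₃, hN, hδ₃, hkey⟩ := exists_meanSq_sub_le d hlam hα1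
    (2 ^ d * (2 + 2 * C₁ * C₃ ^ 2) * 12)
  refine ⟨N, min 1 (min δ₂ δ₃), hN, by positivity, ?_⟩
  intro a Am Ap φ Dφ σ x₀ r₁ r₂ hc ρ R hρ hR u Du hu hE hmax
  by_contra! hcon
  have hc1 := hc.mono (min_le_left _ _)
  have hc2 := hc.mono ((min_le_right _ _).trans (min_le_left _ _))
  have hc3 := hc.mono ((min_le_right _ _).trans (min_le_right _ _))
  have hρ0 : 0 < ρ := hc.pos.trans_le hρ
  set E := excess Am Ap Dφ Du x₀ ρ with hEdef
  have hNρ : ρ ≤ N * ρ := by nlinarith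
  have hFm := fun ξ r => hc.memLp_correctedGrad hlam ξ r
  have hDum := hu.h1.memLp_grad
  -- Radii up to `N ρ` are rounded up to dyadic radii at most `T`, and the upper bound on corrected
  -- gradients needs twice that radius; hence the assumption `4 N ρ ≤ R`.
  set T := 2 * (N * ρ) with hT
  have hTR : 2 * T ≤ R := by linarith
  have hξ : ∀ t ∈ Icc ρ T, ∃ ξ, meanSq x₀ t (fun x => Du x - correctedGrad Am Ap Dφ ξ x)
      ≤ (3 * E / ρ ^ (2 * α)) * t ^ (2 * α) := by
    intro t ht
    have h1 : (1 : ℝ) ≤ (t / ρ) ^ (2 * α) :=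
      Real.one_le_rpow ((one_le_div hρ0).2 ht.1) (by linarith)
    have h2 := hmax t ⟨ht.1, by linarith [ht.2]⟩
    -- Replacing `2` by `3` makes the inequality strict, so some `ξ` achieves it although the
    -- infimum need not be attained.
    have h3 : excess Am Ap Dφ Du x₀ t < 3 * E / ρ ^ (2 * α) * t ^ (2 * α) := by
      have e : 3 * E / ρ ^ (2 * α) * t ^ (2 * α) = 3 * (t / ρ) ^ (2 * α) * E := by
        rw [Real.div_rpow (by linarith [ht.1]) hρ0.le]; ring
      rw [e]
      nlinarith
    obtain ⟨ξ, hξ⟩ := exists_meanSq_lt_of_excess_lt h3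
    exact ⟨ξ, hξ.le⟩
  choose! ξ hξ using hξ
  set K := 3 * E / ρ ^ (2 * α) with hK
  have hK0 : 0 ≤ K := by positivity
  have hdy := norm_sub_le_of_dyadic hα hα1 hρ0 hC₂.le (correctedGrad_sub Am Ap Dφ)
    (fun ξ => hFm ξ T) (fun t ht => hlower a Am Ap φ Dφ σ x₀ r₁ r₂ hc2 t
      ⟨hρ.trans ht.1, by linarith [ht.2]⟩) (memLp_ball_mono hDum (by linarith)) hξ
  obtain ⟨η, hη⟩ := hkey a Am Ap φ Dφ σ x₀ r₁ r₂ hc3 ρ E hρ (by linarith) hE u Du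
    (hu.mono (Metric.ball_subset_ball (by linarith))) (ξ ρ) (by
      intro r hr
      have hr0 : 0 < r := hρ0.trans_le hr.1
      obtain ⟨j, hj1, hj2⟩ := exists_dyadic hρ0 hr.1
      have e2 : 2 * (2 ^ j * ρ) = 2 ^ (j + 1) * ρ := by ring
      rw [e2] at hj2
      set t := 2 ^ (j + 1) * ρ with ht
      have ht2 : t ≤ 2 * r := by linarith
      have htT : t ≤ T := by linarith [hr.2]
      have ht0 : 0 < t := by positivity
      have hdyt := hdy (j + 1) htT
      rw [← ht] at hdyt
      have h1 := hξ t ⟨by linarith [hr.1], htT⟩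
      have h2 := hupper a Am Ap φ Dφ σ x₀ r₁ r₂ hc1 t (by linarith [hr.1]) (by linarith)
        (ξ ρ - ξ t)
      have h3 : ‖ξ ρ - ξ t‖ ^ 2 ≤ C₃ ^ 2 * (K * t ^ (2 * α)) := by
        rw [norm_sub_rev]
        calc ‖ξ t - ξ ρ‖ ^ 2 ≤ (C₃ * √K * t ^ α) ^ 2 := by gcongr
          _ = _ := by rw [mul_pow, mul_pow, Real.sq_sqrt hK0, sq_rpow ht0.le]; ring
      have e : (fun x => Du x - correctedGrad Am Ap Dφ (ξ ρ) x)
          = fun x => (Du x - correctedGrad Am Ap Dφ (ξ t) x)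
            - correctedGrad Am Ap Dφ (ξ ρ - ξ t) x := by
        ext1 x; rw [correctedGrad_sub]; abel
      have hDut := memLp_ball_mono hDum (by linarith : t ≤ R)
      have h4 := meanSq_sub_le (hDut.sub (hFm (ξ t) t)) (hFm (ξ ρ - ξ t) t)
      have h5 := meanSq_le hr0 hj2.le (hDut.sub (hFm (ξ ρ) t))
      have h6 : (t / r) ^ d ≤ 2 ^ d := by
        gcongr
        rwa [div_le_iff₀ hr0]
      have h7 : t ^ (2 * α) ≤ 4 * r ^ (2 * α) :=
        (Real.rpow_le_rpow ht0.le ht2 (by linarith)).trans (rpow_two_mul_le hα1 hr0.le)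
      simp only [Pi.sub_def] at h4 h5
      rw [← e] at h4
      have h8 : meanSq x₀ t (fun x => Du x - correctedGrad Am Ap Dφ (ξ ρ) x)
          ≤ (2 + 2 * C₁ * C₃ ^ 2) * (K * t ^ (2 * α)) := by
        have : C₁ * ‖ξ ρ - ξ t‖ ^ 2 ≤ C₁ * (C₃ ^ 2 * (K * t ^ (2 * α))) := by gcongr
        linarith
      calc _ ≤ (t / r) ^ d * meanSq x₀ t (fun x => Du x - correctedGrad Am Ap Dφ (ξ ρ) x) := h5
        _ ≤ 2 ^ d * ((2 + 2 * C₁ * C₃ ^ 2) * (K * t ^ (2 * α))) := by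
          gcongr
          exact meanSq_nonneg _ _ _
        _ ≤ 2 ^ d * ((2 + 2 * C₁ * C₃ ^ 2) * (K * (4 * r ^ (2 * α)))) := by gcongr
        _ = _ := by
          rw [hK, Real.div_rpow hr0.le hρ0.le]; ring)
  -- The vector `η` gives `E ≤ E / 4`, contradicting `E > 0`.
  have := excess_le Am Ap Dφ Du x₀ ρ η
  linarith

/-- At a radius `ρ` almost maximizing `(R/t)^(2α)` times the excess, all larger radii satisfy the
hypothesis of `exists_scale_bound`. Hence `R/ρ` is bounded and the maximum is controlled by
comparing volumes between `ρ` and `R`. -/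
theorem exists_excess_decay (d : ℕ) [NeZero d] (hlam : 0 < lam) {α : ℝ} (hα : 0 < α)
    (hα1 : α < 1) : ∃ C δ : ℝ, 0 < C ∧ 0 < δ ∧
    ∀ (a : CoeffField d) (Am Ap : Matrix (Fin d) (Fin d) ℝ) (φ : Fin d → Space d → ℝ)
      (Dφ : Fin d → Space d → Space d) (σ : Fin d → Fin d → Fin d → Space d → ℝ) (x₀ : Space d)
      (r₁ r₂ : ℝ), HasSmallCorrector lam a Am Ap φ Dφ σ x₀ r₁ r₂ δ →
      ∀ (R : ℝ), R ≤ r₂ → ∀ (u : Space d → ℝ) (Du : Space d → Space d),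
      IsHarmonicOn a (Metric.ball x₀ R) u Du → ∀ r ∈ Icc r₁ R,
      excess Am Ap Dφ Du x₀ r ≤ C * (r / R) ^ (2 * α) * excess Am Ap Dφ Du x₀ R := by
  obtain ⟨N, δ, hN, hδ, hscale⟩ := exists_scale_bound d hlam hα hα1
  -- The `2` is the loss in choosing an almost maximizer, and `(R/ρ)^(d + 2α) ≤ (4N)^(d + 2)`
  -- collects the weight and the volume ratio.
  refine ⟨2 * (4 * N) ^ (d + 2 : ℝ), δ, by positivity, hδ, ?_⟩
  intro a Am Ap φ Dφ σ x₀ r₁ r₂ hc R hR u Du hu r hr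
  have hr0 : 0 < r := hc.pos.trans_le hr.1
  have hR0 : 0 < R := hr0.trans_le hr.2
  have hDum := hu.h1.memLp_grad
  set E := excess Am Ap Dφ Du x₀ with hE
  have hE0 : ∀ t, 0 ≤ E t := excess_nonneg Am Ap Dφ Du x₀
  have hmono : ∀ t ∈ Icc r₁ R, E t ≤ (R / t) ^ d * E R := fun t ht =>
    hc.excess_mono hlam (hc.pos.trans_le ht.1) ht.2 hDum
  set h : ℝ → ℝ := fun t => (R / t) ^ (2 * α) * E t with hh
  have hh0 : ∀ t ∈ Icc r₁ R, 0 ≤ h t := fun t ht => by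
    have := hc.pos.trans_le ht.1
    exact mul_nonneg (by positivity) (hE0 t)
  suffices hmain : h r ≤ 2 * (4 * N) ^ (d + 2 : ℝ) * E R by
    have e : E r = (r / R) ^ (2 * α) * h r := by
      rw [hh]
      dsimp only
      rw [← mul_assoc, ← Real.mul_rpow (by positivity) (by positivity),
        div_mul_div_cancel₀ hR0.ne', div_self hr0.ne', Real.one_rpow, one_mul]
    calc E r = (r / R) ^ (2 * α) * h r := e
      _ ≤ (r / R) ^ (2 * α) * (2 * (4 * N) ^ (d + 2 : ℝ) * E R) := by gcongr
      _ = _ := by ring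
  have hbdd : BddAbove (h '' Icc r₁ R) := by
    refine ⟨(R / r₁) ^ (2 * α) * ((R / r₁) ^ d * E R), ?_⟩
    rintro _ ⟨t, ht, rfl⟩
    have ht0 := hc.pos.trans_le ht.1
    have hp := hc.pos
    have h1 : R / t ≤ R / r₁ := by gcongr; exact ht.1
    calc h t ≤ (R / t) ^ (2 * α) * ((R / t) ^ d * E R) := by
          exact mul_le_mul_of_nonneg_left (hmono t ht) (by positivity)
      _ ≤ _ := by
          have := hE0 R
          gcongr
  set S := sSup (h '' Icc r₁ R) with hS
  have hrS : ∀ t ∈ Icc r₁ R, h t ≤ S := fun t ht => le_csSup hbdd (mem_image_of_mem h ht)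
  have hER : 0 ≤ 2 * (4 * N) ^ (d + 2 : ℝ) * E R := by have := hE0 R; positivity
  rcases le_or_gt S 0 with hS0 | hS0
  · exact ((hrS r hr).trans hS0).trans hER
  -- The supremum need not be attained; a radius with more than half of it suffices, and accounts
  -- for the factor `2` allowed in the scale bound.
  obtain ⟨_, ⟨ρ, hρ, rfl⟩, hρS⟩ := exists_lt_of_lt_csSup ((nonempty_of_mem hr).image h)
    (half_lt_self hS0)
  have hρ0 : 0 < ρ := hc.pos.trans_le hρ.1
  have hEρ : 0 < E ρ := by
    have : 0 < h ρ := by linarith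
    exact pos_of_mul_pos_right this (by positivity)
  have hRρ := hscale a Am Ap φ Dφ σ x₀ r₁ r₂ hc ρ R hρ.1 hR u Du hu hEρ (by
    intro t ht
    have ht0 := hρ0.trans_le ht.1
    have h1 : h t ≤ 2 * h ρ := by linarith [hrS t ⟨hρ.1.trans ht.1, ht.2⟩]
    have h2 : (R / t) ^ (2 * α) * E t
        ≤ (R / t) ^ (2 * α) * (2 * (t / ρ) ^ (2 * α) * E ρ) := by
      refine h1.trans_eq ?_
      rw [hh]
      dsimp only
      rw [← div_mul_div_cancel₀ ht0.ne' (a := R) (c := ρ),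
        Real.mul_rpow (by positivity) (by positivity)]
      ring
    exact le_of_mul_le_mul_left h2 (by positivity))
  have hq : R / ρ ≤ 4 * N := by rw [div_le_iff₀ hρ0]; exact hRρ.le
  have hq1 : 1 ≤ R / ρ := (one_le_div hρ0).2 hρ.2
  calc h r ≤ 2 * h ρ := by linarith [hrS r hr]
    _ ≤ 2 * ((R / ρ) ^ (2 * α) * ((R / ρ) ^ d * E R)) := by
      gcongr
      exact mul_le_mul_of_nonneg_left (hmono ρ hρ) (by positivity)
    _ = 2 * ((R / ρ) ^ (d + 2 * α) * E R) := by
      rw [Real.rpow_add (by positivity), Real.rpow_natCast]; ring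
    _ ≤ 2 * ((4 * N) ^ (d + 2 : ℝ) * E R) := by
      have h1 : (R / ρ) ^ (d + 2 * α) ≤ (4 * N) ^ (d + 2 : ℝ) :=
        (Real.rpow_le_rpow_of_exponent_le hq1 (by linarith)).trans
          (Real.rpow_le_rpow (by positivity) hq (by positivity))
      have := hE0 R
      gcongr
    _ = _ := by ring

/-- By excess decay `Du` is close to a corrected gradient at every scale, and the vectors `ξ` drift
by a summable amount. At a scale comparable to `R`, non-degeneracy bounds `ξ` by the energy of `Du`;
this bound is carried down to scale `r` and converted back by the upper bound on corrected
gradients. -/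
theorem exists_lipschitz_estimate (d : ℕ) [NeZero d] (hlam : 0 < lam) : ∃ C δ : ℝ, 0 < C ∧ 0 < δ ∧
    ∀ (a : CoeffField d) (Am Ap : Matrix (Fin d) (Fin d) ℝ) (φ : Fin d → Space d → ℝ)
      (Dφ : Fin d → Space d → Space d) (σ : Fin d → Fin d → Fin d → Space d → ℝ) (x₀ : Space d)
      (r₁ r₂ : ℝ), HasSmallCorrector lam a Am Ap φ Dφ σ x₀ r₁ r₂ δ →
      ∀ (R : ℝ), R ≤ r₂ → ∀ (u : Space d → ℝ) (Du : Space d → Space d),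
      IsHarmonicOn a (Metric.ball x₀ R) u Du → ∀ r ∈ Icc r₁ R,
      meanSq x₀ r Du ≤ C * meanSq x₀ R Du := by
  -- Any fixed exponent would do; only summability over dyadic scales is needed.
  obtain ⟨α, hα, hα1⟩ : ∃ α : ℝ, 0 < α ∧ α < 1 := ⟨1 / 2, by norm_num, by norm_num⟩
  obtain ⟨C₁, hC₁, hupper⟩ := exists_meanSq_correctedGrad_le d hlam
  obtain ⟨C₂, δ₂, hC₂, hδ₂, hlower⟩ := exists_le_meanSq_correctedGrad d hlam
  obtain ⟨C₄, δ₄, hC₄, hδ₄, hdecay⟩ := exists_excess_decay d hlam hα hα1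
  set C₃ := √(C₂ * (2 + 8 * 2 ^ d)) / (2 ^ α - 1) with hC₃
  have hC₃0 : 0 ≤ C₃ := div_nonneg (Real.sqrt_nonneg _)
    (sub_nonneg.2 (Real.one_lt_rpow (by norm_num) hα).le)
  set C₅ := 2 * (C₂ * (4 * C₄ + 2 * 4 ^ d)) + 4 * C₃ ^ 2 * C₄ with hC₅
  refine ⟨4 * C₄ + 2 * C₁ * C₅ + 2 ^ d, min 1 (min δ₂ δ₄), by positivity, by positivity, ?_⟩
  intro a Am Ap φ Dφ σ x₀ r₁ r₂ hc R hR u Du hu r hr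
  have hc1 := hc.mono (min_le_left _ _)
  have hc2 := hc.mono ((min_le_right _ _).trans (min_le_left _ _))
  have hc4 := hc.mono ((min_le_right _ _).trans (min_le_right _ _))
  have hr0 : 0 < r := hc.pos.trans_le hr.1
  have hR0 : 0 < R := hr0.trans_le hr.2
  have hDum := hu.h1.memLp_grad
  set M := meanSq x₀ R Du with hM
  have hM0 : 0 ≤ M := meanSq_nonneg _ _ _
  rcases lt_or_ge R (2 * r) with h2r | h2r
  · refine (meanSq_le hr0 hr.2 hDum).trans ?_
    refine mul_le_mul_of_nonneg_right ?_ hM0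
    have h1 : (R / r) ^ d ≤ 2 ^ d := by
      gcongr
      rw [div_le_iff₀ hr0]; exact h2r.le
    have h2 : 0 ≤ 4 * C₄ + 2 * C₁ * C₅ := by positivity
    linarith
  -- Zero energy is treated apart because the selection of `ξ` below needs a strictly positive
  -- bound.
  rcases hM0.eq_or_lt with hM0' | hMpos
  · have := meanSq_le hr0 hr.2 hDum
    rw [← hM, ← hM0', mul_zero] at this
    rw [← hM0', mul_zero]
    exact this
  have hFm := fun ξ r => hc.memLp_correctedGrad hlam ξ r
  set K := 2 * C₄ * M / R ^ (2 * α) with hK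
  have hK0 : 0 ≤ K := by positivity
  have hKR : K * R ^ (2 * α) = 2 * C₄ * M := by
    rw [hK]; exact div_mul_cancel₀ _ (by positivity)
  have hKt : ∀ t, 0 ≤ t → t ≤ R → K * t ^ (2 * α) ≤ 2 * C₄ * M := fun t ht htR => by
    rw [← hKR]; gcongr
  have hξ : ∀ t ∈ Icc r R, ∃ ξ, meanSq x₀ t (fun x => Du x - correctedGrad Am Ap Dφ ξ x)
      ≤ K * t ^ (2 * α) := by
    intro t ht
    have ht0 : 0 < t := hr0.trans_le ht.1
    have h1 := hdecay a Am Ap φ Dφ σ x₀ r₁ r₂ hc4 R hR u Du hu t ⟨hr.1.trans ht.1, ht.2⟩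
    have h2 := excess_le_meanSq Am Ap Dφ Du x₀ R
    have e : K * t ^ (2 * α) = 2 * (C₄ * (t / R) ^ (2 * α) * M) := by
      rw [hK, Real.div_rpow ht0.le hR0.le]; ring
    have h3 : 0 < C₄ * (t / R) ^ (2 * α) * M := by positivity
    have h4 : C₄ * (t / R) ^ (2 * α) * excess Am Ap Dφ Du x₀ R ≤ C₄ * (t / R) ^ (2 * α) * M := by
      gcongr
    obtain ⟨ξ, hξ⟩ := exists_meanSq_lt_of_excess_lt
      (show excess Am Ap Dφ Du x₀ t < K * t ^ (2 * α) by linarith)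
    exact ⟨ξ, hξ.le⟩
  choose! ξ hξ using hξ
  -- The dyadic radius `t = 2 ^ j * r` lies in `(R/4, R/2]`, so passing from `t` to `R` costs at
  -- most `4 ^ d`.
  obtain ⟨j, hj1, hj2⟩ := exists_dyadic hr0 (by linarith : r ≤ R / 2)
  have hdy := norm_sub_le_of_dyadic hα hα1 hr0 hC₂.le (correctedGrad_sub Am Ap Dφ)
    (fun ξ => hFm ξ R) (fun t ht => hlower a Am Ap φ Dφ σ x₀ r₁ r₂ hc2 t
      ⟨hr.1.trans ht.1, by linarith [ht.2]⟩) hDum hξ j (by linarith)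
  have hrt : r ≤ 2 ^ j * r := le_mul_of_one_le_left hr0.le (one_le_pow₀ one_le_two)
  set t := 2 ^ j * r with ht
  have ht0 : 0 < t := by positivity
  have htR : t ≤ R := by linarith
  have h1 : ‖ξ t - ξ r‖ ^ 2 ≤ C₃ ^ 2 * (2 * C₄ * M) := by
    calc ‖ξ t - ξ r‖ ^ 2 ≤ (C₃ * √K * t ^ α) ^ 2 := by gcongr
      _ = C₃ ^ 2 * (K * t ^ (2 * α)) := by
        rw [mul_pow, mul_pow, Real.sq_sqrt hK0, sq_rpow ht0.le]; ring
      _ ≤ _ := mul_le_mul_of_nonneg_left (hKt t ht0.le htR) (sq_nonneg _)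
  have hDut := memLp_ball_mono hDum htR
  have h2 : ‖ξ t‖ ^ 2 ≤ C₂ * (4 * C₄ + 2 * 4 ^ d) * M := by
    have e : correctedGrad Am Ap Dφ (ξ t)
        = fun x => Du x - (Du x - correctedGrad Am Ap Dφ (ξ t) x) := by
      ext1 x; abel
    have h3 := hlower a Am Ap φ Dφ σ x₀ r₁ r₂ hc2 t ⟨hr.1.trans hrt, htR.trans hR⟩ (ξ t)
    have h4 := meanSq_sub_le hDut (hDut.sub (hFm (ξ t) t))
    have h5 : meanSq x₀ t Du ≤ 4 ^ d * M := by
      refine (meanSq_le ht0 htR hDum).trans ?_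
      gcongr
      rw [div_le_iff₀ ht0]; linarith
    have h6 := (hξ t ⟨hrt, htR⟩).trans (hKt t ht0.le htR)
    simp only [Pi.sub_def] at h4
    rw [← e] at h4
    calc ‖ξ t‖ ^ 2 ≤ C₂ * meanSq x₀ t (correctedGrad Am Ap Dφ (ξ t)) := h3
      _ ≤ C₂ * (2 * (4 ^ d * M) + 2 * (2 * C₄ * M)) := by gcongr; linarith
      _ = _ := by ring
  have h3 : ‖ξ r‖ ^ 2 ≤ C₅ * M := by
    have h4 : ‖ξ r‖ ≤ ‖ξ t‖ + ‖ξ t - ξ r‖ := by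
      have := norm_sub_le (ξ t) (ξ t - ξ r)
      rwa [sub_sub_cancel] at this
    have h5 : ‖ξ r‖ ^ 2 ≤ 2 * ‖ξ t‖ ^ 2 + 2 * ‖ξ t - ξ r‖ ^ 2 := by
      nlinarith [norm_nonneg (ξ r), sq_nonneg (‖ξ t‖ - ‖ξ t - ξ r‖)]
    rw [hC₅]
    linarith
  -- The sign lets `Du` be written as a difference, so that `meanSq_sub_le` applies; the required `2
  -- * r ≤ r₂` holds because `2 * r ≤ R`.
  have h4 := hupper a Am Ap φ Dφ σ x₀ r₁ r₂ hc1 r hr.1 (by linarith) (-ξ r)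
  rw [norm_neg] at h4
  have hDur := memLp_ball_mono hDum hr.2
  have h5 := meanSq_sub_le (hDur.sub (hFm (ξ r) r)) (hFm (-ξ r) r)
  have e : Du = fun x => (Du - correctedGrad Am Ap Dφ (ξ r)) x - correctedGrad Am Ap Dφ (-ξ r) x := by
    ext1 x
    have h0 := correctedGrad_sub Am Ap Dφ (ξ r) (ξ r) x
    have h6 := correctedGrad_sub Am Ap Dφ 0 (ξ r) x
    have h7 : correctedGrad Am Ap Dφ 0 x = 0 := by simp [correctedGrad]
    rw [zero_sub, h7, zero_sub] at h6
    rw [h6]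
    simp
  rw [← e] at h5
  have h6 := (hξ r ⟨le_rfl, hr.2⟩).trans (hKt r hr0.le hr.2)
  simp only [Pi.sub_def] at h5
  have h7 : C₁ * ‖ξ r‖ ^ 2 ≤ C₁ * (C₅ * M) := by gcongr
  have h8 : 0 ≤ 2 ^ d * M := by positivity
  linarith

end Regularity

end

/-! ### Choice of a common constant for the three estimates -/

theorem theorem2 (d : ℕ) [NeZero d] (hd : 2 ≤ d) (lam : ℝ) (hlam : 0 < lam)
    (α : ℝ) (hα : α ∈ Set.Ioo (0 : ℝ) 1) :
    ∃ δ : ℝ, 0 < δ ∧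
      ∀ (aMinus aCirc aPlus : CoeffField d) (abarMinus abarPlus : Matrix (Fin d) (Fin d) ℝ)
        (φ : Fin d → Space d → ℝ) (Dφ : Fin d → Space d → Space d)
        (σ : Fin d → Fin d → Fin d → Space d → ℝ),
        IsEllipticField lam (layeredField aMinus aCirc aPlus) →
        IsEllipticMatrix lam abarMinus → IsEllipticMatrix lam abarPlus →
        IsUngaugedCorrector (layeredField aMinus aCirc aPlus) abarMinus abarPlus φ Dφ σ →
        ∀ (x₀ : Space d) (rstar rmax : ℝ), 0 < rstar → rstar < rmax →
          (∀ r ∈ Set.Icc rstar rmax, correctorOsc φ σ x₀ r ≤ δ) →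
          -- excess decay
          (∀ R ∈ Set.Icc rstar rmax, ∀ (u : Space d → ℝ) (Du : Space d → Space d),
            IsHarmonicOn (layeredField aMinus aCirc aPlus) (Metric.ball x₀ R) u Du →
            ∀ r ∈ Set.Icc rstar R,
              excess abarMinus abarPlus Dφ Du x₀ r
                ≤ δ⁻¹ * (r / R) ^ (2 * α) * excess abarMinus abarPlus Dφ Du x₀ R) ∧
          -- non-degeneracy of the corrector
          (∀ (ξ : Space d), ∀ r ∈ Set.Icc rstar (rmax / 2),
            δ * ‖ξ‖ ^ 2
                ≤ ⨍ x in Metric.ball x₀ r, ‖correctedGrad abarMinus abarPlus Dφ ξ x‖ ^ 2 ∧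
              ⨍ x in Metric.ball x₀ r, ‖correctedGrad abarMinus abarPlus Dφ ξ x‖ ^ 2
                ≤ δ⁻¹ * ‖ξ‖ ^ 2) ∧
          -- large-scale Lipschitz estimate
          (∀ R ∈ Set.Icc rstar rmax, ∀ (u : Space d → ℝ) (Du : Space d → Space d),
            IsHarmonicOn (layeredField aMinus aCirc aPlus) (Metric.ball x₀ R) u Du →
            ∀ r ∈ Set.Icc rstar R,
              ⨍ x in Metric.ball x₀ r, ‖Du x‖ ^ 2
                ≤ δ⁻¹ * ⨍ x in Metric.ball x₀ R, ‖Du x‖ ^ 2) := by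

  obtain ⟨C₁, hC₁, hupper⟩ := exists_meanSq_correctedGrad_le d hlam
  obtain ⟨C₂, δ₂, hC₂, hδ₂, hlower⟩ := exists_le_meanSq_correctedGrad d hlam
  obtain ⟨C₃, δ₃, hC₃, hδ₃, hdecay⟩ := exists_excess_decay d hlam hα.1 hα.2
  obtain ⟨C₄, δ₄, hC₄, hδ₄, hlip⟩ := exists_lipschitz_estimate d hlam
  -- One number has to serve as oscillation threshold and as inverse constant, so it lies below all
  -- thresholds and below the reciprocals of all constants.
  obtain ⟨δ, hδ, hle⟩ : ∃ δ : ℝ, 0 < δ ∧ ∀ c ∈ [1, δ₂, δ₃, δ₄, C₁⁻¹, C₂⁻¹, C₃⁻¹, C₄⁻¹], δ ≤ c :=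
    ⟨min 1 (min δ₂ (min δ₃ (min δ₄ (min C₁⁻¹ (min C₂⁻¹ (min C₃⁻¹ C₄⁻¹)))))), by positivity,
      by simp⟩
  simp only [List.mem_cons, List.not_mem_nil, or_false, forall_eq_or_imp, forall_eq] at hle
  obtain ⟨h1, h2, h3, h4, h5, h6, h7, h8⟩ := hle
  have hinv : ∀ {C : ℝ}, 0 < C → δ ≤ C⁻¹ → C ≤ δ⁻¹ := fun hC h => (le_inv_comm₀ hδ hC).1 h
  refine ⟨δ, hδ, fun aMinus aCirc aPlus Am Ap φ Dφ σ ha hm hp hcor x₀ rstar rmax hr hrr hosc => ?_⟩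
  have hc : HasSmallCorrector lam (layeredField aMinus aCirc aPlus) Am Ap φ Dφ σ x₀ rstar rmax δ :=
    ⟨ha, hm, hp, hcor, hr, hosc⟩
  refine ⟨fun R hR u Du hu r hrR => ?_, fun ξ r hrm => ⟨?_, ?_⟩, fun R hR u Du hu r hrR => ?_⟩
  · refine (hdecay _ _ _ _ _ _ _ _ _ (hc.mono h3) R hR.2 u Du hu r hrR).trans ?_
    have hr0 : 0 < r := hr.trans_le hrR.1
    have hR0 : 0 < R := hr0.trans_le hrR.2
    have := excess_nonneg Am Ap Dφ Du x₀ R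
    gcongr
    exact hinv hC₃ h7
  · have h9 := hlower _ _ _ _ _ _ _ _ _ (hc.mono h2) r ⟨hrm.1, by linarith [hrm.2]⟩ ξ
    calc δ * ‖ξ‖ ^ 2 ≤ C₂⁻¹ * ‖ξ‖ ^ 2 := by gcongr
      _ ≤ meanSq x₀ r (correctedGrad Am Ap Dφ ξ) := (inv_mul_le_iff₀ hC₂).2 h9
  · have h9 := hupper _ _ _ _ _ _ _ _ _ (hc.mono h1) r hrm.1 (by linarith [hrm.2]) ξ
    refine h9.trans ?_
    gcongr
    exact hinv hC₁ h5
  · have h9 := hlip _ _ _ _ _ _ _ _ _ (hc.mono h4) R hR.2 u Du hu r hrR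
    refine h9.trans ?_
    have := meanSq_nonneg x₀ R Du
    exact mul_le_mul_of_nonneg_right (hinv hC₄ h8) this
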